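/- Let $d\ge 4$ and $\omega_0\in\mathbb R^d$. On $\mathbb R^{2d}\ni(x,y)$ put $r_j=\tfrac12(x_j^2+y_j^2)$, $r=(r_1,\dots,r_d)$. A ($C^n$, $n\ge1$) $k$-dimensional torus in $\mathbb R^{2d}$ is the image of a $C^n$ embedding $\iota:\mathbb R^k/\mathbb Z^k\to\mathbb R^{2d}$; a flow $\Phi^t$ is linear on it, with frequency $\alpha\in\mathbb R^k$, if $\Phi^t(\iota(\theta))=\iota(\theta+t\alpha)$ for all $t,\theta$. There exists $H\in C^\infty(\mathbb R^{2d})$ with $H(x,y)=\langle\omega_0,r\rangle+O(|(x,y)|^3)$ at the origin, whose Hamiltonian flow $\Phi^t_H$ (of $\dot x=\partial_yH$, $\dot y=-\partial_xH$) is defined for all $t\in\mathbb R$, such that the following hold. 1. $\Phi^t_H$ has no invariant torus of dimension $d$, in the following sense: there is no $C^1$ torus of dimension $d$ on which $\Phi_H^t$ is linear and which is Lagrangian or has nonresonant frequency (i.e. $\langle m,\alpha\rangle\ne0$ for all $m\in\mathbb Z^d\setminus\{0\}$); moreover, no $\Phi^t_H$-invariant set homeomorphic to $(\mathbb R/\mathbb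 Z)^d$, whatever the dynamics on it, is disjoint from $\bigcup_i\{r_i=0\}$. 2. For each $i\le d$ the set $\{r_i=0\}$ is foliated by invariant tori of dimension $\le d-1$: each of the sets $\{r=c\}$, $c\in[0,\infty)^d$, $c_i=0$, is a $C^\infty$ torus of dimension $\le d-1$ on which $\Phi^t_H$ is linear. 3. Every other orbit, i.e. that of each $p$ with $r_i(p)\ne0$ for all $i$, accumulates on one of the sets $\{r_i=0\}$ or at infinity: there are times $t_n$ with $|t_n|\to\infty$ such that either $\Phi_H^{t_n}(p)$ converges to a point of some $\{r_i=0\}$, or $|\Phi_H^{t_n}(p)|\to\infty$. 4. If the coordinates of $\omega_0$ are not all of the same sign, i.e. $\omega_{0,i}<0<\omega_{0,j}$ for some $i,j$, then $\Phi^t_H$ is diffusive: for every $A>0$ there are $p\in\mathbb R^{2d}$ and $t_1,t_2\in\mathbb R$ with $|\Phi_H^{t_1}(p)|\le A^{-1}$ and $|\Phi_H^{t_2}(p)|\ge A$. -/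

import Mathlib

open scoped ContDiff Topology

noncomputable section

/-- The phase space `ℝ^{2d}` with points `z = (x, y)`. (All notions below are insensitive to
replacing the norm by an equivalent one.) -/
abbrev Phase (d : ℕ) : Type := (Fin d → ℝ) × (Fin d → ℝ)

/-- The action `r_j = (x_j² + y_j²) / 2`. -/
def action {d : ℕ} (j : Fin d) (z : Phase d) : ℝ := (z.1 j ^ 2 + z.2 j ^ 2) / 2

/-- The quadratic form `⟨w, r⟩ = ∑ w_j r_j`. -/
def quadPart {d : ℕ} (w : Fin d → ℝ) (z : Phase d) : ℝ := ∑ j, w j * action j z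

/-- The Hamiltonian vector field `X_H = (∂_y H, -∂_x H)`. -/
def hamVectorField {d : ℕ} (H : Phase d → ℝ) (z : Phase d) : Phase d :=
  (fun j => fderiv ℝ H z (0, Pi.single j 1), fun j => - fderiv ℝ H z (Pi.single j 1, 0))

/-- `Φ` is the (complete) flow of `X_H`: for each `z`, the curve `t ↦ Φ t z` is defined for all
times and is the integral curve of `X_H` through `z`. -/
def IsHamFlow {d : ℕ} (H : Phase d → ℝ) (Φ : ℝ → Phase d → Phase d) : Prop :=
  ∀ z, Φ 0 z = z ∧ ∀ t, HasDerivAt (fun s => Φ s z) (hamVectorField H (Φ t z)) t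

/-- The standard symplectic form on `ℝ^{2d}`. -/
def sympForm {d : ℕ} (u v : Phase d) : ℝ := ∑ j, (u.1 j * v.2 j - u.2 j * v.1 j)

/-- `ι : ℝ^k → ℝ^{2d}` induces a `C^n` embedding of the torus `ℝ^k / ℤ^k` (`n ≥ 1`; `n = ⊤` in `ℕ∞` means smooth): it is `C^n`,
two points have the same image exactly when they differ by an integer vector, and it is an
immersion. -/
def IsTorusEmbedding {d k : ℕ} (n : ℕ∞) (ι : (Fin k → ℝ) → Phase d) : Prop :=
  ContDiff ℝ n ι ∧
  (∀ θ θ', ι θ = ι θ' ↔ ∃ m : Fin k → ℤ, θ' = θ + fun j => (m j : ℝ)) ∧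
  ∀ θ, Function.Injective (fderiv ℝ ι θ)

/-- The flow acts on the torus parametrized by `ι` as the translation flow `θ ↦ θ + t α`. -/
def IsLinearFlowOn {d k : ℕ} (Φ : ℝ → Phase d → Phase d) (ι : (Fin k → ℝ) → Phase d)
    (α : Fin k → ℝ) : Prop :=
  ∀ t θ, Φ t (ι θ) = ι (θ + t • α)

/-- The symplectic form vanishes on the tangent spaces of the torus parametrized by `ι`; for
`k = d` this says that the torus is Lagrangian. -/
def IsIsotropic {d k : ℕ} (ι : (Fin k → ℝ) → Phase d) : Prop :=
  ∀ θ u v, sympForm (fderiv ℝ ι θ u) (fderiv ℝ ι θ v) = 0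

/-- `⟨m, α⟩ ≠ 0` for every nonzero integer vector `m`. -/
def IsNonresonant {k : ℕ} (α : Fin k → ℝ) : Prop :=
  ∀ m : Fin k → ℤ, m ≠ 0 → ∑ j, (m j : ℝ) * α j ≠ 0

/-- The curve `γ` has a limit point in `S` along times going to infinity (forward or backward). -/
def AccumulatesOn {d : ℕ} (γ : ℝ → Phase d) (S : Set (Phase d)) : Prop :=
  ∃ q ∈ S, ∃ t : ℕ → ℝ, Filter.Tendsto (fun n => |t n|) Filter.atTop Filter.atTop ∧
    Filter.Tendsto (fun n => γ (t n)) Filter.atTop (𝓝 q)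

/-- The curve `γ` goes to infinity along a sequence of times. -/
def AccumulatesAtInfinity {d : ℕ} (γ : ℝ → Phase d) : Prop :=
  ∃ t : ℕ → ℝ, Filter.Tendsto (fun n => |t n|) Filter.atTop Filter.atTop ∧
    Filter.Tendsto (fun n => ‖γ (t n)‖) Filter.atTop Filter.atTop

/-- For every `A > 0` some orbit visits both `{‖z‖ ≤ 1/A}` and `{‖z‖ ≥ A}`. -/
def IsDiffusive {d : ℕ} (Φ : ℝ → Phase d → Phase d) : Prop :=
  ∀ A : ℝ, 0 < A → ∃ (p : Phase d) (t₁ t₂ : ℝ), ‖Φ t₁ p‖ ≤ A⁻¹ ∧ A ≤ ‖Φ t₂ p‖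

end

/-!
Anosov–Katok construction. Fix an index `q` and consider the integrable Hamiltonians
`h = ∑ w_i(r_q) r_i`, conjugated by symplectic maps `e` that preserve `r_q` and fix every
`{r_i = 0}` pointwise. On a zone of values of `r_q` the frequency curve `w` runs on a segment.
When `d ≥ 4`, the two end points of this segment, perturbed arbitrarily little, are orthogonal to
a common integer vector `k ≠ 0` with `k_q = 0`, so `h` is constant along `k` in the space of
actions. A symplectic map `f` that moves the actions along `k` in this zone then leaves `h`
invariant, and replacing `e` by `e ∘ f` changes nothing. A second tiny perturbation of `w` makes
the monomial `Z^k` rotate, at a slow but nonzero speed. Every orbit of `h` in the zone now meets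
the points that `f` pushes along `k` or `-k` out of any prescribed compact subset of
`{r_i ≠ 0 for all i}`, and so every orbit of the new Hamiltonian in the zone leaves that set. If
`ω₀` has coordinates of both signs, `k` may be chosen nonnegative near the origin, and `f`
carries points near the origin far away.

The perturbations are so small that Hamiltonians and flows converge, and each zone is treated
infinitely often. On `{r_i = 0}` no conjugation acts, so the limit flow rotates the tori
`{r = c}`. A torus with linear flow meeting `{r_i ≠ 0 for all i}` would contain an orbit
accumulating at a point of some `{r_i = 0}`; linear flows being isometric, the orbit of this
point would accumulate at the starting point of the first one, although `{r_i = 0}` is closed and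
invariant. So a `d`-torus with linear flow lies in `⋃ {r_i = 0}`, where the actions are
invariant. This is incompatible with a Lagrangian tangent space, and also with a nonresonant
frequency, for which the actions would be constant on the torus and the torus Lagrangian.
-/

noncomputable section

section TimeOneMap

open Set unitInterval MeasureTheory NNReal

universe u

section Composition

variable {K : Type*} [TopologicalSpace K] [CompactSpace K] {E F : Type*} [NormedAddCommGroup E]
  [NormedSpace ℝ E] [NormedAddCommGroup F] [NormedSpace ℝ F]

theorem norm_mk_clm_apply_le (A : C(K, E →L[ℝ] F)) (η : C(K, E)) :
    ‖(⟨fun t => A t (η t), A.continuous.clm_apply η.continuous⟩ : C(K, F))‖ ≤ ‖A‖ * ‖η‖ :=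
  (ContinuousMap.norm_le _ (by positivity)).2 fun t =>
    ((A t).le_opNorm _).trans (by gcongr; exacts [A.norm_coe_le_norm t, η.norm_coe_le_norm t])

/-- Pointwise application of a continuous family of operators to a continuous family of vectors;
this is the shape of the derivative of postcomposition. -/
def pointwiseApply (A : C(K, E →L[ℝ] F)) : C(K, E) →L[ℝ] C(K, F) :=
  LinearMap.mkContinuous
    { toFun := fun η => ⟨fun t => A t (η t), A.continuous.clm_apply η.continuous⟩
      map_add' := fun η ξ => by ext t; simp
      map_smul' := fun c η => by ext t; simp } ‖A‖ (norm_mk_clm_apply_le A)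

theorem norm_pointwiseApply_le (A : C(K, E →L[ℝ] F)) : ‖pointwiseApply A‖ ≤ ‖A‖ :=
  LinearMap.mkContinuous_norm_le _ (norm_nonneg A) _

variable (K E F) in
theorem isBoundedLinearMap_pointwiseApply :
    IsBoundedLinearMap ℝ (pointwiseApply : C(K, E →L[ℝ] F) → C(K, E) →L[ℝ] C(K, F)) where
  map_add A B := by ext η t; rfl
  map_smul c A := by ext η t; rfl
  bound := ⟨1, one_pos, fun A => by simpa using norm_pointwiseApply_le A⟩

theorem hasFDerivAt_continuousMap_comp {X : C(E, F)} {X' : C(E, E →L[ℝ] F)}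
    (h : ∀ x, HasFDerivAt X (X' x) x) (γ : C(K, E)) :
    HasFDerivAt (fun γ : C(K, E) => X.comp γ) (pointwiseApply (X'.comp γ)) γ := by
  rw [hasFDerivAt_iff_isLittleO_nhds_zero, Asymptotics.isLittleO_iff]
  intro c hc
  have hunif := (isCompact_range γ.continuous).uniformContinuousAt_of_continuousAt X'
    (fun a _ => X'.continuous.continuousAt) (Metric.dist_mem_uniformity hc)
  obtain ⟨δ, hδ, hunif⟩ := Metric.mem_uniformity_dist.1 hunif
  filter_upwards [Metric.ball_mem_nhds (0 : C(K, E)) hδ] with η hη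
  refine (ContinuousMap.norm_le _ (by positivity)).2 fun t => ?_
  have hηt : ‖η t‖ < δ := (η.norm_coe_le_norm t).trans_lt (by simpa using hη)
  have hX'_near : ∀ x ∈ Metric.ball (γ t) δ, ‖X' x - X' (γ t)‖ ≤ c := fun x hx => by
    rw [← dist_eq_norm, dist_comm]
    exact (hunif (by rw [dist_comm]; exact hx) (mem_range_self t)).le
  have hmean := (convex_ball (γ t) δ).norm_image_sub_le_of_norm_hasFDerivWithin_le'
    (fun x _ => (h x).hasFDerivWithinAt) hX'_near (x := γ t) (y := γ t + η t)
    (by simpa using hδ) (by simpa using hηt)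
  rw [add_sub_cancel_left] at hmean
  exact hmean.trans (mul_le_mul_of_nonneg_left (η.norm_coe_le_norm t) hc.le)

end Composition

theorem contDiff_nat_continuousMap_comp {K : Type*} [TopologicalSpace K] [CompactSpace K]
    {E : Type u} [NormedAddCommGroup E] [NormedSpace ℝ E] (n : ℕ) :
    ∀ {F : Type u} [NormedAddCommGroup F] [NormedSpace ℝ F] (X : C(E, F)),
      ContDiff ℝ ∞ X → ContDiff ℝ n (fun γ : C(K, E) => X.comp γ) := by
  induction n with
  | zero => exact fun X _ => contDiff_zero.2 X.continuous_postcomp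
  | succ n ih =>
    intro F _ _ X hX
    let X' : C(E, E →L[ℝ] F) := ⟨fderiv ℝ X, hX.continuous_fderiv (by simp)⟩
    rw [Nat.cast_succ, contDiff_succ_iff_hasFDerivAt]
    have happly : ContDiff ℝ n (pointwiseApply : C(K, E →L[ℝ] F) → C(K, E) →L[ℝ] C(K, F)) :=
      (isBoundedLinearMap_pointwiseApply K E F).contDiff
    exact ⟨fun γ => pointwiseApply (X'.comp γ),
      happly.comp (ih X' (hX.fderiv_right (by simp))),
      hasFDerivAt_continuousMap_comp fun x => (hX.differentiable (by simp) x).hasFDerivAt⟩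

section IntegralCurves

variable {E : Type*} [NormedAddCommGroup E] [NormedSpace ℝ E] {X : E → E} {L : ℝ≥0} {γ ξ : ℝ → E}

theorem hasDerivWithinAt_Ici_of_isIntegralCurveOn {X : ℝ → E → E} {a b : ℝ}
    (hγ : IsIntegralCurveOn γ X (Icc a b)) {t : ℝ} (ht : t ∈ Ico a b) :
    HasDerivWithinAt γ (X t (γ t)) (Ici t) t :=
  (hγ t (Ico_subset_Icc_self ht)).mono_of_mem_nhdsWithin (Icc_mem_nhdsGE_of_mem ht)

theorem hasDerivWithinAt_Iic_of_isIntegralCurveOn {X : ℝ → E → E} {a b : ℝ}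
    (hγ : IsIntegralCurveOn γ X (Icc a b)) {t : ℝ} (ht : t ∈ Ioc a b) :
    HasDerivWithinAt γ (X t (γ t)) (Iic t) t :=
  (hγ t (Ioc_subset_Icc_self ht)).mono_of_mem_nhdsWithin (Icc_mem_nhdsLE_of_mem ht)

theorem eqOn_Icc_of_isIntegralCurveOn (hX : LipschitzWith L X) {a b : ℝ}
    (hγ : IsIntegralCurveOn γ (fun _ => X) (Icc a b))
    (hξ : IsIntegralCurveOn ξ (fun _ => X) (Icc a b)) (h : γ a = ξ a) : EqOn γ ξ (Icc a b) :=
  ODE_solution_unique (fun _ => hX) hγ.continuousOn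
    (fun _ => hasDerivWithinAt_Ici_of_isIntegralCurveOn hγ) hξ.continuousOn
    (fun _ => hasDerivWithinAt_Ici_of_isIntegralCurveOn hξ) h

theorem eq_of_isIntegralCurveOn_of_apply_eq_zero (hX : LipschitzWith L X) {a b : ℝ}
    (hγ : IsIntegralCurveOn γ (fun _ => X) (Icc a b)) {t : ℝ} (ht : t ∈ Icc a b)
    (h : X (γ t) = 0) : γ a = γ t := by
  have hγt := hγ.mono (Icc_subset_Icc_right ht.2)
  have hconst : IsIntegralCurve (fun _ => γ t) (fun _ => X) := isIntegralCurve_const fun _ => h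
  exact ODE_solution_unique_of_mem_Icc_left (s := fun _ => univ) (fun _ _ => hX.lipschitzOnWith)
    hγt.continuousOn (fun _ => hasDerivWithinAt_Iic_of_isIntegralCurveOn hγt)
    (fun _ _ => mem_univ _) continuousOn_const
    (fun _ => hasDerivWithinAt_Iic_of_isIntegralCurveOn (hconst.isIntegralCurveOn _))
    (fun _ _ => mem_univ _) rfl (left_mem_Icc.2 ht.1)

theorem isIntegralCurveOn_comp_one_sub (hγ : IsIntegralCurveOn γ (fun _ => X) (Icc 0 1)) :
    IsIntegralCurveOn (fun t => γ (1 - t)) (fun _ x => -X x) (Icc 0 1) := by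
  have hmaps : MapsTo (fun t : ℝ => 1 - t) (Icc 0 1) (Icc 0 1) := fun t ht =>
    ⟨sub_nonneg.2 ht.2, sub_le_self 1 ht.1⟩
  intro t ht
  have hsub : HasDerivWithinAt (fun t : ℝ => 1 - t) (-1) (Icc 0 1) t :=
    ((hasDerivAt_id t).const_sub 1).hasDerivWithinAt
  exact ((hγ (1 - t) (hmaps ht)).scomp t hsub hmaps).congr_deriv (neg_one_smul ℝ _)

end IntegralCurves

section Picard

variable {E : Type u} [NormedAddCommGroup E] [NormedSpace ℝ E]

theorem norm_primitive_IccExtend_le (η : C(I, E)) (t : I) :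
    ‖∫ s in (0 : ℝ)..t, IccExtend zero_le_one η s‖ ≤ ‖η‖ := by
  calc ‖∫ s in (0 : ℝ)..t, IccExtend zero_le_one η s‖ ≤ ‖η‖ * |(t : ℝ) - 0| :=
        intervalIntegral.norm_integral_le_of_norm_le_const fun s _ => η.norm_coe_le_norm _
    _ ≤ ‖η‖ := by
        rw [sub_zero, abs_of_nonneg t.2.1]
        exact mul_le_of_le_one_right (norm_nonneg _) t.2.2

variable (E) in
/-- The primitive of a path on the unit interval, vanishing at time `0`. -/
def pathPrimitive : C(I, E) →L[ℝ] C(I, E) :=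
  LinearMap.mkContinuous
    { toFun := fun η => ⟨fun t => ∫ s in (0 : ℝ)..t, IccExtend zero_le_one η s,
        (intervalIntegral.continuous_primitive (fun a b =>
          (η.continuous.Icc_extend').intervalIntegrable a b) 0).comp continuous_subtype_val⟩
      map_add' := fun η ξ => ContinuousMap.ext fun t =>
        intervalIntegral.integral_add (η.continuous.Icc_extend'.intervalIntegrable _ _)
          (ξ.continuous.Icc_extend'.intervalIntegrable _ _)
      map_smul' := fun c η => ContinuousMap.ext fun t =>
        intervalIntegral.integral_smul c (IccExtend zero_le_one η) } 1
    (fun η => by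
      rw [one_mul]
      exact (ContinuousMap.norm_le _ (norm_nonneg _)).2 (norm_primitive_IccExtend_le η))

theorem norm_pathPrimitive_le : ‖pathPrimitive E‖ ≤ 1 :=
  LinearMap.mkContinuous_norm_le _ zero_le_one _

theorem hasDerivWithinAt_IccExtend_of_sub_pathPrimitive [CompleteSpace E] {g f : C(I, E)} {x : E}
    (h : g - pathPrimitive E f = ContinuousMap.const I x) {t : ℝ} (ht : t ∈ Icc (0 : ℝ) 1) :
    HasDerivWithinAt (IccExtend zero_le_one g) (f ⟨t, ht⟩) (Icc 0 1) t := by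
  have hf : Continuous (IccExtend zero_le_one f) := f.continuous.Icc_extend'
  have hprim : HasDerivAt (fun t => x + ∫ s in (0 : ℝ)..t, IccExtend zero_le_one f s)
      (f ⟨t, ht⟩) t := by
    rw [← IccExtend_of_mem zero_le_one f ht]
    exact (intervalIntegral.integral_hasDerivAt_right (hf.intervalIntegrable _ _)
      (hf.stronglyMeasurableAtFilter _ _) hf.continuousAt).const_add x
  have hg : ∀ s ∈ Icc (0 : ℝ) 1,
      IccExtend zero_le_one g s = x + ∫ r in (0 : ℝ)..s, IccExtend zero_le_one f r := by
    intro s hs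
    rw [IccExtend_of_mem _ _ hs]
    exact sub_eq_iff_eq_add.1 (DFunLike.congr_fun h ⟨s, hs⟩)
  exact hprim.hasDerivWithinAt.congr hg (hg t ht)

theorem apply_zero_of_sub_pathPrimitive {g f : C(I, E)} {x : E}
    (h : g - pathPrimitive E f = ContinuousMap.const I x) : g 0 = x := by
  have h0 : pathPrimitive E f 0 = 0 := intervalIntegral.integral_same
  simpa [h0] using DFunLike.congr_fun h 0

/-- The map `γ ↦ γ - ∫ X(γ)`, whose fibres over constants are the solutions of `γ' = X(γ)`. -/
def picardDefect (X : C(E, E)) (γ : C(I, E)) : C(I, E) := γ - pathPrimitive E (X.comp γ)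

theorem contDiff_picardDefect {X : C(E, E)} (hX : ContDiff ℝ ∞ X) :
    ContDiff ℝ ∞ (picardDefect X) :=
  contDiff_infty.2 fun n =>
    contDiff_id.sub ((pathPrimitive E).contDiff.comp (contDiff_nat_continuousMap_comp n X hX))

theorem hasFDerivAt_picardDefect {X : C(E, E)} {X' : C(E, E →L[ℝ] E)}
    (h : ∀ x, HasFDerivAt X (X' x) x) (γ : C(I, E)) :
    HasFDerivAt (picardDefect X)
      (ContinuousLinearMap.id ℝ C(I, E) - (pathPrimitive E).comp (pointwiseApply (X'.comp γ))) γ :=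
  (hasFDerivAt_id γ).sub
    ((pathPrimitive E).hasFDerivAt.comp γ (hasFDerivAt_continuousMap_comp h γ))

theorem approximatesLinearOn_picardDefect {X : C(E, E)} {L : ℝ≥0} (hL : LipschitzWith L X) :
    ApproximatesLinearOn (picardDefect X)
      (ContinuousLinearEquiv.refl ℝ C(I, E) : C(I, E) →L[ℝ] C(I, E)) univ L := by
  intro γ _ ξ _
  have hdiff : picardDefect X γ - picardDefect X ξ - (γ - ξ) =
      -pathPrimitive E (X.comp γ - X.comp ξ) := by
    simp only [picardDefect, map_sub]
    abel
  have hcomp : ‖X.comp γ - X.comp ξ‖ ≤ L * ‖γ - ξ‖ :=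
    (ContinuousMap.norm_le _ (by positivity)).2 fun t =>
      (hL.norm_sub_le (γ t) (ξ t)).trans
        (mul_le_mul_of_nonneg_left ((γ - ξ).norm_coe_le_norm t) L.2)
  calc ‖picardDefect X γ - picardDefect X ξ - (γ - ξ)‖
      = ‖pathPrimitive E (X.comp γ - X.comp ξ)‖ := by rw [hdiff, norm_neg]
    _ ≤ ‖X.comp γ - X.comp ξ‖ := by
        exact ((pathPrimitive E).le_of_opNorm_le norm_pathPrimitive_le _).trans_eq (one_mul _)
    _ ≤ L * ‖γ - ξ‖ := hcomp

theorem subsingleton_or_lt_nnnorm_refl_symm_inv {V : Type*} [NormedAddCommGroup V]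
    [NormedSpace ℝ V] {L : ℝ≥0} (hL : L < 1) :
    Subsingleton V ∨ L < ‖((ContinuousLinearEquiv.refl ℝ V).symm : V →L[ℝ] V)‖₊⁻¹ := by
  rcases subsingleton_or_nontrivial V with hV | hV
  · exact Or.inl hV
  · have hnorm : ‖((ContinuousLinearEquiv.refl ℝ V).symm : V →L[ℝ] V)‖₊ = 1 :=
      NNReal.eq ContinuousLinearMap.norm_id
    exact Or.inr (by rwa [hnorm, inv_one])

theorem norm_pathPrimitive_comp_pointwiseApply_le {A : C(I, E →L[ℝ] E)} {L : ℝ≥0}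
    (hA : ∀ t, ‖A t‖₊ ≤ L) : ‖(pathPrimitive E).comp (pointwiseApply A)‖ ≤ L :=
  calc ‖(pathPrimitive E).comp (pointwiseApply A)‖
      ≤ ‖pathPrimitive E‖ * ‖pointwiseApply A‖ := ContinuousLinearMap.opNorm_comp_le _ _
    _ ≤ 1 * ‖A‖ := by gcongr; exacts [norm_pathPrimitive_le, norm_pointwiseApply_le A]
    _ ≤ L := by rw [one_mul]; exact (ContinuousMap.norm_le _ L.2).2 hA

variable (E) in
/-- The inclusion of the constant paths. -/
def constPath : E →L[ℝ] C(I, E) :=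
  LinearMap.mkContinuous
    { toFun := ContinuousMap.const I
      map_add' := fun _ _ => rfl
      map_smul' := fun _ _ => rfl } 1
    (fun x => by rw [one_mul]; exact (ContinuousMap.norm_le _ (norm_nonneg x)).2 fun _ => le_rfl)

theorem fderiv_sub_pathPrimitive_eq_const {X : C(E, E)} {X' : C(E, E →L[ℝ] E)}
    (h : ∀ x, HasFDerivAt X (X' x) x) {sol : E → C(I, E)} (hsol : Differentiable ℝ sol)
    (hfix : ∀ x, sol x - pathPrimitive E (X.comp (sol x)) = ContinuousMap.const I x) (x v : E) :
    fderiv ℝ sol x v - pathPrimitive E (pointwiseApply (X'.comp (sol x)) (fderiv ℝ sol x v)) =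
      ContinuousMap.const I v := by
  have hcomp := (hasFDerivAt_picardDefect h (sol x)).comp x (hsol x).hasFDerivAt
  have hconst : HasFDerivAt (picardDefect X ∘ sol) (constPath E) x := by
    rw [show picardDefect X ∘ sol = constPath E from funext hfix]
    exact (constPath E).hasFDerivAt
  exact DFunLike.congr_fun (hcomp.unique hconst) v

variable [CompleteSpace E]

/-- For a contracting field, `picardDefect` as a homeomorphism of the space of paths. -/
def picardHomeomorph (X : C(E, E)) {L : ℝ≥0} (hX : LipschitzWith L X) (hL : L < 1) :
    C(I, E) ≃ₜ C(I, E) :=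
  (approximatesLinearOn_picardDefect hX).toHomeomorph _ (subsingleton_or_lt_nnnorm_refl_symm_inv hL)

/-- The derivative of `picardDefect` along a contracting field, as an equivalence. -/
def picardDeriv (A : C(I, E →L[ℝ] E)) {L : ℝ≥0} (hA : ∀ t, ‖A t‖₊ ≤ L) (hL : L < 1) :
    C(I, E) ≃L[ℝ] C(I, E) :=
  ContinuousLinearEquiv.unitsEquiv ℝ C(I, E) (Units.oneSub
    ((pathPrimitive E).comp (pointwiseApply A))
    ((norm_pathPrimitive_comp_pointwiseApply_le hA).trans_lt hL))

theorem coe_picardDeriv (A : C(I, E →L[ℝ] E)) {L : ℝ≥0} (hA : ∀ t, ‖A t‖₊ ≤ L) (hL : L < 1) :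
    (picardDeriv A hA hL : C(I, E) →L[ℝ] C(I, E)) =
      ContinuousLinearMap.id ℝ C(I, E) - (pathPrimitive E).comp (pointwiseApply A) := by
  ext1 η
  rfl

theorem contDiff_picardHomeomorph_symm {X : C(E, E)} (hX : ContDiff ℝ ∞ X) {L : ℝ≥0} (hL : L < 1)
    (hXL : ∀ x, ‖fderiv ℝ X x‖₊ ≤ L) (hLip : LipschitzWith L X) :
    ContDiff ℝ ∞ (picardHomeomorph X hLip hL).symm := by
  let X' : C(E, E →L[ℝ] E) := ⟨fderiv ℝ X, hX.continuous_fderiv (by simp)⟩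
  refine (picardHomeomorph X hLip hL).contDiff_symm
    (f₀' := fun γ => picardDeriv (X'.comp γ) (fun t => hXL (γ t)) hL) (fun γ => ?_)
    (contDiff_picardDefect hX)
  rw [coe_picardDeriv]
  exact hasFDerivAt_picardDefect (fun x => (hX.differentiable (by simp) x).hasFDerivAt) γ

theorem exists_contDiff_sub_pathPrimitive_eq_const {X : C(E, E)} (hX : ContDiff ℝ ∞ X) {L : ℝ≥0}
    (hL : L < 1) (hXL : ∀ x, ‖fderiv ℝ X x‖₊ ≤ L) :
    ∃ sol : E → C(I, E), ContDiff ℝ ∞ sol ∧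
      ∀ x, sol x - pathPrimitive E (X.comp (sol x)) = ContinuousMap.const I x := by
  have hLip : LipschitzWith L X :=
    lipschitzWith_of_nnnorm_fderiv_le (hX.differentiable (by simp)) hXL
  exact ⟨fun x => (picardHomeomorph X hLip hL).symm (constPath E x),
    (contDiff_picardHomeomorph_symm hX hL hXL hLip).comp (constPath E).contDiff,
    fun x => (picardHomeomorph X hLip hL).apply_symm_apply (constPath E x)⟩

/-- The variational equation for `η` is what makes the time-one map symplectic in the Hamiltonian
case. -/
theorem exists_contDiff_timeOneMap {X : E → E} (hX : ContDiff ℝ ∞ X) {L : ℝ≥0} (hL : L < 1)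
    (hXL : ∀ x, ‖fderiv ℝ X x‖₊ ≤ L) :
    ∃ ψ : E → E, ContDiff ℝ ∞ ψ ∧ ∀ x, ∃ γ : ℝ → E,
      IsIntegralCurveOn γ (fun _ => X) (Icc 0 1) ∧ γ 0 = x ∧ γ 1 = ψ x ∧
      ∀ v, ∃ η : ℝ → E, IsIntegralCurveOn η (fun t => fderiv ℝ X (γ t)) (Icc 0 1) ∧
        η 0 = v ∧ η 1 = fderiv ℝ ψ x v := by
  let Xc : C(E, E) := ⟨X, hX.continuous⟩
  let Xc' : C(E, E →L[ℝ] E) := ⟨fderiv ℝ X, hX.continuous_fderiv (by simp)⟩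
  have hXc' : ∀ x, HasFDerivAt Xc (Xc' x) x := fun x =>
    (hX.differentiable (by simp) x).hasFDerivAt
  obtain ⟨sol, hsol, hfix⟩ := exists_contDiff_sub_pathPrimitive_eq_const (X := Xc) hX hL hXL
  have hsol_diff : Differentiable ℝ sol := hsol.differentiable (by simp)
  let evalOne : C(I, E) →L[ℝ] E := ContinuousMap.evalCLM ℝ 1
  have hextend : ∀ (g : C(I, E)) {t : ℝ} (ht : t ∈ Icc (0 : ℝ) 1),
      IccExtend zero_le_one g t = g ⟨t, ht⟩ := fun g _ ht => IccExtend_of_mem _ _ ht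
  refine ⟨fun x => sol x 1, evalOne.contDiff.comp hsol, fun x => ⟨IccExtend zero_le_one (sol x),
    fun t ht => ?_, (hextend _ _).trans (apply_zero_of_sub_pathPrimitive (hfix x)),
    hextend _ _, fun v => ?_⟩⟩
  · simp only [hextend _ ht]
    exact hasDerivWithinAt_IccExtend_of_sub_pathPrimitive (hfix x) ht
  · have hvar := fderiv_sub_pathPrimitive_eq_const hXc' hsol_diff hfix x v
    have hψ : fderiv ℝ (fun x => sol x 1) x = evalOne.comp (fderiv ℝ sol x) :=
      (evalOne.hasFDerivAt.comp x (hsol_diff x).hasFDerivAt).fderiv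
    refine ⟨IccExtend zero_le_one (fderiv ℝ sol x v), fun t ht => ?_,
      (hextend _ _).trans (apply_zero_of_sub_pathPrimitive hvar),
      (hextend _ ⟨zero_le_one, le_rfl⟩).trans (by rw [hψ]; rfl)⟩
    simp only [hextend _ ht]
    exact hasDerivWithinAt_IccExtend_of_sub_pathPrimitive hvar ht

theorem leftInverse_of_isIntegralCurveOn_neg {E : Type*} [NormedAddCommGroup E] [NormedSpace ℝ E]
    {X : E → E} {L : ℝ≥0} (hX : LipschitzWith L fun x => -X x) {ψ φ : E → E}
    (hψ : ∀ x, ∃ γ : ℝ → E, IsIntegralCurveOn γ (fun _ => X) (Icc 0 1) ∧ γ 0 = x ∧ γ 1 = ψ x)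
    (hφ : ∀ x, ∃ γ : ℝ → E,
      IsIntegralCurveOn γ (fun _ x => -X x) (Icc 0 1) ∧ γ 0 = x ∧ γ 1 = φ x) :
    Function.LeftInverse φ ψ := by
  intro x
  obtain ⟨γ, hγ, hγ_zero, hγ_one⟩ := hψ x
  obtain ⟨ξ, hξ, hξ_zero, hξ_one⟩ := hφ (ψ x)
  have heq : γ (1 - 1) = ξ 1 :=
    eqOn_Icc_of_isIntegralCurveOn hX (isIntegralCurveOn_comp_one_sub hγ) hξ
      (by rw [sub_zero, hγ_one, hξ_zero]) (right_mem_Icc.2 zero_le_one)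
  rw [← hξ_one, ← heq, sub_self, hγ_zero]

theorem exists_timeOneEquiv {X : E → E} (hX : ContDiff ℝ ∞ X) {L : ℝ≥0} (hL : L < 1)
    (hXL : ∀ x, ‖fderiv ℝ X x‖₊ ≤ L) :
    ∃ e : E ≃ E, ContDiff ℝ ∞ e ∧ ContDiff ℝ ∞ e.symm ∧ ∀ x, ∃ γ : ℝ → E,
      IsIntegralCurveOn γ (fun _ => X) (Icc 0 1) ∧ γ 0 = x ∧ γ 1 = e x ∧
      ∀ v, ∃ η : ℝ → E, IsIntegralCurveOn η (fun t => fderiv ℝ X (γ t)) (Icc 0 1) ∧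
        η 0 = v ∧ η 1 = fderiv ℝ e x v := by
  have hX_neg : ContDiff ℝ ∞ (fun x => -X x) := hX.neg
  have hXL_neg : ∀ x, ‖fderiv ℝ (fun x => -X x) x‖₊ ≤ L := fun x => by
    rw [fderiv_fun_neg, nnnorm_neg]
    exact hXL x
  have hLip := lipschitzWith_of_nnnorm_fderiv_le (hX.differentiable (by simp)) hXL
  have hLip_neg := lipschitzWith_of_nnnorm_fderiv_le (hX_neg.differentiable (by simp)) hXL_neg
  obtain ⟨ψ, hψ, hγ⟩ := exists_contDiff_timeOneMap hX hL hXL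
  obtain ⟨φ, hφ, hξ⟩ := exists_contDiff_timeOneMap hX_neg hL hXL_neg
  choose γ hγ hγ_zero hγ_one hvar using hγ
  choose ξ hξ hξ_zero hξ_one _ using hξ
  have hleft : Function.LeftInverse φ ψ := leftInverse_of_isIntegralCurveOn_neg hLip_neg
    (fun x => ⟨γ x, hγ x, hγ_zero x, hγ_one x⟩) (fun x => ⟨ξ x, hξ x, hξ_zero x, hξ_one x⟩)
  have hright : Function.LeftInverse ψ φ :=
    leftInverse_of_isIntegralCurveOn_neg (X := fun x => -X x) (by simpa only [neg_neg] using hLip)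
      (fun x => ⟨ξ x, hξ x, hξ_zero x, hξ_one x⟩)
      (by simpa only [neg_neg] using fun x => ⟨γ x, hγ x, hγ_zero x, hγ_one x⟩)
  exact ⟨⟨ψ, φ, hleft, hright⟩, hψ, hφ, fun x => ⟨γ x, hγ x, hγ_zero x, hγ_one x, hvar x⟩⟩

end Picard

end TimeOneMap

section Symplectic

open Set NNReal

variable {d : ℕ}

/-- The coordinate `x_j` as a continuous linear form. -/
def coordX (j : Fin d) : Phase d →L[ℝ] ℝ :=
  (ContinuousLinearMap.proj j).comp (ContinuousLinearMap.fst ℝ (Fin d → ℝ) (Fin d → ℝ))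

/-- The coordinate `y_j` as a continuous linear form. -/
def coordY (j : Fin d) : Phase d →L[ℝ] ℝ :=
  (ContinuousLinearMap.proj j).comp (ContinuousLinearMap.snd ℝ (Fin d → ℝ) (Fin d → ℝ))

@[simp] theorem coordX_apply (j : Fin d) (z : Phase d) : coordX j z = z.1 j := rfl

@[simp] theorem coordY_apply (j : Fin d) (z : Phase d) : coordY j z = z.2 j := rfl

/-- `sympForm` as a continuous bilinear map, which makes the calculus of derivatives available. -/
def sympCLM (d : ℕ) : Phase d →L[ℝ] Phase d →L[ℝ] ℝ :=
  ∑ j, ((coordX j).smulRight (coordY j) - (coordY j).smulRight (coordX j))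

theorem sympCLM_apply (u v : Phase d) : sympCLM d u v = sympForm u v := by
  simp [sympCLM, sympForm]

theorem sympForm_swap (u v : Phase d) : sympForm u v = -sympForm v u := by
  simp only [sympForm, ← Finset.sum_neg_distrib]
  exact Finset.sum_congr rfl fun j _ => by ring

theorem sympForm_self (u : Phase d) : sympForm u u = 0 := by
  linarith [sympForm_swap u u]

theorem sympForm_left_injective {u w : Phase d} (h : ∀ v, sympForm u v = sympForm w v) :
    u = w := by
  ext j
  · simpa [sympForm, Pi.single_apply] using h (0, Pi.single j 1)
  · simpa [sympForm, Pi.single_apply] using h (Pi.single j 1, 0)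

theorem phase_eq_sum_single (v : Phase d) :
    v = ∑ j, (v.1 j • ((Pi.single j 1, 0) : Phase d) + v.2 j • ((0, Pi.single j 1) : Phase d)) := by
  ext i <;> simp [Prod.fst_sum, Prod.snd_sum, Finset.sum_apply, Pi.single_apply]

theorem sympForm_hamVectorField (H : Phase d → ℝ) (z v : Phase d) :
    sympForm (hamVectorField H z) v = fderiv ℝ H z v := by
  conv_rhs => rw [phase_eq_sum_single v]
  simp only [map_sum, map_add, map_smul, sympForm, hamVectorField, smul_eq_mul]
  exact Finset.sum_congr rfl fun j _ => by ring

theorem eq_hamVectorField {H : Phase d → ℝ} {z u : Phase d}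
    (h : ∀ v, sympForm u v = fderiv ℝ H z v) : u = hamVectorField H z :=
  sympForm_left_injective fun v => by rw [h, sympForm_hamVectorField]

theorem fderiv_apply_hamVectorField_swap (F G : Phase d → ℝ) (z : Phase d) :
    fderiv ℝ F z (hamVectorField G z) = -fderiv ℝ G z (hamVectorField F z) := by
  rw [← sympForm_hamVectorField, ← sympForm_hamVectorField, sympForm_swap]

theorem contDiff_hamVectorField {H : Phase d → ℝ} {m n : WithTop ℕ∞} (hH : ContDiff ℝ n H)
    (hmn : m + 1 ≤ n) : ContDiff ℝ m (hamVectorField H) := by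
  have hfderiv : ContDiff ℝ m (fderiv ℝ H) := hH.fderiv_right hmn
  exact (contDiff_pi.2 fun j => hfderiv.clm_apply contDiff_const).prodMk
    (contDiff_pi.2 fun j => (hfderiv.clm_apply contDiff_const).neg)

theorem sympForm_fderiv_hamVectorField {H : Phase d → ℝ} (hH : ContDiff ℝ 2 H) (z u v : Phase d) :
    sympForm (fderiv ℝ (hamVectorField H) z u) v = fderiv ℝ (fderiv ℝ H) z u v := by
  have hX := contDiff_hamVectorField hH (m := 1) one_add_one_eq_two.le
  have hH' : ContDiff ℝ 1 (fderiv ℝ H) := hH.fderiv_right one_add_one_eq_two.le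
  have hcontract : HasFDerivAt (fun z => sympCLM d (hamVectorField H z) v)
      (((sympCLM d).comp (fderiv ℝ (hamVectorField H) z)).flip v) z :=
    (((sympCLM d).hasFDerivAt.comp z (hX.differentiable one_ne_zero z).hasFDerivAt).clm_apply
      (hasFDerivAt_const v z)).congr_fderiv (by rw [ContinuousLinearMap.comp_zero, zero_add])
  have hfderiv : HasFDerivAt (fun z => fderiv ℝ H z v) ((fderiv ℝ (fderiv ℝ H) z).flip v) z :=
    ((hH'.differentiable one_ne_zero z).hasFDerivAt.clm_apply
      (hasFDerivAt_const v z)).congr_fderiv (by rw [ContinuousLinearMap.comp_zero, zero_add])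
  simp only [sympCLM_apply, sympForm_hamVectorField] at hcontract
  simpa [sympCLM_apply] using DFunLike.congr_fun (hcontract.unique hfderiv) u

theorem sympForm_fderiv_hamVectorField_add {H : Phase d → ℝ} (hH : ContDiff ℝ 2 H)
    (z u v : Phase d) :
    sympForm (fderiv ℝ (hamVectorField H) z u) v + sympForm u (fderiv ℝ (hamVectorField H) z v)
      = 0 := by
  have hsymm : IsSymmSndFDerivAt ℝ H z := hH.contDiffAt.isSymmSndFDerivAt (by simp)
  rw [sympForm_swap u, sympForm_fderiv_hamVectorField hH, sympForm_fderiv_hamVectorField hH,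
    hsymm u v, add_neg_cancel]

theorem sympForm_eq_of_isIntegralCurveOn_fderiv {H : Phase d → ℝ} (hH : ContDiff ℝ 2 H)
    {γ η ξ : ℝ → Phase d} {a b : ℝ} (hab : a ≤ b)
    (hη : IsIntegralCurveOn η (fun t => fderiv ℝ (hamVectorField H) (γ t)) (Icc a b))
    (hξ : IsIntegralCurveOn ξ (fun t => fderiv ℝ (hamVectorField H) (γ t)) (Icc a b)) :
    sympForm (η b) (ξ b) = sympForm (η a) (ξ a) := by
  simp only [← sympCLM_apply]
  refine constant_of_has_deriv_right_zero (f := fun t => sympCLM d (η t) (ξ t))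
    (fun t ht => ?_) (fun t ht => ?_) b (right_mem_Icc.2 hab)
  · exact (((sympCLM d).hasFDerivAt.comp_hasDerivWithinAt t (hη t ht)).clm_apply
      (hξ t ht)).continuousWithinAt
  · refine (((sympCLM d).hasFDerivAt.comp_hasDerivWithinAt t
      (hasDerivWithinAt_Ici_of_isIntegralCurveOn hη ht)).clm_apply
      (hasDerivWithinAt_Ici_of_isIntegralCurveOn hξ ht)).congr_deriv ?_
    simp only [sympCLM_apply, Function.comp]
    exact sympForm_fderiv_hamVectorField_add hH _ _ _

/-- Smooth symplectic diffeomorphisms of the phase space, as a property of the underlying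
bijection so that composition and iteration are those of `Equiv`. -/
structure IsSymplecto (e : Phase d ≃ Phase d) : Prop where
  contDiff : ContDiff ℝ ∞ e
  contDiff_symm : ContDiff ℝ ∞ e.symm
  sympForm_fderiv : ∀ z u v, sympForm (fderiv ℝ e z u) (fderiv ℝ e z v) = sympForm u v

namespace IsSymplecto

variable {e f : Phase d ≃ Phase d}

theorem differentiable (he : IsSymplecto e) : Differentiable ℝ e :=
  he.contDiff.differentiable (by simp)

theorem differentiable_symm (he : IsSymplecto e) : Differentiable ℝ e.symm :=
  he.contDiff_symm.differentiable (by simp)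

theorem refl : IsSymplecto (Equiv.refl (Phase d)) where
  contDiff := contDiff_id
  contDiff_symm := contDiff_id
  sympForm_fderiv z u v := by
    have hid : fderiv ℝ (Equiv.refl (Phase d)) z = ContinuousLinearMap.id ℝ _ := fderiv_id
    rw [hid]
    rfl

theorem trans (he : IsSymplecto e) (hf : IsSymplecto f) : IsSymplecto (e.trans f) where
  contDiff := hf.contDiff.comp he.contDiff
  contDiff_symm := he.contDiff_symm.comp hf.contDiff_symm
  sympForm_fderiv z u v := by
    have hcomp : fderiv ℝ (e.trans f) z = (fderiv ℝ f (e z)).comp (fderiv ℝ e z) :=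
      fderiv_comp z (hf.differentiable _) (he.differentiable _)
    rw [hcomp, ContinuousLinearMap.comp_apply, ContinuousLinearMap.comp_apply, hf.sympForm_fderiv,
      he.sympForm_fderiv]

theorem pow {e : Equiv.Perm (Phase d)} (he : IsSymplecto e) (n : ℕ) :
    IsSymplecto (e ^ n : Equiv.Perm (Phase d)) := by
  induction n with
  | zero => exact refl
  | succ n ih =>
    rw [pow_succ]
    exact he.trans ih

theorem fderiv_fderiv_symm_apply (he : IsSymplecto e) (z v : Phase d) :
    fderiv ℝ e z (fderiv ℝ e.symm (e z) v) = v := by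
  have he' : HasFDerivAt e (fderiv ℝ e z) (e.symm (e z)) := by
    rw [e.symm_apply_apply]
    exact (he.differentiable z).hasFDerivAt
  have hcomp := he'.comp (e z) (he.differentiable_symm (e z)).hasFDerivAt
  rw [e.self_comp_symm] at hcomp
  exact DFunLike.congr_fun (hcomp.unique (hasFDerivAt_id _)) v

theorem fderiv_apply_hamVectorField (he : IsSymplecto e) {h : Phase d → ℝ}
    (hh : Differentiable ℝ h) (z : Phase d) :
    fderiv ℝ e z (hamVectorField h z) = hamVectorField (h ∘ e.symm) (e z) := by
  refine eq_hamVectorField fun v => ?_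
  rw [← he.fderiv_fderiv_symm_apply z v, he.sympForm_fderiv, sympForm_hamVectorField,
    he.fderiv_fderiv_symm_apply z v, fderiv_comp (e z) (hh _) (he.differentiable_symm _),
    ContinuousLinearMap.comp_apply, e.symm_apply_apply]

theorem isHamFlow_conj (he : IsSymplecto e) {h : Phase d → ℝ} (hh : Differentiable ℝ h)
    {Φ : ℝ → Phase d → Phase d} (hΦ : IsHamFlow h Φ) :
    IsHamFlow (h ∘ e.symm) (fun t z => e (Φ t (e.symm z))) := by
  refine fun z => ⟨by simp only [(hΦ (e.symm z)).1, e.apply_symm_apply], fun t => ?_⟩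
  rw [← he.fderiv_apply_hamVectorField hh]
  exact (he.differentiable _).hasFDerivAt.comp_hasDerivAt t ((hΦ (e.symm z)).2 t)

end IsSymplecto

theorem eq_of_hasDerivAt_of_contDiff {E : Type*} [NormedAddCommGroup E] [NormedSpace ℝ E]
    [ProperSpace E] {X : E → E} (hX : ContDiff ℝ 1 X) {γ ξ : ℝ → E}
    (hγ : ∀ t, HasDerivAt γ (X (γ t)) t) (hξ : ∀ t, HasDerivAt ξ (X (ξ t)) t) (h : γ 0 = ξ 0) :
    γ = ξ := by
  funext t
  have hIcc : IsCompact (Icc (-(|t| + 1)) (|t| + 1)) := isCompact_Icc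
  obtain ⟨R, hR⟩ := hIcc.exists_bound_of_continuousOn
    (fun s _ => (hγ s).continuousAt.continuousWithinAt)
  obtain ⟨S, hS⟩ := hIcc.exists_bound_of_continuousOn
    (fun s _ => (hξ s).continuousAt.continuousWithinAt)
  obtain ⟨K, hK⟩ := (hX.contDiffOn (s := Metric.closedBall 0 (max R S))).exists_lipschitzOnWith
    one_ne_zero (convex_closedBall _ _) (isCompact_closedBall _ _)
  have heq : EqOn γ ξ (Ioo (-(|t| + 1)) (|t| + 1)) :=
    ODE_solution_unique_of_mem_Ioo (v := fun _ => X) (s := fun _ => Metric.closedBall 0 (max R S))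
      (fun _ _ => hK) ⟨by linarith [abs_nonneg t], by positivity⟩
      (fun s hs => ⟨hγ s, by simpa using Or.inl (hR s (Ioo_subset_Icc_self hs))⟩)
      (fun s hs => ⟨hξ s, by simpa using Or.inr (hS s (Ioo_subset_Icc_self hs))⟩) h
  exact heq (abs_lt.1 (lt_add_one |t|))

theorem IsHamFlow.unique {H : Phase d → ℝ} (hH : ContDiff ℝ 2 H) {Φ Ψ : ℝ → Phase d → Phase d}
    (hΦ : IsHamFlow H Φ) (hΨ : IsHamFlow H Ψ) : Φ = Ψ := by
  funext t z
  exact congrFun (eq_of_hasDerivAt_of_contDiff (contDiff_hamVectorField hH one_add_one_eq_two.le)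
    (hΦ z).2 (hΨ z).2 ((hΦ z).1.trans (hΨ z).1.symm)) t

theorem exists_isSymplecto_timeOneMap {G : Phase d → ℝ} (hG : ContDiff ℝ ∞ G) {L : ℝ≥0}
    (hL : L < 1) (hGL : ∀ x, ‖fderiv ℝ (hamVectorField G) x‖₊ ≤ L) :
    ∃ e : Phase d ≃ Phase d, IsSymplecto e ∧ ∀ x, ∃ γ : ℝ → Phase d,
      IsIntegralCurveOn γ (fun _ => hamVectorField G) (Icc 0 1) ∧ γ 0 = x ∧ γ 1 = e x := by
  obtain ⟨e, he, he_symm, hγ⟩ := exists_timeOneEquiv (contDiff_hamVectorField hG (by simp)) hL hGL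
  choose γ hγ hγ_zero hγ_one hvar using hγ
  refine ⟨e, ⟨he, he_symm, fun z u v => ?_⟩, fun x => ⟨γ x, hγ x, hγ_zero x, hγ_one x⟩⟩
  obtain ⟨η, hη, rfl, hη_one⟩ := hvar z u
  obtain ⟨ξ, hξ, rfl, hξ_one⟩ := hvar z v
  rw [← hη_one, ← hξ_one]
  have hG_two : ContDiff ℝ 2 G := hG.of_le (WithTop.coe_le_coe.2 le_top)
  exact sympForm_eq_of_isIntegralCurveOn_fderiv hG_two zero_le_one hη hξ

end Symplectic

section Rotations

open Set

variable {d : ℕ}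

/-- The differential `x_j dx_j + y_j dy_j` of the action `r_j`. -/
def actionDeriv (j : Fin d) (z : Phase d) : Phase d →L[ℝ] ℝ :=
  z.1 j • coordX j + z.2 j • coordY j

theorem hasFDerivAt_action (j : Fin d) (z : Phase d) :
    HasFDerivAt (action j) (actionDeriv j z) z := by
  have hx : HasFDerivAt (fun z : Phase d => z.1 j) (coordX j) z := (coordX j).hasFDerivAt
  have hy : HasFDerivAt (fun z : Phase d => z.2 j) (coordY j) z := (coordY j).hasFDerivAt
  refine (((hx.pow 2).add (hy.pow 2)).mul_const (1 / 2 : ℝ)).congr_fderiv ?_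
    |>.congr_of_eventuallyEq (Filter.Eventually.of_forall fun z => ?_)
  · ext v <;> simp [actionDeriv] <;> ring
  · simp [action]
    ring

theorem contDiff_action {n : WithTop ℕ∞} (j : Fin d) : ContDiff ℝ n (action (d := d) j) :=
  (((coordX j).contDiff.pow 2).add ((coordY j).contDiff.pow 2)).div_const 2

theorem continuous_action (j : Fin d) : Continuous (action (d := d) j) :=
  (contDiff_action (n := 0) j).continuous

theorem action_nonneg (j : Fin d) (z : Phase d) : 0 ≤ action j z := by
  unfold action
  positivity

theorem action_eq_zero {j : Fin d} {z : Phase d} : action j z = 0 ↔ z.1 j = 0 ∧ z.2 j = 0 := by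
  rw [action, div_eq_zero_iff, or_iff_left two_ne_zero,
    add_eq_zero_iff_of_nonneg (sq_nonneg _) (sq_nonneg _), sq_eq_zero_iff, sq_eq_zero_iff]

theorem action_le_norm_sq (j : Fin d) (z : Phase d) : action j z ≤ ‖z‖ ^ 2 := by
  have hx : z.1 j ^ 2 ≤ ‖z‖ ^ 2 :=
    sq_le_sq.2 (((norm_le_pi_norm z.1 j).trans (norm_fst_le z)).trans (le_abs_self _))
  have hy : z.2 j ^ 2 ≤ ‖z‖ ^ 2 :=
    sq_le_sq.2 (((norm_le_pi_norm z.2 j).trans (norm_snd_le z)).trans (le_abs_self _))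
  unfold action
  linarith

theorem norm_le_of_action_le {z : Phase d} {R : ℝ} (hR : 0 ≤ R)
    (h : ∀ j, action j z ≤ R ^ 2 / 2) : ‖z‖ ≤ R := by
  simp only [action] at h
  refine max_le ((pi_norm_le_iff_of_nonneg hR).2 fun j => abs_le_of_sq_le_sq ?_ hR)
    ((pi_norm_le_iff_of_nonneg hR).2 fun j => abs_le_of_sq_le_sq ?_ hR)
  · linarith [h j, sq_nonneg (z.2 j)]
  · linarith [h j, sq_nonneg (z.1 j)]

/-- Rotation by the angle `a_j` in each plane `(x_j, y_j)`, in the (clockwise) direction of the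
Hamiltonian flow of `r_j`. -/
def rotate (a : Fin d → ℝ) (z : Phase d) : Phase d :=
  (fun j => z.1 j * Real.cos (a j) + z.2 j * Real.sin (a j),
    fun j => z.2 j * Real.cos (a j) - z.1 j * Real.sin (a j))

theorem rotate_zero (z : Phase d) : rotate 0 z = z := by ext j <;> simp [rotate]

theorem action_rotate (j : Fin d) (a : Fin d → ℝ) (z : Phase d) :
    action j (rotate a z) = action j z := by
  simp only [action, rotate]
  linear_combination ((z.1 j ^ 2 + z.2 j ^ 2) / 2) * Real.sin_sq_add_cos_sq (a j)

theorem continuous_rotate {α : Type*} [TopologicalSpace α] {a : α → Fin d → ℝ} {z : α → Phase d}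
    (ha : Continuous a) (hz : Continuous z) : Continuous fun x => rotate (a x) (z x) := by
  unfold rotate
  fun_prop

/-- The infinitesimal rotation `∑ Ω_j X_{r_j}`. -/
def rotGen (Ω : Fin d → ℝ) (z : Phase d) : Phase d :=
  (fun j => Ω j * z.2 j, fun j => -(Ω j * z.1 j))

theorem hasDerivAt_rotate (Ω : Fin d → ℝ) (z : Phase d) (t : ℝ) :
    HasDerivAt (fun s : ℝ => rotate (s • Ω) z) (rotGen Ω (rotate (t • Ω) z)) t := by
  have hangle : ∀ j, HasDerivAt (fun s : ℝ => s * Ω j) (Ω j) t := fun j => hasDerivAt_mul_const _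
  refine HasDerivAt.prodMk (hasDerivAt_pi.2 fun j => ?_) (hasDerivAt_pi.2 fun j => ?_)
  · refine (((hangle j).cos.const_mul (z.1 j)).add
      ((hangle j).sin.const_mul (z.2 j))).congr_deriv ?_
    simp only [rotate, Pi.smul_apply, smul_eq_mul]
    ring
  · refine (((hangle j).cos.const_mul (z.2 j)).sub
      ((hangle j).sin.const_mul (z.1 j))).congr_deriv ?_
    simp only [rotate, Pi.smul_apply, smul_eq_mul]
    ring

theorem sympForm_rotGen (Ω : Fin d → ℝ) (z v : Phase d) :
    sympForm (rotGen Ω z) v = ∑ j, Ω j * actionDeriv j z v := by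
  simp only [sympForm, rotGen, actionDeriv, add_apply, smul_apply, coordX_apply, coordY_apply,
    smul_eq_mul]
  exact Finset.sum_congr rfl fun j _ => by ring

/-- The integrable Hamiltonian `∑ w_i(r_q) r_i`: the frequencies vary with the single action
`r_q`. -/
def freqHam (q : Fin d) (w : ℝ → Fin d → ℝ) (z : Phase d) : ℝ :=
  ∑ i, w (action q z) i * action i z

/-- The frequencies `∂h/∂r_i` of `h = ∑ w_i(r_q) r_i`. -/
def freq (q : Fin d) (w : ℝ → Fin d → ℝ) (z : Phase d) (i : Fin d) : ℝ :=
  w (action q z) i + if i = q then ∑ l, deriv w (action q z) l * action l z else 0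

/-- The Hamiltonian flow of `∑ w_i(r_q) r_i`. -/
def freqFlow (q : Fin d) (w : ℝ → Fin d → ℝ) (t : ℝ) (z : Phase d) : Phase d :=
  rotate (t • freq q w z) z

theorem contDiff_freqHam (q : Fin d) {w : ℝ → Fin d → ℝ} {n : WithTop ℕ∞} (hw : ContDiff ℝ n w) :
    ContDiff ℝ n (freqHam q w) :=
  ContDiff.sum fun i _ => (contDiff_pi.1 (hw.comp (contDiff_action q)) i).mul (contDiff_action i)

theorem hamVectorField_freqHam (q : Fin d) {w : ℝ → Fin d → ℝ} (hw : Differentiable ℝ w)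
    (z : Phase d) : hamVectorField (freqHam q w) z = rotGen (freq q w z) z := by
  refine (eq_hamVectorField fun v => ?_).symm
  have hwi : ∀ i, HasDerivAt (fun s => w s i) (deriv w (action q z) i) (action q z) :=
    hasDerivAt_pi.1 (hw (action q z)).hasDerivAt
  have hderiv : HasFDerivAt (freqHam q w) (∑ i, (w (action q z) i • actionDeriv i z +
      action i z • (deriv w (action q z) i • actionDeriv q z))) z :=
    HasFDerivAt.fun_sum fun i _ =>
      ((hwi i).comp_hasFDerivAt z (hasFDerivAt_action q z)).mul (hasFDerivAt_action i z)
  rw [hderiv.fderiv, sympForm_rotGen]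
  simp only [freq, add_mul, Finset.sum_add_distrib, ite_mul, zero_mul, Finset.sum_ite_eq',
    Finset.mem_univ, if_true, sum_apply, add_apply, smul_apply, smul_eq_mul, Finset.sum_mul]
  congr 1
  exact Finset.sum_congr rfl fun i _ => by ring

theorem freq_rotate (q : Fin d) (w : ℝ → Fin d → ℝ) (a : Fin d → ℝ) (z : Phase d) :
    freq q w (rotate a z) = freq q w z := by
  funext i
  simp only [freq, action_rotate]

theorem isHamFlow_freqFlow (q : Fin d) {w : ℝ → Fin d → ℝ} (hw : Differentiable ℝ w) :
    IsHamFlow (freqHam q w) (freqFlow q w) := by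
  refine fun z => ⟨by rw [freqFlow, zero_smul, rotate_zero], fun t => ?_⟩
  rw [hamVectorField_freqHam q hw, freqFlow, freq_rotate]
  exact hasDerivAt_rotate _ z t

theorem action_freqFlow (q : Fin d) (w : ℝ → Fin d → ℝ) (t : ℝ) (z : Phase d) (j : Fin d) :
    action j (freqFlow q w t z) = action j z :=
  action_rotate j _ z

end Rotations

section ResonantMonomials

variable {d : ℕ}

/-- The complex coordinate `x_i + √-1 y_i`. -/
def cplx (i : Fin d) (z : Phase d) : ℂ := ⟨z.1 i, z.2 i⟩

/-- The monomial `Z^k = ∏ z_i ^ k_i` in the complex coordinates, with negative powers read as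
powers of the conjugate. -/
def resMonomial (k : Fin d → ℤ) (z : Phase d) : ℂ :=
  ∏ i, (cplx i z ^ (k i).toNat * (starRingEnd ℂ (cplx i z)) ^ (-k i).toNat)

theorem contDiff_cplx {n : WithTop ℕ∞} (i : Fin d) : ContDiff ℝ n (cplx (d := d) i) := by
  have h : cplx (d := d) i = fun z => ((coordX i z : ℝ) : ℂ) + (coordY i z : ℝ) * Complex.I := by
    funext z
    apply Complex.ext <;> simp [cplx]
  rw [h]
  exact (Complex.ofRealCLM.contDiff.comp (coordX i).contDiff).add
    ((Complex.ofRealCLM.contDiff.comp (coordY i).contDiff).mul contDiff_const)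

theorem contDiff_resMonomial {n : WithTop ℕ∞} (k : Fin d → ℤ) : ContDiff ℝ n (resMonomial k) :=
  contDiff_prod fun i _ => ((contDiff_cplx i).pow _).mul
    ((Complex.conjCLE.contDiff.comp (contDiff_cplx i)).pow _)

theorem contDiff_resMonomial_re {n : WithTop ℕ∞} (k : Fin d → ℤ) :
    ContDiff ℝ n fun z => (resMonomial k z).re :=
  Complex.reCLM.contDiff.comp (contDiff_resMonomial k)

theorem continuous_resMonomial_im (k : Fin d → ℤ) : Continuous fun z => (resMonomial k z).im :=
  Complex.continuous_im.comp (contDiff_resMonomial (n := 0) k).continuous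

theorem resMonomial_ne_zero {k : Fin d → ℤ} {z : Phase d} (h : ∀ i, action i z ≠ 0) :
    resMonomial k z ≠ 0 := by
  have hc : ∀ i, cplx i z ≠ 0 := fun i hi =>
    h i (action_eq_zero.2 ⟨congrArg Complex.re hi, congrArg Complex.im hi⟩)
  exact Finset.prod_ne_zero_iff.2 fun i _ =>
    mul_ne_zero (pow_ne_zero _ (hc i)) (pow_ne_zero _ ((map_ne_zero _).2 (hc i)))

theorem resMonomial_neg (k : Fin d → ℤ) (z : Phase d) :
    resMonomial (-k) z = starRingEnd ℂ (resMonomial k z) := by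
  simp only [resMonomial, map_prod, map_mul, map_pow, Complex.conj_conj, Pi.neg_apply, neg_neg]
  exact Finset.prod_congr rfl fun i _ => mul_comm _ _

theorem exp_neg_mul_I_eq (a : ℝ) :
    Complex.exp (-(a : ℂ) * Complex.I) = ⟨Real.cos a, -Real.sin a⟩ := by
  rw [← Complex.ofReal_neg]
  apply Complex.ext
  · rw [Complex.exp_ofReal_mul_I_re, Real.cos_neg]
  · rw [Complex.exp_ofReal_mul_I_im, Real.sin_neg]

theorem cplx_rotate (i : Fin d) (a : Fin d → ℝ) (z : Phase d) :
    cplx i (rotate a z) = Complex.exp (-(a i : ℂ) * Complex.I) * cplx i z := by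
  rw [exp_neg_mul_I_eq]
  apply Complex.ext <;> simp [cplx, rotate] <;> ring

theorem exp_pow_mul_conj_pow (a : ℝ) (k : ℤ) :
    Complex.exp (-(a : ℂ) * Complex.I) ^ k.toNat *
      (starRingEnd ℂ (Complex.exp (-(a : ℂ) * Complex.I))) ^ (-k).toNat =
      Complex.exp (-((k * a : ℝ) : ℂ) * Complex.I) := by
  have hk : (k.toNat : ℂ) - ((-k).toNat : ℂ) = k :=
    mod_cast congrArg (Int.cast : ℤ → ℂ) (Int.toNat_sub_toNat_neg k)
  rw [← Complex.exp_conj, ← Complex.exp_nat_mul, ← Complex.exp_nat_mul, ← Complex.exp_add]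
  simp only [map_mul, map_neg, Complex.conj_ofReal, Complex.conj_I]
  push_cast
  rw [← hk]
  ring_nf

theorem resMonomial_rotate (k : Fin d → ℤ) (a : Fin d → ℝ) (z : Phase d) :
    resMonomial k (rotate a z) =
      Complex.exp (-((∑ i, (k i : ℝ) * a i : ℝ) : ℂ) * Complex.I) * resMonomial k z := by
  have hexp : Complex.exp (-((∑ i, (k i : ℝ) * a i : ℝ) : ℂ) * Complex.I) =
      ∏ i, Complex.exp (-((k i * a i : ℝ) : ℂ) * Complex.I) := by
    rw [← Complex.exp_sum, ← Finset.sum_mul, Finset.sum_neg_distrib, Complex.ofReal_sum]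
  rw [hexp, resMonomial, resMonomial, ← Finset.prod_mul_distrib]
  refine Finset.prod_congr rfl fun i _ => ?_
  rw [cplx_rotate, ← exp_pow_mul_conj_pow, map_mul, mul_pow, mul_pow]
  ring

end ResonantMonomials

section PushHamiltonians

open Set

variable {d : ℕ} {k : Fin d → ℤ} {Γ : Phase d → ℝ}

/-- The Hamiltonian `-Γ Re Z^k`. When `Γ` is a function of the actions, its flow moves the actions
in the direction `k`, and it preserves `{Re Z^k = 0}`. -/
def pushHam (k : Fin d → ℤ) (Γ : Phase d → ℝ) (z : Phase d) : ℝ := -(Γ z * (resMonomial k z).re)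

theorem contDiff_pushHam {n : WithTop ℕ∞} (k : Fin d → ℤ) (hΓ : ContDiff ℝ n Γ) :
    ContDiff ℝ n (pushHam k Γ) :=
  (hΓ.mul (contDiff_resMonomial_re k)).neg

theorem pushHam_neg (k : Fin d → ℤ) (Γ : Phase d → ℝ) : pushHam (-k) Γ = pushHam k Γ := by
  funext z
  simp only [pushHam, resMonomial_neg, Complex.conj_re]

theorem pushHam_const_mul (k : Fin d → ℤ) (κ : ℝ) (Γ : Phase d → ℝ) :
    pushHam k (fun z => κ * Γ z) = fun z => κ * pushHam k Γ z := by
  funext z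
  simp only [pushHam]
  ring

theorem hasCompactSupport_pushHam (k : Fin d → ℤ) (hΓ : HasCompactSupport Γ) :
    HasCompactSupport (pushHam k Γ) :=
  HasCompactSupport.intro hΓ.isCompact fun z hz => by
    rw [pushHam, image_eq_zero_of_notMem_tsupport hz, zero_mul, neg_zero]

theorem hamVectorField_action (i : Fin d) (z : Phase d) :
    hamVectorField (action i) z = rotGen (Pi.single i 1) z := by
  refine (eq_hamVectorField fun v => ?_).symm
  rw [(hasFDerivAt_action i z).fderiv, sympForm_rotGen]
  simp [Pi.single_apply]

theorem hasDerivAt_comp_rotate {G : Phase d → ℝ} {z : Phase d} (hG : DifferentiableAt ℝ G z)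
    (Ω : Fin d → ℝ) :
    HasDerivAt (fun s : ℝ => G (rotate (s • Ω) z)) (fderiv ℝ G z (rotGen Ω z)) 0 := by
  have hz : rotate ((0 : ℝ) • Ω) z = z := by rw [zero_smul, rotate_zero]
  have hrot := hasDerivAt_rotate Ω z 0
  rw [hz] at hrot
  exact (hz.symm ▸ hG.hasFDerivAt : HasFDerivAt G (fderiv ℝ G z) _).comp_hasDerivAt 0 hrot

theorem pushHam_rotate_single (hrot : ∀ a z, Γ (rotate a z) = Γ z) (i : Fin d) (s : ℝ)
    (z : Phase d) :
    pushHam k Γ (rotate (s • Pi.single i 1) z) =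
      -(Γ z * (Real.cos (k i * s) * (resMonomial k z).re +
        Real.sin (k i * s) * (resMonomial k z).im)) := by
  have hangle : ∑ j, (k j : ℝ) * (s • (Pi.single i 1 : Fin d → ℝ)) j = k i * s := by
    simp [Pi.single_apply]
  simp only [pushHam, hrot, resMonomial_rotate, hangle, exp_neg_mul_I_eq, Complex.mul_re]
  ring

theorem fderiv_action_apply_hamVectorField_pushHam (hΓ : Differentiable ℝ Γ)
    (hrot : ∀ a z, Γ (rotate a z) = Γ z) (i : Fin d) (z : Phase d) :
    fderiv ℝ (action i) z (hamVectorField (pushHam k Γ) z) =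
      k i * (Γ z * (resMonomial k z).im) := by
  have hdiff : Differentiable ℝ (pushHam k Γ) :=
    (hΓ.mul ((contDiff_resMonomial_re (n := 1) k).differentiable one_ne_zero)).neg
  have hderiv := hasDerivAt_comp_rotate (hdiff z) (Pi.single i 1)
  simp only [pushHam_rotate_single hrot] at hderiv
  have hlin : HasDerivAt (fun s : ℝ => (k i : ℝ) * s) (k i) 0 := by
    simpa using (hasDerivAt_id (0 : ℝ)).const_mul (k i : ℝ)
  have hexplicit := (((hlin.cos.mul_const (resMonomial k z).re).add
    (hlin.sin.mul_const (resMonomial k z).im)).const_mul (Γ z)).neg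
  rw [fderiv_apply_hamVectorField_swap, hamVectorField_action, hderiv.unique hexplicit]
  simp only [mul_zero, Real.sin_zero, Real.cos_zero]
  ring

theorem fderiv_re_apply_hamVectorField_pushHam (hΓ : Differentiable ℝ Γ) (z : Phase d) :
    fderiv ℝ (fun z => (resMonomial k z).re) z (hamVectorField (pushHam k Γ) z) =
      fderiv ℝ Γ z (hamVectorField (fun z => (resMonomial k z).re) z) * (resMonomial k z).re := by
  have hRe := (((contDiff_resMonomial_re (n := 1) k).differentiable one_ne_zero) z).hasFDerivAt
  have hself : fderiv ℝ (fun z => (resMonomial k z).re) z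
      (hamVectorField (fun z => (resMonomial k z).re) z) = 0 := by
    rw [← sympForm_hamVectorField, sympForm_self]
  have hpush : fderiv ℝ (pushHam k Γ) z = _ := ((hΓ z).hasFDerivAt.fun_mul hRe).fun_neg.fderiv
  rw [fderiv_apply_hamVectorField_swap, hpush]
  simp only [neg_apply, smul_apply, add_apply, hself, smul_eq_mul]
  ring

theorem hamVectorField_eq_zero_of_eventuallyEq {G : Phase d → ℝ} {z : Phase d}
    (h : G =ᶠ[𝓝 z] 0) : hamVectorField G z = 0 := by
  have hfderiv : fderiv ℝ G z = 0 := by rw [h.fderiv_eq, fderiv_zero, Pi.zero_apply]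
  ext j <;> simp [hamVectorField, hfderiv]

theorem hamVectorField_pushHam_eq_zero {z : Phase d} (h : Γ =ᶠ[𝓝 z] 0) :
    hamVectorField (pushHam k Γ) z = 0 :=
  hamVectorField_eq_zero_of_eventuallyEq (h.mono fun y hy => by simp [pushHam, hy])

theorem hamVectorField_const_mul {G : Phase d → ℝ} (hG : Differentiable ℝ G) (κ : ℝ) :
    hamVectorField (fun z => κ * G z) = fun z => κ • hamVectorField G z := by
  funext z
  refine (eq_hamVectorField fun v => ?_).symm
  rw [((hG z).hasFDerivAt.const_mul κ).fderiv, ← sympCLM_apply, map_smul, smul_apply, smul_apply,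
    sympCLM_apply, sympForm_hamVectorField]

theorem exists_pos_nnnorm_fderiv_hamVectorField_const_mul_le {G : Phase d → ℝ}
    (hG : ContDiff ℝ 2 G) (hc : HasCompactSupport G) {L : NNReal} (hL : 0 < L) :
    ∃ κ : ℝ, 0 < κ ∧ ∀ z, ‖fderiv ℝ (hamVectorField (fun z => κ * G z)) z‖₊ ≤ L := by
  have hX : ContDiff ℝ 1 (hamVectorField G) := contDiff_hamVectorField hG (by norm_num)
  have hXc : HasCompactSupport (hamVectorField G) :=
    HasCompactSupport.intro hc.isCompact fun z hz =>
      hamVectorField_eq_zero_of_eventuallyEq (notMem_tsupport_iff_eventuallyEq.1 hz)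
  obtain ⟨B, hB⟩ := (hXc.fderiv (𝕜 := ℝ)).exists_bound_of_continuous
    (hX.continuous_fderiv one_ne_zero)
  have hB0 : 0 ≤ B := (norm_nonneg _).trans (hB 0)
  refine ⟨L / (B + 1), by positivity, fun z => ?_⟩
  have hsmul : fderiv ℝ (fun z => (L / (B + 1)) • hamVectorField G z) z =
      (L / (B + 1)) • fderiv ℝ (hamVectorField G) z :=
    fderiv_fun_const_smul (hX.differentiable one_ne_zero z) _
  rw [hamVectorField_const_mul (hG.differentiable two_ne_zero), hsmul, ← NNReal.coe_le_coe,
    coe_nnnorm, norm_smul, Real.norm_of_nonneg (by positivity), div_mul_eq_mul_div,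
    div_le_iff₀ (by positivity)]
  gcongr
  linarith [hB z]

theorem isCompact_setOf_action_mem_Icc (a b : Fin d → ℝ) :
    IsCompact {z : Phase d | ∀ i, action i z ∈ Icc (a i) (b i)} := by
  have hclosed : IsClosed {z : Phase d | ∀ i, action i z ∈ Icc (a i) (b i)} := by
    simp only [ofPred_forall]
    exact isClosed_iInter fun i => isClosed_Icc.preimage (continuous_action i)
  refine (isCompact_closedBall (0 : Phase d) √(2 * ∑ i, |b i|)).of_isClosed_subset hclosed
    fun z hz => ?_
  rw [mem_closedBall_zero_iff]
  refine norm_le_of_action_le (Real.sqrt_nonneg _) fun i => ?_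
  rw [Real.sq_sqrt (by positivity), mul_div_cancel_left₀ _ two_ne_zero]
  exact (hz i).2.trans ((le_abs_self _).trans
    (Finset.single_le_sum (fun i _ => abs_nonneg (b i)) (Finset.mem_univ i)))

theorem exists_action_cutoff {a b a' b' : Fin d → ℝ} (ha : ∀ i, a' i < a i)
    (hb : ∀ i, b i < b' i) :
    ∃ Γ : Phase d → ℝ, ContDiff ℝ ∞ Γ ∧ (∀ α z, Γ (rotate α z) = Γ z) ∧ (∀ z, 0 ≤ Γ z) ∧
      HasCompactSupport Γ ∧ (∀ z, (∀ i, action i z ∈ Icc (a i) (b i)) → Γ z = 1) ∧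
      ∀ z i, action i z ∉ Icc (a' i) (b' i) → Γ =ᶠ[𝓝 z] 0 := by
  have hopen : IsOpen {r : Fin d → ℝ | ∀ i, r i ∈ Ioo (a' i) (b' i)} := by
    simp only [ofPred_forall]
    exact isOpen_iInter_of_finite fun i => isOpen_Ioo.preimage (continuous_apply i)
  have hdisj : Disjoint {r : Fin d → ℝ | ∀ i, r i ∈ Ioo (a' i) (b' i)}ᶜ (Icc a b) :=
    disjoint_compl_left_iff_subset.2 fun r hr i =>
      ⟨(ha i).trans_le (hr.1 i), (hr.2 i).trans_lt (hb i)⟩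
  obtain ⟨β, hβ_zero, hβ_one, hβ⟩ := exists_contMDiffMap_zero_one_of_isClosed (n := ⊤)
    (modelWithCornersSelf ℝ (Fin d → ℝ)) hopen.isClosed_compl isClosed_Icc hdisj
  have hzero : ∀ z i, action i z ∉ Ioo (a' i) (b' i) → β (fun i => action i z) = 0 :=
    fun z i hi => hβ_zero fun h => hi (h i)
  refine ⟨fun z => β fun i => action i z, β.contMDiff.contDiff.comp (contDiff_pi.2 contDiff_action),
    fun α z => by simp only [action_rotate], fun z => (hβ _).1,
    HasCompactSupport.intro (isCompact_setOf_action_mem_Icc a' b') fun z hz => ?_,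
    fun z hz => hβ_one ⟨fun i => (hz i).1, fun i => (hz i).2⟩, fun z i hi => ?_⟩
  · obtain ⟨i, hi⟩ := not_forall.1 hz
    exact hzero z i (notMem_subset Ioo_subset_Icc_self hi)
  · filter_upwards [(continuous_action i).continuousAt.eventually_mem
      (isClosed_Icc.isOpen_compl.mem_nhds hi)] with y hy
    exact hzero y i (notMem_subset Ioo_subset_Icc_self hy)

end PushHamiltonians

section PushMaps

open Set

theorem integral_fderiv_apply_of_isIntegralCurveOn {E : Type*} [NormedAddCommGroup E]
    [NormedSpace ℝ E] {X : E → E} (hX : Continuous X) {γ : ℝ → E} {a b : ℝ}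
    (hγ : IsIntegralCurveOn γ (fun _ => X) (Icc a b)) {F : E → ℝ} (hF : ContDiff ℝ 1 F) {t : ℝ}
    (ht : t ∈ Icc a b) : ∫ s in a..t, fderiv ℝ F (γ s) (X (γ s)) = F (γ t) - F (γ a) := by
  have hγt := hγ.mono (Icc_subset_Icc_right ht.2)
  refine intervalIntegral.integral_eq_sub_of_hasDerivAt_of_le ht.1
    (hF.continuous.comp_continuousOn hγt.continuousOn) (fun s hs => ?_)
    (ContinuousOn.intervalIntegrable_of_Icc ht.1 ?_)
  · exact (hF.differentiable one_ne_zero (γ s)).hasFDerivAt.comp_hasDerivAt s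
      ((hγt s (Ioo_subset_Icc_self hs)).hasDerivAt (Icc_mem_nhds hs.1 hs.2))
  · exact ((hF.continuous_fderiv one_ne_zero).comp_continuousOn hγt.continuousOn).clm_apply
      (hX.comp_continuousOn hγt.continuousOn)

theorem add_mul_mem_uIcc (x c : ℝ) {u v : ℝ} (hu : 0 ≤ u) (huv : u ≤ v) :
    x + c * u ∈ uIcc x (x + c * v) := by
  rcases le_total 0 c with hc | hc
  · exact mem_uIcc_of_le (by nlinarith) (by nlinarith)
  · exact mem_uIcc_of_ge (by nlinarith) (by nlinarith)

variable {d : ℕ} {q : Fin d} {k : Fin d → ℤ} {I : Set ℝ} {ε M : ℝ}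

/-- The set of points whose actions all lie in `[ε, M]`. -/
def actionBox (d : ℕ) (ε M : ℝ) : Set (Phase d) := {z | ∀ i, action i z ∈ Icc ε M}

/-- The points from which the flow of `-Γ Re Z^k` pushes the actions in the direction `+k`: no
action vanishes, `Z^k` is on the positive imaginary axis, and the action `r_q` is in `I`. -/
def pushDomain (q : Fin d) (k : Fin d → ℤ) (I : Set ℝ) : Set (Phase d) :=
  {z | (resMonomial k z).re = 0 ∧ 0 < (resMonomial k z).im ∧ action q z ∈ I ∧ ∀ i, action i z ≠ 0}

theorem norm_resMonomial_of_mem_pushDomain {z : Phase d} (hz : z ∈ pushDomain q k I) :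
    ‖resMonomial k z‖ = (resMonomial k z).im := by
  have h : resMonomial k z = ((resMonomial k z).im : ℂ) * Complex.I := by
    apply Complex.ext <;> simp [hz.1]
  rw [h, norm_mul, Complex.norm_I, mul_one, Complex.norm_real, Real.norm_of_nonneg hz.2.1.le, ← h]

theorem exists_pos_le_norm_resMonomial (k : Fin d → ℤ) (hε : 0 < ε) (M : ℝ) :
    ∃ m : ℝ, 0 < m ∧ ∀ z ∈ actionBox d ε M, m ≤ ‖resMonomial k z‖ :=
  (isCompact_setOf_action_mem_Icc (fun _ => ε) fun _ => M).exists_forall_le'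
    (contDiff_resMonomial (n := 0) k).continuous.norm.continuousOn fun _ hz =>
      norm_pos_iff.2 (resMonomial_ne_zero fun i => (hε.trans_le (hz i).1).ne')

section Curves

variable {Γ : Phase d → ℝ} {γ : ℝ → Phase d} {a b t : ℝ} {L : NNReal}

theorem action_eq_add_integral (hΓ : ContDiff ℝ 1 Γ) (hrot : ∀ α z, Γ (rotate α z) = Γ z)
    (hγ : IsIntegralCurveOn γ (fun _ => hamVectorField (pushHam k Γ)) (Icc a b))
    (ht : t ∈ Icc a b) (i : Fin d) :
    action i (γ t) =
      action i (γ a) + k i * ∫ s in a..t, Γ (γ s) * (resMonomial k (γ s)).im := by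
  have hX : Continuous (hamVectorField (pushHam k Γ)) :=
    (contDiff_hamVectorField (m := 0) (contDiff_pushHam k hΓ) (by simp)).continuous
  have hintegral := integral_fderiv_apply_of_isIntegralCurveOn hX hγ (contDiff_action i) ht
  simp only [fderiv_action_apply_hamVectorField_pushHam (hΓ.differentiable one_ne_zero) hrot,
    intervalIntegral.integral_const_mul] at hintegral
  linarith

theorem resMonomial_re_eq_zero_of_isIntegralCurveOn (hΓ : ContDiff ℝ 1 Γ)
    (hγ : IsIntegralCurveOn γ (fun _ => hamVectorField (pushHam k Γ)) (Icc a b))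
    (hre : (resMonomial k (γ a)).re = 0) (ht : t ∈ Icc a b) : (resMonomial k (γ t)).re = 0 := by
  have hRe : ContDiff ℝ 1 fun z => (resMonomial k z).re := contDiff_resMonomial_re k
  have hcont : Continuous fun z =>
      fderiv ℝ Γ z (hamVectorField (fun z => (resMonomial k z).re) z) :=
    (hΓ.continuous_fderiv one_ne_zero).clm_apply
      (contDiff_hamVectorField (m := 0) hRe (by simp)).continuous
  obtain ⟨C, hC⟩ := isCompact_Icc.exists_bound_of_continuousOn
    (hcont.comp_continuousOn hγ.continuousOn)
  refine eq_zero_of_abs_deriv_le_mul_abs_self_of_eq_zero_right (K := C)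
    (f' := fun s => fderiv ℝ (fun z => (resMonomial k z).re) (γ s)
      (hamVectorField (pushHam k Γ) (γ s)))
    (hRe.continuous.comp_continuousOn hγ.continuousOn) (fun s hs => ?_) hre (fun s hs => ?_) t ht
  · exact (hRe.differentiable one_ne_zero (γ s)).hasFDerivAt.comp_hasDerivWithinAt s
      (hasDerivWithinAt_Ici_of_isIntegralCurveOn hγ hs)
  · rw [fderiv_re_apply_hamVectorField_pushHam (hΓ.differentiable one_ne_zero), norm_mul]
    exact mul_le_mul_of_nonneg_right (hC s (Ico_subset_Icc_self hs)) (norm_nonneg _)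

theorem mem_pushDomain_of_isIntegralCurveOn (hΓ : ContDiff ℝ 1 Γ)
    (hrot : ∀ α z, Γ (rotate α z) = Γ z) (hzero : ∀ z i, action i z = 0 → Γ =ᶠ[𝓝 z] 0)
    (hX : LipschitzWith L (hamVectorField (pushHam k Γ)))
    (hγ : IsIntegralCurveOn γ (fun _ => hamVectorField (pushHam k Γ)) (Icc a b)) (hkq : k q = 0)
    (hγa : γ a ∈ pushDomain q k I) (ht : t ∈ Icc a b) : γ t ∈ pushDomain q k I := by
  obtain ⟨hre, him, hq, hne⟩ := hγa
  have hre' : ∀ s ∈ Icc a b, (resMonomial k (γ s)).re = 0 := fun s =>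
    resMonomial_re_eq_zero_of_isIntegralCurveOn hΓ hγ hre
  have hne' : ∀ s ∈ Icc a b, ∀ i, action i (γ s) ≠ 0 := fun s hs i hi =>
    hne i (eq_of_isIntegralCurveOn_of_apply_eq_zero hX hγ hs
      (hamVectorField_pushHam_eq_zero (hzero _ i hi)) ▸ hi)
  refine ⟨hre' t ht, ?_, ?_, hne' t ht⟩
  · by_contra! hneg
    have hcont : ContinuousOn (fun s => (resMonomial k (γ s)).im) (Icc a t) :=
      (continuous_resMonomial_im k).comp_continuousOn
        (hγ.continuousOn.mono (Icc_subset_Icc_right ht.2))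
    obtain ⟨s, hs, him_s⟩ := intermediate_value_Icc' ht.1 hcont ⟨hneg, him.le⟩
    have hs' : s ∈ Icc a b := Icc_subset_Icc_right ht.2 hs
    exact resMonomial_ne_zero (hne' s hs') (Complex.ext (hre' s hs') him_s)
  · rwa [action_eq_add_integral hΓ hrot hγ ht, hkq, Int.cast_zero, zero_mul, add_zero]

theorem intervalIntegrable_push_speed (hΓ : Continuous Γ) (hγ : ContinuousOn γ (Icc a b))
    {s : ℝ} (hs : s ∈ Icc a b) (ht : t ∈ Icc a b) :
    IntervalIntegrable (fun s => Γ (γ s) * (resMonomial k (γ s)).im) MeasureTheory.volume s t :=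
  (((hΓ.comp_continuousOn hγ).mul
    ((continuous_resMonomial_im k).comp_continuousOn hγ)).mono
      (uIcc_subset_Icc hs ht)).intervalIntegrable

theorem mem_actionBox_of_isIntegralCurveOn (hΓ : ContDiff ℝ 1 Γ)
    (hrot : ∀ α z, Γ (rotate α z) = Γ z) (hnonneg : ∀ z, 0 ≤ Γ z)
    (hγ : IsIntegralCurveOn γ (fun _ => hamVectorField (pushHam k Γ)) (Icc a b))
    (him : ∀ s ∈ Icc a b, 0 ≤ (resMonomial k (γ s)).im) (hγa : γ a ∈ actionBox d ε M)
    (hγb : γ b ∈ actionBox d ε M) (ht : t ∈ Icc a b) : γ t ∈ actionBox d ε M := by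
  have hab : a ≤ b := ht.1.trans ht.2
  have hspeed : ∀ s ∈ Icc a b, 0 ≤ Γ (γ s) * (resMonomial k (γ s)).im := fun s hs =>
    mul_nonneg (hnonneg _) (him s hs)
  have hmono : ∫ s in a..t, Γ (γ s) * (resMonomial k (γ s)).im ≤
      ∫ s in a..b, Γ (γ s) * (resMonomial k (γ s)).im := by
    rw [← intervalIntegral.integral_add_adjacent_intervals
      (intervalIntegrable_push_speed hΓ.continuous hγ.continuousOn (left_mem_Icc.2 hab) ht)
      (intervalIntegrable_push_speed hΓ.continuous hγ.continuousOn ht (right_mem_Icc.2 hab)),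
      le_add_iff_nonneg_right]
    exact intervalIntegral.integral_nonneg ht.2 fun s hs => hspeed s ⟨ht.1.trans hs.1, hs.2⟩
  intro i
  refine uIcc_subset_Icc (hγa i) (hγb i) ?_
  rw [action_eq_add_integral hΓ hrot hγ ht,
    action_eq_add_integral hΓ hrot hγ (right_mem_Icc.2 hab)]
  exact add_mul_mem_uIcc _ _ (intervalIntegral.integral_nonneg ht.1 fun s hs =>
    hspeed s ⟨hs.1, hs.2.trans ht.2⟩) hmono

end Curves

/-- The map `e` pushes every point of `pushDomain q k I` by a nonnegative multiple of `k` in the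
actions, and by at least `m • k` if the point and its image are in the box `[ε, M]^d`. -/
def IsPushStep (q : Fin d) (k : Fin d → ℤ) (I : Set ℝ) (ε M m : ℝ) (e : Phase d → Phase d) : Prop :=
  ∀ y ∈ pushDomain q k I, e y ∈ pushDomain q k I ∧
    ∃ u : ℝ, 0 ≤ u ∧ (∀ i, action i (e y) = action i y + k i * u) ∧
      (y ∈ actionBox d ε M → e y ∈ actionBox d ε M → m ≤ u)

theorem isPushStep_of_isIntegralCurveOn {Γ : Phase d → ℝ} {L : NNReal} {κ m : ℝ}
    {e : Phase d → Phase d} (hΓ : ContDiff ℝ 1 Γ) (hrot : ∀ α z, Γ (rotate α z) = Γ z)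
    (hnonneg : ∀ z, 0 ≤ Γ z) (hzero : ∀ z i, action i z = 0 → Γ =ᶠ[𝓝 z] 0)
    (hX : LipschitzWith L (hamVectorField (pushHam k Γ))) (hkq : k q = 0)
    (he : ∀ y, ∃ γ, IsIntegralCurveOn γ (fun _ => hamVectorField (pushHam k Γ)) (Icc 0 1) ∧
      γ 0 = y ∧ γ 1 = e y)
    (hΓκ : ∀ z ∈ actionBox d ε M, action q z ∈ I → Γ z = κ)
    (hκ : 0 ≤ κ) (hm : ∀ z ∈ actionBox d ε M, m ≤ ‖resMonomial k z‖) :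
    IsPushStep q k I ε M (κ * m) e := by
  intro y hy
  obtain ⟨γ, hγ, rfl, hγ1⟩ := he y
  have hdom : ∀ s ∈ Icc (0 : ℝ) 1, γ s ∈ pushDomain q k I := fun s =>
    mem_pushDomain_of_isIntegralCurveOn hΓ hrot hzero hX hγ hkq hy
  have h1 : (1 : ℝ) ∈ Icc (0 : ℝ) 1 := right_mem_Icc.2 zero_le_one
  rw [← hγ1]
  refine ⟨hdom 1 h1, ∫ s in (0 : ℝ)..1, Γ (γ s) * (resMonomial k (γ s)).im,
    intervalIntegral.integral_nonneg zero_le_one fun s hs =>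
      mul_nonneg (hnonneg _) (hdom s hs).2.1.le,
    action_eq_add_integral hΓ hrot hγ h1, fun hbox hbox' => ?_⟩
  have hspeed : ∀ s ∈ Icc (0 : ℝ) 1, κ * m ≤ Γ (γ s) * (resMonomial k (γ s)).im := by
    intro s hs
    have hbox_s : γ s ∈ actionBox d ε M := mem_actionBox_of_isIntegralCurveOn hΓ hrot hnonneg hγ
      (fun s hs => (hdom s hs).2.1.le) hbox hbox' hs
    rw [hΓκ _ hbox_s (hdom s hs).2.2.1, ← norm_resMonomial_of_mem_pushDomain (hdom s hs)]
    exact mul_le_mul_of_nonneg_left (hm _ hbox_s) hκ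
  simpa using intervalIntegral.integral_mono_on zero_le_one
    (intervalIntegrable_const (c := κ * m))
    (intervalIntegrable_push_speed hΓ.continuous hγ.continuousOn (left_mem_Icc.2 zero_le_one) h1)
    hspeed

theorem exists_scaled_action_cutoff (q : Fin d) (k : Fin d → ℤ) {a₁ a₂ b₁ b₂ : ℝ} (hε : 0 < ε)
    (M : ℝ) (ha₁ : 0 < a₁) (hab : a₁ < b₁) (hba : b₂ < a₂) :
    ∃ (Γ : Phase d → ℝ) (κ : ℝ), 0 < κ ∧ ContDiff ℝ ∞ Γ ∧ (∀ α z, Γ (rotate α z) = Γ z) ∧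
      (∀ z, 0 ≤ Γ z) ∧ (∀ z i, action i z = 0 → Γ =ᶠ[𝓝 z] 0) ∧
      (∀ z, action q z ∉ Icc a₁ a₂ → Γ =ᶠ[𝓝 z] 0) ∧
      (∀ z ∈ actionBox d ε M, action q z ∈ Icc b₁ b₂ → Γ z = κ) ∧
      ∀ z, ‖fderiv ℝ (hamVectorField (pushHam k Γ)) z‖₊ ≤ 1 / 2 := by
  obtain ⟨Γ, hΓ, hrot, hnonneg, hcompact, hone, hzero⟩ := exists_action_cutoff
    (a := fun i => if i = q then b₁ else ε) (b := fun i => if i = q then b₂ else M)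
    (a' := fun i => if i = q then a₁ else ε / 2) (b' := fun i => if i = q then a₂ else M + 1)
    (fun i => by split_ifs <;> linarith)
    (fun i => by split_ifs <;> linarith)
  obtain ⟨κ, hκ, hκ_le⟩ := exists_pos_nnnorm_fderiv_hamVectorField_const_mul_le
    ((contDiff_pushHam k hΓ).of_le (WithTop.coe_le_coe.2 le_top))
    (hasCompactSupport_pushHam k hcompact) (L := 1 / 2) (by norm_num)
  have hzero' : ∀ z i, action i z ∉ Icc (if i = q then a₁ else ε / 2)
      (if i = q then a₂ else M + 1) → (fun z => κ * Γ z) =ᶠ[𝓝 z] 0 := fun z i hi =>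
    (hzero z i hi).mono fun y hy => by simp [hy]
  refine ⟨fun z => κ * Γ z, κ, hκ, contDiff_const.mul hΓ, fun α z => by simp only [hrot],
    fun z => mul_nonneg hκ.le (hnonneg z), fun z i hi => hzero' z i fun h => ?_,
    fun z hz => hzero' z q (by simpa only [if_true] using hz), fun z hz hzq => ?_,
    by rwa [pushHam_const_mul]⟩
  · have hpos : 0 < if i = q then a₁ else ε / 2 := by split_ifs <;> linarith
    exact hpos.not_ge (hi ▸ h.1)
  · dsimp only
    rw [hone z, mul_one]
    intro i
    split_ifs with hi
    exacts [hi ▸ hzq, hz i]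

theorem exists_isPushStep (q : Fin d) (k : Fin d → ℤ) {a₁ a₂ b₁ b₂ : ℝ} (hkq : k q = 0)
    (hε : 0 < ε) (M : ℝ) (ha₁ : 0 < a₁) (hab : a₁ < b₁) (hba : b₂ < a₂) :
    ∃ (e : Phase d ≃ Phase d) (m : ℝ), 0 < m ∧ IsSymplecto e ∧
      (∀ z i, action i z = 0 → e z = z) ∧ (∀ z, action q z ∉ Icc a₁ a₂ → e z = z) ∧
      (∀ z, ∃ u : ℝ, ∀ i, action i (e z) = action i z + k i * u) ∧
      IsPushStep q k (Icc b₁ b₂) ε M m e ∧ IsPushStep q (-k) (Icc b₁ b₂) ε M m e := by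
  obtain ⟨Γ, κ, hκ, hΓ, hrot, hnonneg, hzero, hzone, hΓκ, hX⟩ :=
    exists_scaled_action_cutoff q k hε M ha₁ hab hba
  have hΓ1 : ContDiff ℝ 1 Γ := hΓ.of_le (WithTop.coe_le_coe.2 le_top)
  have hpush := contDiff_pushHam k hΓ
  have hlip : LipschitzWith (1 / 2) (hamVectorField (pushHam k Γ)) :=
    lipschitzWith_of_nnnorm_fderiv_le
      ((contDiff_hamVectorField (m := 1) hpush (WithTop.coe_le_coe.2 le_top)).differentiable
        one_ne_zero) hX
  obtain ⟨e, he, hcurve⟩ := exists_isSymplecto_timeOneMap hpush (by norm_num) hX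
  have hfix : ∀ z, Γ =ᶠ[𝓝 z] 0 → e z = z := by
    intro z hz
    obtain ⟨γ, hγ, h0, h1⟩ := hcurve z
    rw [← h1]
    exact eqOn_Icc_of_isIntegralCurveOn hlip hγ ((isIntegralCurve_const fun _ =>
      hamVectorField_pushHam_eq_zero hz).isIntegralCurveOn _) h0 (right_mem_Icc.2 zero_le_one)
  obtain ⟨m, hm, hm_le⟩ := exists_pos_le_norm_resMonomial k hε M
  refine ⟨e, κ * m, mul_pos hκ hm, he, fun z i hz => hfix z (hzero z i hz),
    fun z hz => hfix z (hzone z hz), fun z => ?_, ?_, ?_⟩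
  · obtain ⟨γ, hγ, rfl, h1⟩ := hcurve z
    exact ⟨_, h1 ▸ action_eq_add_integral hΓ1 hrot hγ (right_mem_Icc.2 zero_le_one)⟩
  · exact isPushStep_of_isIntegralCurveOn hΓ1 hrot hnonneg hzero hlip hkq hcurve hΓκ hκ.le hm_le
  · rw [← pushHam_neg] at hlip hcurve
    exact isPushStep_of_isIntegralCurveOn hΓ1 hrot hnonneg hzero hlip (by simpa using hkq) hcurve
      hΓκ hκ.le fun z hz => by
        rw [resMonomial_neg, Complex.norm_conj]
        exact hm_le z hz

namespace IsPushStep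

variable {m : ℝ} {e : Phase d → Phase d}

theorem iterate (he : IsPushStep q k I ε M m e) {y : Phase d} (hy : y ∈ pushDomain q k I) (n : ℕ) :
    e^[n] y ∈ pushDomain q k I ∧
      ∃ u : ℝ, 0 ≤ u ∧ (∀ i, action i (e^[n] y) = action i y + k i * u) ∧
        ∀ u₀ : ℝ, 0 ≤ u₀ → (∀ i, action i y - k i * u₀ ∈ Icc ε M) →
          e^[n] y ∈ actionBox d ε M → n * m ≤ u := by
  induction n with
  | zero => exact ⟨hy, 0, le_rfl, by simp, by simp⟩
  | succ n ih =>
    obtain ⟨hdom, u, hu, hact, hlow⟩ := ih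
    obtain ⟨hdom', v, hv, hact', hlow'⟩ := he _ hdom
    rw [← Function.iterate_succ_apply' e n y] at hdom' hact' hlow'
    refine ⟨hdom', u + v, add_nonneg hu hv, fun i => by rw [hact', hact]; ring,
      fun u₀ hu₀ hbox₀ hbox => ?_⟩
    have hmid : e^[n] y ∈ actionBox d ε M := by
      intro i
      refine uIcc_subset_Icc (hbox₀ i) (hbox i) ?_
      have h := add_mul_mem_uIcc (action i y - k i * u₀) (k i) (add_nonneg hu₀ hu)
        (le_add_of_nonneg_right hv)
      have hmid_eq : action i (e^[n] y) = action i y - k i * u₀ + k i * (u₀ + u) := by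
        rw [hact]; ring
      have hend_eq : action i (e^[n + 1] y) = action i y - k i * u₀ + k i * (u₀ + u + v) := by
        rw [hact', hact]; ring
      rwa [hmid_eq, hend_eq]
    push_cast
    linarith [hlow u₀ hu₀ hbox₀ hmid, hlow' hmid hbox]

theorem iterate_notMem_actionBox (he : IsPushStep q k I ε M m e) (hk : k ≠ 0) {n : ℕ}
    (hn : M - ε < n * m) {y : Phase d} (hy : y ∈ pushDomain q k I) {u₀ : ℝ} (hu₀ : 0 ≤ u₀)
    (hbox₀ : ∀ i, action i y - k i * u₀ ∈ Icc ε M) : e^[n] y ∉ actionBox d ε M := by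
  intro hbox
  obtain ⟨-, u, hu, hact, hlow⟩ := he.iterate hy n
  obtain ⟨i, hi⟩ := Function.ne_iff.1 hk
  have hdisp : |(k i : ℝ) * (u₀ + u)| ≤ M - ε := by
    have h := abs_sub_le_of_le_of_le (hbox i).1 (hbox i).2 (hbox₀ i).1 (hbox₀ i).2
    rwa [hact, show action i y + k i * u - (action i y - k i * u₀) = k i * (u₀ + u) by ring] at h
  have hki : (1 : ℝ) ≤ |(k i : ℝ)| := mod_cast Int.one_le_abs hi
  rw [abs_mul, abs_of_nonneg (add_nonneg hu₀ hu)] at hdisp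
  linarith [le_mul_of_one_le_left (add_nonneg hu₀ hu) hki, hlow u₀ hu₀ hbox₀ hbox]

end IsPushStep

theorem exists_action_iterate_eq {e : Phase d → Phase d}
    (he : ∀ z, ∃ u : ℝ, ∀ i, action i (e z) = action i z + k i * u) (n : ℕ) (z : Phase d) :
    ∃ u : ℝ, ∀ i, action i (e^[n] z) = action i z + k i * u := by
  induction n with
  | zero => exact ⟨0, by simp⟩
  | succ n ih =>
    obtain ⟨u, hu⟩ := ih
    obtain ⟨v, hv⟩ := he (e^[n] z)
    exact ⟨u + v, fun i => by rw [Function.iterate_succ_apply', hv, hu]; ring⟩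

/-- A symplectic map supported in `{r_q ∈ J}` which moves the actions along `ℝ k` only, and moves
the points of the zone `{r_q ∈ I}` with `Z^k` on the positive (negative) imaginary axis along `k`
(along `-k`) until they leave the box of actions `[ε, M]^d`. -/
structure IsPush (q : Fin d) (k : Fin d → ℤ) (I J : Set ℝ) (ε M : ℝ) (f : Phase d ≃ Phase d) :
    Prop where
  isSymplecto : IsSymplecto f
  apply_of_action_eq_zero : ∀ z i, action i z = 0 → f z = z
  apply_of_notMem : ∀ z, action q z ∉ J → f z = z
  exists_action_apply : ∀ z, ∃ u : ℝ, ∀ i, action i (f z) = action i z + k i * u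
  exists_action_apply_of_mem : ∀ κ, κ = k ∨ κ = -k → ∀ y ∈ pushDomain q κ I,
    ∃ u : ℝ, 0 ≤ u ∧ ∀ i, action i (f y) = action i y + κ i * u
  apply_notMem_actionBox : ∀ κ, κ = k ∨ κ = -k → ∀ y ∈ pushDomain q κ I, ∀ u : ℝ, 0 ≤ u →
    (∀ i, action i y - κ i * u ∈ Icc ε M) → f y ∉ actionBox d ε M

theorem IsPush.action_apply_of_eq_zero {q : Fin d} {k : Fin d → ℤ} {I J : Set ℝ}
    {f : Phase d ≃ Phase d} (hf : IsPush q k I J ε M f) {i : Fin d} (hi : k i = 0) (z : Phase d) :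
    action i (f z) = action i z := by
  obtain ⟨u, hu⟩ := hf.exists_action_apply z
  rw [hu, hi, Int.cast_zero, zero_mul, add_zero]

theorem exists_isPush (q : Fin d) {k : Fin d → ℤ} {a₁ a₂ b₁ b₂ : ℝ} (hk : k ≠ 0) (hkq : k q = 0)
    (hε : 0 < ε) (M : ℝ) (ha₁ : 0 < a₁) (hab : a₁ < b₁) (hba : b₂ < a₂) :
    ∃ f : Phase d ≃ Phase d, IsPush q k (Icc b₁ b₂) (Icc a₁ a₂) ε M f := by
  obtain ⟨e, m, hm, he, hzero, hzone, hact, hstep, hstep_neg⟩ :=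
    exists_isPushStep q k hkq hε M ha₁ hab hba
  obtain ⟨N, hN⟩ := exists_nat_gt ((M - ε) / m)
  rw [div_lt_iff₀ hm] at hN
  have hstep' : ∀ κ, κ = k ∨ κ = -k → κ ≠ 0 ∧ IsPushStep q κ (Icc b₁ b₂) ε M m e := by
    rintro κ (rfl | rfl)
    exacts [⟨hk, hstep⟩, ⟨neg_ne_zero.2 hk, hstep_neg⟩]
  refine ⟨(e : Equiv.Perm (Phase d)) ^ N, he.pow N, fun z i hz => ?_, fun z hz => ?_, fun z => ?_,
    fun κ hκ y hy => ?_, fun κ hκ y hy u hu hbox => ?_⟩ <;> rw [← Equiv.Perm.iterate_eq_pow]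
  · exact Function.iterate_fixed (hzero z i hz) N
  · exact Function.iterate_fixed (hzone z hz) N
  · exact exists_action_iterate_eq hact N z
  · obtain ⟨-, u, hu, hact, -⟩ := (hstep' κ hκ).2.iterate hy N
    exact ⟨u, hu, hact⟩
  · exact (hstep' κ hκ).2.iterate_notMem_actionBox (hstep' κ hκ).1 hN hy hu hbox

end PushMaps

section Resonances

theorem exists_int_ne_zero_map_eq_zero {ι V : Type*} [Fintype ι] [AddCommGroup V] [Module ℚ V]
    [FiniteDimensional ℚ V] (f : (ι → ℚ) →ₗ[ℚ] V) (h : Module.finrank ℚ V < Fintype.card ι) :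
    ∃ k : ι → ℤ, k ≠ 0 ∧ f (fun i => (k i : ℚ)) = 0 := by
  classical
  have hker : LinearMap.ker f ≠ ⊥ :=
    LinearMap.ker_ne_bot_of_finrank_lt (by rwa [Module.finrank_fintype_fun_eq_card])
  obtain ⟨v, hv, hv0⟩ := (Submodule.ne_bot_iff _).1 hker
  obtain ⟨D, hD⟩ := IsLocalization.exist_integer_multiples_of_finset (nonZeroDivisors ℤ)
    (Finset.univ.image v)
  choose k hk using fun i => hD (v i) (Finset.mem_image_of_mem v (Finset.mem_univ i))
  have hkv : (fun i => (k i : ℚ)) = ((D : ℤ) : ℚ) • v := by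
    funext i
    simpa [Algebra.smul_def] using hk i
  have hD0 : ((D : ℤ) : ℚ) ≠ 0 := Int.cast_ne_zero.2 (nonZeroDivisors.ne_zero D.2)
  refine ⟨k, fun hk0 => smul_ne_zero hD0 hv0 ?_, ?_⟩
  · rw [← hkv, hk0]
    simp [funext_iff]
  · rw [hkv, map_smul, LinearMap.mem_ker.1 hv, smul_zero]

theorem exists_rat_vector_near {ι : Type*} [Fintype ι] (a : ι → ℝ) {δ : ℝ} (hδ : 0 < δ) :
    ∃ r : ι → ℚ, ‖(fun i => (r i : ℝ)) - a‖ ≤ δ := by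
  choose r hr using fun i => exists_rat_near (a i) hδ
  refine ⟨r, (pi_norm_le_iff_of_nonneg hδ.le).2 fun i => ?_⟩
  rw [Pi.sub_apply, Real.norm_eq_abs, abs_sub_comm]
  exact (hr i).le

variable {d : ℕ}

theorem exists_resonance (hd : 4 ≤ d) (q : Fin d) (a b : Fin d → ℝ) {δ : ℝ} (hδ : 0 < δ) :
    ∃ (c : (Fin d → ℝ) × (Fin d → ℝ)) (k : Fin d → ℤ), ‖c‖ ≤ δ ∧ k ≠ 0 ∧ k q = 0 ∧
      ∑ i, (k i : ℝ) * (a i + c.1 i) = 0 ∧ ∑ i, (k i : ℝ) * (b i + c.2 i) = 0 := by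
  obtain ⟨r, hr⟩ := exists_rat_vector_near a hδ
  obtain ⟨s, hs⟩ := exists_rat_vector_near b hδ
  let f : (Fin d → ℚ) →ₗ[ℚ] (Fin 3 → ℚ) := LinearMap.pi
    ![∑ i, r i • LinearMap.proj i, ∑ i, s i • LinearMap.proj i, LinearMap.proj q]
  obtain ⟨k, hk, hfk⟩ := exists_int_ne_zero_map_eq_zero f (by
    simp only [Module.finrank_fin_fun, Fintype.card_fin]
    omega)
  have hkr : ∑ i, r i * (k i : ℚ) = 0 := by simpa [f] using congrFun hfk 0
  have hks : ∑ i, s i * (k i : ℚ) = 0 := by simpa [f] using congrFun hfk 1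
  have hkq : (k q : ℚ) = 0 := by simpa [f] using congrFun hfk 2
  refine ⟨((fun i => (r i : ℝ)) - a, (fun i => (s i : ℝ)) - b), k, max_le hr hs, hk,
    Int.cast_eq_zero.1 hkq, ?_, ?_⟩ <;>
    simp only [Pi.sub_apply, add_sub_cancel, mul_comm (Int.cast _ : ℝ)]
  · exact_mod_cast hkr
  · exact_mod_cast hks

-- The rational slope `ρ > -a i₀ / a j₀` gives the resonance `ρ.den • e_{i₀} + ρ.num • e_{j₀}`.
theorem exists_nonneg_resonance {q i₀ j₀ : Fin d} (hi : i₀ ≠ q) (hj : j₀ ≠ q) (a : Fin d → ℝ)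
    (hai : a i₀ < 0) (haj : 0 < a j₀) {δ : ℝ} (hδ : 0 < δ) :
    ∃ (c : Fin d → ℝ) (k : Fin d → ℤ), ‖c‖ ≤ δ ∧ k ≠ 0 ∧ k q = 0 ∧ 0 ≤ k ∧
      ∑ i, (k i : ℝ) * (a i + c i) = 0 := by
  have hij : i₀ ≠ j₀ := by
    rintro rfl
    exact lt_asymm hai haj
  obtain ⟨ρ, hlow, hup⟩ := exists_rat_btwn
    (div_lt_div_of_pos_right (lt_add_of_pos_right (-a i₀) hδ) haj)
  rw [div_lt_iff₀ haj] at hlow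
  rw [lt_div_iff₀ haj] at hup
  have hρ : (0 : ℝ) < ρ := pos_of_mul_pos_left (by linarith) haj.le
  have hnum : 0 ≤ ρ.num := (Rat.num_pos.2 (Rat.cast_pos.1 hρ)).le
  refine ⟨Pi.single i₀ (-(ρ * a j₀) - a i₀), Pi.single i₀ (ρ.den : ℤ) + Pi.single j₀ ρ.num, ?_,
    fun h => ?_, by simp [hi.symm, hj.symm],
    add_nonneg (Pi.single_nonneg.2 (by positivity)) (Pi.single_nonneg.2 hnum), ?_⟩
  · rw [Pi.norm_single, Real.norm_eq_abs, abs_le]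
    constructor <;> linarith
  · simpa [hij] using congrFun h i₀
  · have hden : (ρ.den : ℝ) * ρ = ρ.num := by exact_mod_cast Rat.den_mul_eq_num ρ
    rw [Fintype.sum_eq_add i₀ j₀ hij fun i hi => by simp [hi.1, hi.2]]
    simp only [Pi.add_apply, Pi.single_eq_same, Pi.single_eq_of_ne hij, Pi.single_eq_of_ne hij.symm,
      add_zero, zero_add, Int.cast_natCast]
    linear_combination (-a j₀) * hden

end Resonances

section Zones

open Set

/-- The `j`-th zone of values of the action `r_q`. The zones cover `(0, ∞)`, with overlaps. -/
def zone (j : ℤ) : Set ℝ := Icc (1 / 2 / 4 ^ j) (4 / 4 ^ j)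

/-- A smaller version of `zone j`; the cores still cover `(0, ∞)`. -/
def zoneCore (j : ℤ) : Set ℝ := Icc (3 / 4 / 4 ^ j) (7 / 2 / 4 ^ j)

/-- A smooth function supported in `[1, 8]` and equal to `1` on `[2, 4]`. -/
def plateau (s : ℝ) : ℝ := Real.smoothTransition (2 - s / 4) - Real.smoothTransition (2 - s)

/-- The rescaled plateau functions: `zoneFun j` and `zoneFun (j + 1)` add up to `1` on `zone j`,
where all the others vanish. -/
def zoneFun (j : ℤ) (s : ℝ) : ℝ := plateau (4 ^ j * s)

theorem mem_Icc_div_zpow {a b s : ℝ} {j : ℤ} :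
    s ∈ Icc (a / 4 ^ j) (b / 4 ^ j) ↔ 4 ^ j * s ∈ Icc a b := by
  have hp : (0 : ℝ) < 4 ^ j := by positivity
  simp only [mem_Icc, div_le_iff₀ hp, le_div_iff₀ hp, mul_comm s]

theorem zoneCore_subset_zone (j : ℤ) : zoneCore j ⊆ zone j :=
  Icc_subset_Icc (div_le_div_of_nonneg_right (by norm_num) (by positivity))
    (div_le_div_of_nonneg_right (by norm_num) (by positivity))

theorem exists_mem_zoneCore {s : ℝ} (hs : 0 < s) : ∃ j : ℤ, s ∈ zoneCore j := by
  obtain ⟨n, hle, hlt⟩ := exists_mem_Ico_zpow (x := 4 / 3 * s) (y := (4 : ℝ)) (by positivity)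
    (by norm_num)
  have hp : (0 : ℝ) < 4 ^ n := by positivity
  rw [zpow_add_one₀ (by norm_num)] at hlt
  refine ⟨-n, mem_Icc_div_zpow.2 ?_⟩
  rw [zpow_neg, inv_mul_eq_div, mem_Icc, le_div_iff₀ hp, div_le_iff₀ hp]
  constructor <;> linarith

theorem contDiff_zoneFun (j : ℤ) : ContDiff ℝ ∞ (zoneFun j) := by
  unfold zoneFun plateau
  exact (Real.smoothTransition.contDiff.comp (by fun_prop)).sub
    (Real.smoothTransition.contDiff.comp (by fun_prop))

theorem plateau_of_le_one {s : ℝ} (h : s ≤ 1) : plateau s = 0 := by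
  rw [plateau, Real.smoothTransition.one_of_one_le (by linarith),
    Real.smoothTransition.one_of_one_le (by linarith), sub_self]

theorem plateau_of_eight_le {s : ℝ} (h : 8 ≤ s) : plateau s = 0 := by
  rw [plateau, Real.smoothTransition.zero_of_nonpos (by linarith),
    Real.smoothTransition.zero_of_nonpos (by linarith), sub_self]

theorem plateau_add_plateau_four_mul {s : ℝ} (h : s ∈ Icc (1 / 2 : ℝ) 4) :
    plateau s + plateau (4 * s) = 1 := by
  rw [plateau, plateau, mul_div_cancel_left₀ s (by norm_num),
    Real.smoothTransition.one_of_one_le (x := 2 - s / 4) (by linarith [h.2]),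
    Real.smoothTransition.zero_of_nonpos (x := 2 - 4 * s) (by linarith [h.1])]
  ring

theorem zoneFun_add_zoneFun {j : ℤ} {s : ℝ} (h : s ∈ zone j) :
    zoneFun j s + zoneFun (j + 1) s = 1 := by
  rw [zoneFun, zoneFun, zpow_add_one₀ (by norm_num), mul_right_comm, mul_comm _ (4 : ℝ),
    plateau_add_plateau_four_mul (mem_Icc_div_zpow.1 h)]

theorem zoneFun_eq_zero {i j : ℤ} {s : ℝ} (h : s ∈ zone j) (hij : i ≠ j) (hij' : i ≠ j + 1) :
    zoneFun i s = 0 := by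
  obtain ⟨hlow, hup⟩ := mem_Icc_div_zpow.1 h
  have hi : (4 : ℝ) ^ i * s = 4 ^ (i - j) * (4 ^ j * s) := by
    rw [← mul_assoc, ← zpow_add₀ (by norm_num), sub_add_cancel]
  rw [zoneFun, hi]
  rcases lt_or_gt_of_ne hij with hlt | hgt
  · have hpow : (4 : ℝ) ^ (i - j) ≤ 4 ^ (-1 : ℤ) := zpow_le_zpow_right₀ (by norm_num) (by omega)
    have hpos : (0 : ℝ) < 4 ^ (i - j) := by positivity
    rw [zpow_neg_one] at hpow
    exact plateau_of_le_one (by nlinarith)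
  · have hpow : (4 : ℝ) ^ (2 : ℤ) ≤ 4 ^ (i - j) := zpow_le_zpow_right₀ (by norm_num) (by omega)
    norm_num at hpow
    exact plateau_of_eight_le (by nlinarith)

theorem zoneFun_of_lt {j : ℤ} {s : ℝ} (h : s < 1 / 4 ^ j) : zoneFun j s = 0 := by
  rw [lt_div_iff₀' (by positivity)] at h
  exact plateau_of_le_one h.le

variable {E : Type*} [NormedAddCommGroup E] [NormedSpace ℝ E]

/-- A curve which runs on the segment `[c.1, c.2]` while the parameter is in `zone j`. -/
def zonePath (j : ℤ) (c : E × E) (s : ℝ) : E := zoneFun j s • c.1 + zoneFun (j + 1) s • c.2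

theorem contDiff_zonePath (j : ℤ) (c : E × E) : ContDiff ℝ ∞ (zonePath j c) :=
  ((contDiff_zoneFun j).smul contDiff_const).add ((contDiff_zoneFun (j + 1)).smul contDiff_const)

theorem deriv_zonePath (j : ℤ) (c : E × E) (s : ℝ) :
    deriv (zonePath j c) s = deriv (zoneFun j) s • c.1 + deriv (zoneFun (j + 1)) s • c.2 := by
  have hderiv : ∀ i, HasDerivAt (zoneFun i) (deriv (zoneFun i) s) s := fun i =>
    ((contDiff_zoneFun i).differentiable (by simp) s).hasDerivAt
  exact (((hderiv j).smul_const c.1).add ((hderiv (j + 1)).smul_const c.2)).deriv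

theorem zonePath_self (c : E) {j : ℤ} {s : ℝ} (h : s ∈ zone j) : zonePath j (c, c) s = c := by
  rw [zonePath, ← add_smul, zoneFun_add_zoneFun h, one_smul]

theorem zonePath_of_lt (c : E × E) {j : ℤ} {s : ℝ} (h : s < 1 / 4 ^ (j + 1)) :
    zonePath j c s = 0 := by
  have h' : s < 1 / 4 ^ j := h.trans_le (one_div_le_one_div_of_le (by positivity)
    (zpow_le_zpow_right₀ (by norm_num) (by omega)))
  rw [zonePath, zoneFun_of_lt h, zoneFun_of_lt h', zero_smul, zero_smul, add_zero]

theorem exists_eqOn_zone_smul_zoneFun (i j : ℤ) (c : E) :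
    ∃ c' : E × E, EqOn (fun s => zoneFun i s • c) (zonePath j c') (zone j) := by
  by_cases hij : i = j
  · exact ⟨(c, 0), fun s _ => by simp [zonePath, hij]⟩
  by_cases hij' : i = j + 1
  · exact ⟨(0, c), fun s _ => by simp [zonePath, hij']⟩
  · exact ⟨0, fun s hs => by simp [zonePath, zoneFun_eq_zero hs hij hij']⟩

/-- The frequency curves of the construction: constant near `0`, and running on a segment in each
zone. -/
structure IsFreqCurve (ω₀ : E) (w : ℝ → E) : Prop where
  contDiff : ContDiff ℝ ∞ w
  eq_of_lt : ∃ s₀ > 0, ∀ s < s₀, w s = ω₀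
  eqOn_zone : ∀ j : ℤ, ∃ c : E × E, EqOn w (zonePath j c) (zone j)

namespace IsFreqCurve

variable {ω₀ : E} {w : ℝ → E}

theorem const (ω₀ : E) : IsFreqCurve ω₀ (fun _ => ω₀) where
  contDiff := contDiff_const
  eq_of_lt := ⟨1, one_pos, fun _ _ => rfl⟩
  eqOn_zone _ := ⟨(ω₀, ω₀), fun _ hs => (zonePath_self ω₀ hs).symm⟩

theorem add_zonePath (hw : IsFreqCurve ω₀ w) (j : ℤ) (c : E × E) :
    IsFreqCurve ω₀ (w + zonePath j c) where
  contDiff := hw.contDiff.add (contDiff_zonePath j c)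
  eq_of_lt := by
    obtain ⟨s₀, hs₀, h⟩ := hw.eq_of_lt
    refine ⟨min s₀ (1 / 4 ^ (j + 1)), by positivity, fun s hs => ?_⟩
    rw [lt_min_iff] at hs
    rw [Pi.add_apply, h s hs.1, zonePath_of_lt c hs.2, add_zero]
  eqOn_zone i := by
    obtain ⟨c₀, h₀⟩ := hw.eqOn_zone i
    obtain ⟨c₁, h₁⟩ := exists_eqOn_zone_smul_zoneFun j i c.1
    obtain ⟨c₂, h₂⟩ := exists_eqOn_zone_smul_zoneFun (j + 1) i c.2
    refine ⟨c₀ + (c₁ + c₂), fun s hs => ?_⟩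
    calc w s + (zoneFun j s • c.1 + zoneFun (j + 1) s • c.2)
        = zonePath i c₀ s + (zonePath i c₁ s + zonePath i c₂ s) := by
          rw [h₀ hs, ← h₁ hs, ← h₂ hs]
      _ = zonePath i (c₀ + (c₁ + c₂)) s := by
          simp only [zonePath, Prod.fst_add, Prod.snd_add, smul_add]
          abel

end IsFreqCurve

end Zones

section Limits

open Set Filter

section Geometric

variable {α : Type*} [PseudoMetricSpace α] {f : ℕ → α} {N : ℕ}

theorem cauchySeq_of_dist_le_half_pow (h : ∀ n ≥ N, dist (f n) (f (n + 1)) ≤ (1 / 2) ^ n) :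
    CauchySeq f := by
  rw [← cauchySeq_shift N]
  refine cauchySeq_of_le_geometric (1 / 2 : ℝ) ((1 / 2) ^ N) (by norm_num) fun n => ?_
  rw [← pow_add, add_comm N n, add_right_comm]
  exact h (n + N) le_add_self

theorem dist_le_of_dist_le_half_pow (h : ∀ n ≥ N, dist (f n) (f (n + 1)) ≤ (1 / 2) ^ n) {a : α}
    (ha : Tendsto f atTop (𝓝 a)) : dist (f N) a ≤ 2 * (1 / 2) ^ N := by
  have hshift : ∀ n, dist (f (n + N)) (f (n + 1 + N)) ≤ (1 / 2) ^ N * (1 / 2) ^ n := fun n => by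
    rw [← pow_add, add_comm N n, add_right_comm]
    exact h (n + N) le_add_self
  have hdist := dist_le_of_le_geometric_of_tendsto₀ (1 / 2 : ℝ) _ (by norm_num) hshift
    ((tendsto_add_atTop_iff_nat N).2 ha)
  rw [zero_add] at hdist
  exact hdist.trans_eq (by ring)

theorem exists_limit_of_dist_le_half_pow {α β : Type*} [PseudoMetricSpace β] [CompleteSpace β]
    {f : ℕ → α → β} {s : ℕ → Set α} (hs : Monotone s) (hcover : ∀ x, ∃ n, x ∈ s n)
    (h : ∀ n, ∀ x ∈ s n, dist (f n x) (f (n + 1) x) ≤ (1 / 2) ^ n) :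
    ∃ g : α → β, (∀ x, Tendsto (fun n => f n x) atTop (𝓝 (g x))) ∧
      ∀ n, ∀ x ∈ s n, dist (f n x) (g x) ≤ 2 * (1 / 2) ^ n := by
  have hlim x : ∃ y, Tendsto (fun n => f n x) atTop (𝓝 y) := by
    obtain ⟨N, hN⟩ := hcover x
    exact cauchySeq_tendsto_of_complete
      (cauchySeq_of_dist_le_half_pow fun n hn => h n x (hs hn hN))
  choose g hg using hlim
  exact ⟨g, hg, fun N x hx => dist_le_of_dist_le_half_pow (fun n hn => h n x (hs hn hx)) (hg x)⟩

end Geometric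

section Series

theorem exists_summable_bound_on_ball {E G : Type*} [NormedAddCommGroup E] [ProperSpace E]
    [NormedAddCommGroup G] {F : ℕ → E → G} {u : ℕ → ℝ} {p : ℕ}
    (hF : ∀ n, Continuous (F n)) (hu : Summable u)
    (hb : ∀ n z, p ≤ n → ‖z‖ ≤ n → ‖F n z‖ ≤ u n) (R : ℝ) :
    ∃ v : ℕ → ℝ, Summable v ∧ ∀ n, ∀ z ∈ Metric.ball (0 : E) R, ‖F n z‖ ≤ v n := by
  obtain ⟨N, hN⟩ := exists_nat_ge R
  choose B hB using fun n => (isCompact_closedBall (0 : E) R).exists_bound_of_continuousOn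
    (hF n).continuousOn
  refine ⟨fun n => if N + p ≤ n then u n else B n, ?_, fun n z hz => ?_⟩
  · rw [← summable_nat_add_iff (N + p)]
    simpa using (summable_nat_add_iff (N + p)).2 hu
  · dsimp only
    split_ifs with h
    · have hNn : (N : ℝ) ≤ n := by exact_mod_cast (Nat.le_add_right N p).trans h
      exact hb n z ((Nat.le_add_left p N).trans h) (by linarith [mem_ball_zero_iff.1 hz])
    · exact hB n z (Metric.ball_subset_closedBall hz)

theorem summable_of_norm_le_on_balls {E G : Type*} [NormedAddCommGroup E] [ProperSpace E]
    [NormedAddCommGroup G] [CompleteSpace G] {F : ℕ → E → G} {u : ℕ → ℝ} {p : ℕ}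
    (hF : ∀ n, Continuous (F n)) (hu : Summable u)
    (hb : ∀ n z, p ≤ n → ‖z‖ ≤ n → ‖F n z‖ ≤ u n) (z : E) : Summable fun n => F n z := by
  obtain ⟨v, hv, hvb⟩ := exists_summable_bound_on_ball hF hu hb (‖z‖ + 1)
  exact .of_norm_bounded hv fun n => hvb n z (by simp)

variable {E : Type*} [NormedAddCommGroup E] [NormedSpace ℝ E] [ProperSpace E]
  {G : Type*} [NormedAddCommGroup G] [NormedSpace ℝ G] [CompleteSpace G]
  {F : ℕ → E → G} {u : ℕ → ℝ} {p : ℕ}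

theorem hasFDerivAt_tsum_of_norm_le_on_balls (hF : ∀ n, ContDiff ℝ 1 (F n)) (hu : Summable u)
    (hb : ∀ n z, p ≤ n → ‖z‖ ≤ n → ‖F n z‖ ≤ u n)
    (hb' : ∀ n z, p ≤ n → ‖z‖ ≤ n → ‖fderiv ℝ (F n) z‖ ≤ u n) (z : E) :
    HasFDerivAt (fun y => ∑' n, F n y) (∑' n, fderiv ℝ (F n) z) z := by
  have hz : z ∈ Metric.ball (0 : E) (‖z‖ + 1) := by simp
  obtain ⟨v, hv, hvb⟩ := exists_summable_bound_on_ball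
    (fun n => (hF n).continuous_fderiv one_ne_zero) hu hb' (‖z‖ + 1)
  exact hasFDerivAt_tsum_of_isPreconnected hv Metric.isOpen_ball
    (convex_ball (0 : E) _).isPreconnected
    (fun n y _ => ((hF n).differentiable one_ne_zero y).hasFDerivAt) hvb hz
    (summable_of_norm_le_on_balls (fun n => (hF n).continuous) hu hb z) hz

theorem hasFDerivAt_tsum_iteratedFDeriv (hF : ∀ n, ContDiff ℝ ∞ (F n)) (hu : Summable u)
    (hb : ∀ n : ℕ, ∀ k ≤ n, ∀ z, ‖z‖ ≤ n → ‖iteratedFDeriv ℝ k (F n) z‖ ≤ u n) (k : ℕ) (z : E) :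
    HasFDerivAt (fun y => ∑' n, iteratedFDeriv ℝ k (F n) y)
      (∑' n, fderiv ℝ (iteratedFDeriv ℝ k (F n)) z) z := by
  refine hasFDerivAt_tsum_of_norm_le_on_balls (p := k + 1)
    (fun n => (hF n).iteratedFDeriv_right (by norm_cast; exact le_top)) hu
    (fun n y hn hy => hb n k (k.le_succ.trans hn) y hy) (fun n y hn hy => ?_) z
  rw [norm_fderiv_iteratedFDeriv]
  exact hb n (k + 1) hn y hy

theorem contDiff_tsum_of_norm_le_on_balls (hF : ∀ n, ContDiff ℝ ∞ (F n)) (hu : Summable u)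
    (hb : ∀ n : ℕ, ∀ k ≤ n, ∀ z, ‖z‖ ≤ n → ‖iteratedFDeriv ℝ k (F n) z‖ ≤ u n) :
    ContDiff ℝ ∞ fun y => ∑' n, F n y := by
  refine HasFTaylorSeriesUpTo.contDiff
    (f' := fun z k => ∑' n, iteratedFDeriv ℝ k (F n) z)
    ⟨fun z => ?_, fun k _ z => ?_, fun k _ => ?_⟩
  · exact ((continuousMultilinearCurryFin0 ℝ E G).toContinuousLinearEquiv.map_tsum).trans rfl
  · convert hasFDerivAt_tsum_iteratedFDeriv hF hu hb k z using 1
    exact (continuousMultilinearCurryLeftEquiv ℝ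
      (fun _ : Fin (k + 1) => E) G).toContinuousLinearEquiv.map_tsum
  · exact continuous_iff_continuousAt.2 fun z =>
      (hasFDerivAt_tsum_iteratedFDeriv hF hu hb k z).continuousAt

end Series

theorem exists_abs_le_mul_norm_pow {E : Type*} [NormedAddCommGroup E] [ProperSpace E]
    {F : E → ℝ} (hF : Continuous F) (h0 : F =ᶠ[𝓝 0] 0) (m : ℕ) (R : ℝ) :
    ∃ B, 0 ≤ B ∧ ∀ z, ‖z‖ ≤ R → |F z| ≤ B * ‖z‖ ^ m := by
  obtain ⟨A, hA⟩ := (isCompact_closedBall (0 : E) R).exists_bound_of_continuousOn hF.continuousOn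
  obtain ⟨ρ, hρ, hρ0⟩ := Metric.eventually_nhds_iff.1 h0
  refine ⟨|A| / ρ ^ m, by positivity, fun z hz => ?_⟩
  by_cases hzρ : ‖z‖ < ρ
  · rw [hρ0 (by simpa using hzρ), Pi.zero_apply, abs_zero]
    positivity
  · calc |F z| ≤ |A| := (hA z (by simpa using hz)).trans (le_abs_self A)
      _ = |A| / ρ ^ m * ρ ^ m := by field_simp
      _ ≤ |A| / ρ ^ m * ‖z‖ ^ m := by gcongr; exact not_lt.1 hzρ

section SmallOn

variable {E : Type*} [NormedAddCommGroup E] [NormedSpace ℝ E] {n : ℕ} {η η' : ℝ} {F G : E → ℝ}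

/-- `SmallOn n η F`: the smooth function `F` is `η`-small in `C^n` on the ball of radius `n`, and
vanishes to third order at the origin with constant `η`. This is the size in which the increments
of the approximating Hamiltonians are summed. -/
structure SmallOn (n : ℕ) (η : ℝ) (F : E → ℝ) : Prop where
  contDiff : ContDiff ℝ ∞ F
  norm_iteratedFDeriv_le : ∀ k ≤ n, ∀ z, ‖z‖ ≤ n → ‖iteratedFDeriv ℝ k F z‖ ≤ η
  abs_le : ∀ z, ‖z‖ ≤ 1 → |F z| ≤ η * ‖z‖ ^ 3

namespace SmallOn

theorem zero (n : ℕ) : SmallOn n 0 (0 : E → ℝ) where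
  contDiff := contDiff_const
  norm_iteratedFDeriv_le k _ z _ := by simp
  abs_le z _ := by simp

theorem mono (hF : SmallOn n η F) (h : η ≤ η') : SmallOn n η' F where
  contDiff := hF.contDiff
  norm_iteratedFDeriv_le k hk z hz := (hF.norm_iteratedFDeriv_le k hk z hz).trans h
  abs_le z hz := (hF.abs_le z hz).trans (by gcongr)

theorem add (hF : SmallOn n η F) (hG : SmallOn n η' G) : SmallOn n (η + η') (F + G) where
  contDiff := hF.contDiff.add hG.contDiff
  norm_iteratedFDeriv_le k hk z hz := by
    have hk' : (k : WithTop ℕ∞) ≤ ∞ := by exact_mod_cast le_top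
    rw [iteratedFDeriv_add_apply (hF.contDiff.of_le hk').contDiffAt
      (hG.contDiff.of_le hk').contDiffAt]
    exact norm_add_le_of_le (hF.norm_iteratedFDeriv_le k hk z hz)
      (hG.norm_iteratedFDeriv_le k hk z hz)
  abs_le z hz := by
    rw [add_mul]
    exact (abs_add_le _ _).trans (add_le_add (hF.abs_le z hz) (hG.abs_le z hz))

theorem const_smul (hF : SmallOn n η F) (c : ℝ) : SmallOn n (|c| * η) (c • F) where
  contDiff := contDiff_const.smul hF.contDiff
  norm_iteratedFDeriv_le k hk z hz := by
    rw [iteratedFDeriv_const_smul_apply (hF.contDiff.of_le (by exact_mod_cast le_top)).contDiffAt,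
      norm_smul, Real.norm_eq_abs]
    exact mul_le_mul_of_nonneg_left (hF.norm_iteratedFDeriv_le k hk z hz) (abs_nonneg c)
  abs_le z hz := by
    rw [Pi.smul_apply, smul_eq_mul, abs_mul, mul_assoc]
    exact mul_le_mul_of_nonneg_left (hF.abs_le z hz) (abs_nonneg c)

end SmallOn

variable {H : ℕ → E → ℝ}

theorem contDiff_of_smallOn_sub (h0 : ContDiff ℝ ∞ (H 0))
    (hs : ∀ n, SmallOn n ((1 / 2) ^ n) (H (n + 1) - H n)) (n : ℕ) : ContDiff ℝ ∞ (H n) := by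
  induction n with
  | zero => exact h0
  | succ n ih => simpa using ih.add (hs n).contDiff

variable [ProperSpace E]

theorem exists_norm_iteratedFDeriv_le_on_ball (n : ℕ) (hF : ContDiff ℝ ∞ F) (R : ℝ) :
    ∃ B, ∀ k ≤ n, ∀ z, ‖z‖ ≤ R → ‖iteratedFDeriv ℝ k F z‖ ≤ B := by
  choose A hA using fun k : ℕ => (isCompact_closedBall (0 : E) R).exists_bound_of_continuousOn
    (hF.continuous_iteratedFDeriv (m := k) (by exact_mod_cast le_top)).continuousOn
  obtain ⟨B, hB⟩ := ((finite_Iic n).image A).bddAbove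
  exact ⟨B, fun k hk z hz => (hA k z (by simpa using hz)).trans (hB (mem_image_of_mem A hk))⟩

theorem exists_smallOn (n : ℕ) (hF : ContDiff ℝ ∞ F) (h0 : F =ᶠ[𝓝 0] 0) :
    ∃ B > 0, SmallOn n B F := by
  obtain ⟨A, hA⟩ := exists_norm_iteratedFDeriv_le_on_ball n hF n
  obtain ⟨B, hB0, hB⟩ := exists_abs_le_mul_norm_pow hF.continuous h0 3 1
  refine ⟨|A| + B + 1, by positivity, hF, fun k hk z hz => ?_, fun z hz => ?_⟩
  · linarith [hA k hk z hz, le_abs_self A]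
  · refine (hB z hz).trans ?_
    gcongr
    linarith [abs_nonneg A]

theorem exists_smallOn_sum_smul {ι : Type*} (s : Finset ι) (n : ℕ) {F : ι → E → ℝ}
    (hF : ∀ i, ContDiff ℝ ∞ (F i)) (h0 : ∀ i, F i =ᶠ[𝓝 0] 0) (hη : 0 < η) :
    ∃ δ > 0, ∀ c : ι → ℝ, (∀ i, |c i| ≤ δ) → SmallOn n η (∑ i ∈ s, c i • F i) := by
  classical
  induction s using Finset.induction_on generalizing η with
  | empty => exact ⟨1, one_pos, fun c _ => by simpa using (SmallOn.zero n).mono hη.le⟩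
  | insert a s ha ih =>
    obtain ⟨δ, hδ, hsum⟩ := ih (half_pos hη)
    obtain ⟨B, hB, hFa⟩ := exists_smallOn n (hF a) (h0 a)
    refine ⟨min δ (η / 2 / B), by positivity, fun c hc => ?_⟩
    rw [Finset.sum_insert ha]
    have hca : |c a| * B ≤ η / 2 := (le_div_iff₀ hB).1 ((hc a).trans (min_le_right _ _))
    exact ((hFa.const_smul (c a)).add (hsum c fun i => (hc i).trans (min_le_left _ _))).mono
      (by linarith)

theorem tendsto_fderiv_of_smallOn_sub (h0 : ContDiff ℝ ∞ (H 0))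
    (hs : ∀ n, SmallOn n ((1 / 2) ^ n) (H (n + 1) - H n)) (z : E) :
    Tendsto (fun n => fderiv ℝ (H n) z) atTop
      (𝓝 (fderiv ℝ (H 0 + fun y => ∑' n, (H (n + 1) - H n) y) z)) := by
  have hHd n : DifferentiableAt ℝ (H n) z :=
    (contDiff_of_smallOn_sub h0 hs n).differentiable (by simp) z
  have hFc n : ContDiff ℝ 1 (H (n + 1) - H n) := (hs n).contDiff.of_le (by simp)
  have hb (n : ℕ) z (_ : 1 ≤ n) (hz : ‖z‖ ≤ n) : ‖(H (n + 1) - H n) z‖ ≤ (1 / 2) ^ n := by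
    simpa using (hs n).norm_iteratedFDeriv_le 0 n.zero_le z hz
  have hb' (n : ℕ) z (hn : 1 ≤ n) (hz : ‖z‖ ≤ n) :
      ‖fderiv ℝ (H (n + 1) - H n) z‖ ≤ (1 / 2) ^ n := by
    rw [← norm_iteratedFDeriv_one]
    exact (hs n).norm_iteratedFDeriv_le 1 hn z hz
  have hsum := (summable_of_norm_le_on_balls (fun n => (hFc n).continuous_fderiv one_ne_zero)
    summable_geometric_two hb' z).hasSum.tendsto_sum_nat.const_add (fderiv ℝ (H 0) z)
  rw [((hHd 0).hasFDerivAt.add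
    (hasFDerivAt_tsum_of_norm_le_on_balls hFc summable_geometric_two hb hb' z)).fderiv]
  refine hsum.congr fun n => ?_
  simp only [fderiv_sub (hHd _) (hHd _), Finset.sum_range_sub (fun n => fderiv ℝ (H n) z),
    add_sub_cancel]

theorem exists_smooth_limit (h0 : ContDiff ℝ ∞ (H 0))
    (hs : ∀ n, SmallOn n ((1 / 2) ^ n) (H (n + 1) - H n)) :
    ∃ K : E → ℝ, ContDiff ℝ ∞ K ∧ (fun z => K z - H 0 z) =O[𝓝 0] (fun z => ‖z‖ ^ 3) ∧
      ∀ (N : ℕ) (z : E), 1 ≤ N → ‖z‖ ≤ N →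
        ‖fderiv ℝ (H N) z - fderiv ℝ K z‖ ≤ 2 * (1 / 2) ^ N := by
  refine ⟨H 0 + fun z => ∑' n, (H (n + 1) - H n) z,
    h0.add (contDiff_tsum_of_norm_le_on_balls (fun n => (hs n).contDiff) summable_geometric_two
      fun n => (hs n).norm_iteratedFDeriv_le), ?_, fun N z hN hz => ?_⟩
  · refine .of_bound 2 ?_
    filter_upwards [Metric.closedBall_mem_nhds (0 : E) one_pos] with z hz
    rw [Pi.add_apply, add_sub_cancel_left, norm_pow, norm_norm]
    exact tsum_of_norm_bounded (hasSum_geometric_two.mul_right _) fun n =>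
      (hs n).abs_le z (by simpa using hz)
  · rw [← dist_eq_norm]
    refine dist_le_of_dist_le_half_pow (fun n hn => ?_) (tendsto_fderiv_of_smallOn_sub h0 hs z)
    have hHd n : DifferentiableAt ℝ (H n) z :=
      (contDiff_of_smallOn_sub h0 hs n).differentiable (by simp) z
    rw [dist_comm, dist_eq_norm, ← fderiv_sub (hHd _) (hHd _), ← norm_iteratedFDeriv_one]
    exact (hs n).norm_iteratedFDeriv_le 1 (hN.trans hn) z (hz.trans (by exact_mod_cast hn))

end SmallOn

section FlowLimit

theorem tendstoLocallyUniformly_of_dist_le {α β : Type*} [TopologicalSpace α] [PseudoMetricSpace β]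
    {F : ℕ → α → β} {f : α → β} {ρ : α → ℝ} (hρ : Continuous ρ) {R u : ℕ → ℝ}
    (hR : Tendsto R atTop atTop) (hu : Tendsto u atTop (𝓝 0))
    (h : ∀ᶠ n in atTop, ∀ x, ρ x ≤ R n → dist (f x) (F n x) ≤ u n) :
    TendstoLocallyUniformly F f atTop := by
  refine Metric.tendstoLocallyUniformly_iff.2 fun ε hε x =>
    ⟨{y | ρ y < ρ x + 1}, (isOpen_Iio.preimage hρ).mem_nhds (by simp), ?_⟩
  filter_upwards [h, hR.eventually_ge_atTop (ρ x + 1), hu.eventually_lt_const hε]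
    with n hn hRn hun y hy
  exact (hn y ((le_of_lt hy).trans hRn)).trans_lt hun

theorem tendstoLocallyUniformly_apply_apply {ι α β γ : Type*} [TopologicalSpace α]
    [UniformSpace β] [UniformSpace γ] {l : Filter ι} {F : ι → β → γ} {f : β → γ} {G : ι → α → β}
    {g : α → β} (hF : TendstoLocallyUniformly F f l) (hf : Continuous f)
    (hG : TendstoLocallyUniformly G g l) (hg : Continuous g) :
    TendstoLocallyUniformly (fun i x => F i (G i x)) (fun x => f (g x)) l := by
  rw [tendstoLocallyUniformly_iff_forall_tendsto] at *
  intro x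
  have hGx : Tendsto (fun y : ι × α => G y.1 y.2) (l ×ˢ 𝓝 x) (𝓝 (g x)) :=
    (hg.continuousAt.tendsto.comp tendsto_snd).congr_uniformity (hG x)
  have hfg : Tendsto (fun y : ι × α => f (G y.1 y.2)) (l ×ˢ 𝓝 x) (𝓝 (f (g x))) :=
    hf.continuousAt.tendsto.comp hGx
  have hFG : Tendsto (fun y : ι × α => F y.1 (G y.1 y.2)) (l ×ˢ 𝓝 x) (𝓝 (f (g x))) :=
    hfg.congr_uniformity ((hF (g x)).comp (tendsto_fst.prodMk hGx))
  exact ((((hf.comp hg).continuousAt.tendsto.comp tendsto_snd).prodMk_nhds hFG).mono_right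
    (nhds_le_uniformity _))

theorem hasDerivAt_of_tendstoLocallyUniformly_vectorField {E : Type*} [NormedAddCommGroup E]
    [NormedSpace ℝ E] {X : ℕ → E → E} {Y : E → E} {γ : ℕ → ℝ → E} {ξ : ℝ → E}
    (hX : TendstoLocallyUniformly X Y atTop) (hY : Continuous Y)
    (hγξ : TendstoLocallyUniformly γ ξ atTop)
    (hγ : ∀ n t, HasDerivAt (γ n) (X n (γ n t)) t) (t : ℝ) : HasDerivAt ξ (Y (ξ t)) t := by
  have hξ : Continuous ξ := hγξ.continuous (.of_forall fun n =>
    continuous_iff_continuousAt.2 fun s => (hγ n s).continuousAt)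
  exact hasDerivAt_of_tendstoLocallyUniformlyOn isOpen_univ
    (tendstoLocallyUniformlyOn_univ.2 (tendstoLocallyUniformly_apply_apply hX hY hγξ hξ))
    (.of_forall fun n s _ => hγ n s)
    (fun s _ => (tendstoLocallyUniformlyOn_univ.2 hγξ).tendsto_at (mem_univ s)) (mem_univ t)

theorem tendsto_two_mul_half_pow : Tendsto (fun n : ℕ => 2 * ((1 : ℝ) / 2) ^ n) atTop (𝓝 0) := by
  simpa using (tendsto_pow_atTop_nhds_zero_of_lt_one (r := (1 : ℝ) / 2) (by norm_num)
    (by norm_num)).const_mul 2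

variable {d : ℕ}

theorem norm_hamVectorField_sub_le (F G : Phase d → ℝ) (z : Phase d) :
    ‖hamVectorField F z - hamVectorField G z‖ ≤ ‖fderiv ℝ F z - fderiv ℝ G z‖ := by
  have hunit (v : Phase d) (hv : ‖v‖ ≤ 1) :
      ‖fderiv ℝ F z v - fderiv ℝ G z v‖ ≤ ‖fderiv ℝ F z - fderiv ℝ G z‖ :=
    (fderiv ℝ F z - fderiv ℝ G z).unit_le_opNorm v hv
  refine max_le ((pi_norm_le_iff_of_nonneg (norm_nonneg _)).2 fun j => ?_)
    ((pi_norm_le_iff_of_nonneg (norm_nonneg _)).2 fun j => ?_)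
  · exact hunit (0, Pi.single j 1) (by simp [Prod.norm_def, Pi.norm_single])
  · simpa [hamVectorField, neg_add_eq_sub, abs_sub_comm] using hunit (Pi.single j 1, 0)
      (by simp [Prod.norm_def, Pi.norm_single])

theorem exists_isHamFlow_limit {H : ℕ → Phase d → ℝ} {K : Phase d → ℝ} (hK : ContDiff ℝ 1 K)
    (hHK : ∀ (N : ℕ) (z : Phase d), 1 ≤ N → ‖z‖ ≤ N →
      ‖fderiv ℝ (H N) z - fderiv ℝ K z‖ ≤ 2 * (1 / 2) ^ N)
    {Ψ : ℕ → ℝ → Phase d → Phase d} (hΨ : ∀ n, IsHamFlow (H n) (Ψ n)) {T : ℕ → ℝ}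
    (hT : Monotone T) (hT' : Tendsto T atTop atTop)
    (hclose : ∀ n t z, |t| ≤ T n → ‖z‖ ≤ n → ‖Ψ (n + 1) t z - Ψ n t z‖ ≤ (1 / 2) ^ n) :
    ∃ Φ : ℝ → Phase d → Phase d, IsHamFlow K Φ ∧
      (∀ t z, Tendsto (fun n => Ψ n t z) atTop (𝓝 (Φ t z))) ∧
      ∀ N t z, |t| ≤ T N → ‖z‖ ≤ N → ‖Ψ N t z - Φ t z‖ ≤ 2 * (1 / 2) ^ N := by
  have hnorm (z : Phase d) : ∀ᶠ n : ℕ in atTop, ‖z‖ ≤ n :=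
    tendsto_natCast_atTop_atTop.eventually_ge_atTop _
  obtain ⟨Φ, hΦ, hdist⟩ := exists_limit_of_dist_le_half_pow
    (f := fun n (p : ℝ × Phase d) => Ψ n p.1 p.2) (s := fun n => {p | |p.1| ≤ T n ∧ ‖p.2‖ ≤ n})
    (fun m n hmn p hp => ⟨hp.1.trans (hT hmn), hp.2.trans (by exact_mod_cast hmn)⟩)
    (fun p => ((hT'.eventually_ge_atTop |p.1|).and (hnorm p.2)).exists)
    (fun n p hp => by rw [dist_comm, dist_eq_norm]; exact hclose n p.1 p.2 hp.1 hp.2)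
  have hvf : TendstoLocallyUniformly (fun n => hamVectorField (H n)) (hamVectorField K) atTop := by
    refine tendstoLocallyUniformly_of_dist_le continuous_norm tendsto_natCast_atTop_atTop
      tendsto_two_mul_half_pow ((eventually_ge_atTop 1).mono fun n hn z hz => ?_)
    rw [dist_comm, dist_eq_norm]
    exact (norm_hamVectorField_sub_le _ _ _).trans (hHK n z hn hz)
  refine ⟨fun t z => Φ (t, z), fun z => ⟨?_, fun t => ?_⟩, fun t z => hΦ (t, z),
    fun N t z ht hz => by rw [← dist_eq_norm]; exact hdist N (t, z) ⟨ht, hz⟩⟩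
  · exact tendsto_nhds_unique (hΦ (0, z)) (by simp [fun n => (hΨ n z).1])
  · refine hasDerivAt_of_tendstoLocallyUniformly_vectorField hvf
      (contDiff_hamVectorField (m := 0) hK (by simp)).continuous ?_ (fun n => (hΨ n z).2) t
    refine tendstoLocallyUniformly_of_dist_le continuous_abs hT' tendsto_two_mul_half_pow
      ((hnorm z).mono fun n hn t ht => ?_)
    rw [dist_comm]
    exact hdist n (t, z) ⟨ht, hn⟩

end FlowLimit

end Limits

section Stages

open Set Filter

variable {d : ℕ} {q : Fin d} {ω₀ : Fin d → ℝ}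

theorem exists_norm_sub_apply_zero_le {C X V : Type*} [SeminormedAddCommGroup C]
    [TopologicalSpace X] [SeminormedAddCommGroup V] {F : C → X → V}
    (hF : Continuous fun p : C × X => F p.1 p.2) {K : Set X} (hK : IsCompact K) {η : ℝ}
    (hη : 0 < η) : ∃ δ > 0, ∀ c, ‖c‖ ≤ δ → ∀ x ∈ K, ‖F c x - F 0 x‖ ≤ η := by
  have hF₀ : Continuous fun p : C × X => F 0 p.2 := hF.comp (by fun_prop : Continuous
    fun p : C × X => ((0 : C), p.2))
  have hev := hK.eventually_forall_of_forall_eventually (x₀ := (0 : C))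
    (P := fun c x => ‖F c x - F 0 x‖ < η) fun x _ =>
      (hF.sub hF₀).norm.continuousAt.eventually_lt_const (by simpa using hη)
  obtain ⟨δ, hδ, h⟩ := Metric.eventually_nhds_iff.1 hev
  exact ⟨δ / 2, half_pos hδ, fun c hc x hx =>
    (h (y := c) (by rw [dist_zero_right]; linarith) x hx).le⟩

theorem continuous_freq {X : Type*} [TopologicalSpace X] (q : Fin d) {w : X → ℝ → Fin d → ℝ}
    (hw : Continuous fun p : X × ℝ => w p.1 p.2)
    (hw' : Continuous fun p : X × ℝ => deriv (w p.1) p.2) :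
    Continuous fun p : X × Phase d => freq q (w p.1) p.2 := by
  have hact : ∀ i, Continuous fun p : X × Phase d => action i p.2 := fun i =>
    (continuous_action i).comp continuous_snd
  refine continuous_pi fun i => .add
    ((continuous_apply i).comp (hw.comp (continuous_fst.prodMk (hact q)))) ?_
  split_ifs
  · exact continuous_finsetSum _ fun l _ =>
      ((continuous_apply l).comp (hw'.comp (continuous_fst.prodMk (hact q)))).mul (hact l)
  · exact continuous_const

/-- A stage of the Anosov–Katok construction: an integrable Hamiltonian `∑ w_i(r_q) r_i`, given by
its frequency curve `w`, together with the symplectic map `e` that conjugates it to the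
approximating Hamiltonian. -/
structure Stage (q : Fin d) (ω₀ : Fin d → ℝ) where
  w : ℝ → Fin d → ℝ
  e : Phase d ≃ Phase d
  isFreqCurve : IsFreqCurve ω₀ w
  isSymplecto : IsSymplecto e
  action_e : ∀ z, action q (e z) = action q z
  e_of_action_eq_zero : ∀ z i, action i z = 0 → e z = z
  e_of_action_lt : ∃ s₀ > 0, ∀ z, action q z < s₀ → e z = z

namespace Stage

/-- The approximating Hamiltonian of a stage. -/
def ham (S : Stage q ω₀) : Phase d → ℝ := freqHam q S.w ∘ S.e.symm

/-- The Hamiltonian flow of the approximating Hamiltonian of a stage. -/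
def flow (S : Stage q ω₀) (t : ℝ) (z : Phase d) : Phase d := S.e (freqFlow q S.w t (S.e.symm z))

theorem contDiff_ham (S : Stage q ω₀) : ContDiff ℝ ∞ S.ham :=
  (contDiff_freqHam q S.isFreqCurve.contDiff).comp S.isSymplecto.contDiff_symm

theorem isHamFlow (S : Stage q ω₀) : IsHamFlow S.ham S.flow :=
  S.isSymplecto.isHamFlow_conj
    ((contDiff_freqHam q S.isFreqCurve.contDiff).differentiable (by simp))
    (isHamFlow_freqFlow q (S.isFreqCurve.contDiff.differentiable (by simp)))

theorem flow_eq_of_ham_eq {S S' : Stage q ω₀} (h : S.ham = S'.ham) : S.flow = S'.flow :=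
  IsHamFlow.unique (S.contDiff_ham.of_le (WithTop.coe_le_coe.2 le_top)) S.isHamFlow
    (h ▸ S'.isHamFlow)

theorem action_symm (S : Stage q ω₀) (z : Phase d) : action q (S.e.symm z) = action q z := by
  rw [← S.action_e, S.e.apply_symm_apply]

theorem symm_of_action_eq_zero (S : Stage q ω₀) {z : Phase d} {i : Fin d} (h : action i z = 0) :
    S.e.symm z = z := by
  rw [Equiv.symm_apply_eq, S.e_of_action_eq_zero z i h]

/-- The initial stage, with Hamiltonian `⟨ω₀, r⟩`. -/
def init (q : Fin d) (ω₀ : Fin d → ℝ) : Stage q ω₀ where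
  w := fun _ => ω₀
  e := Equiv.refl _
  isFreqCurve := .const ω₀
  isSymplecto := .refl
  action_e _ := rfl
  e_of_action_eq_zero _ _ _ := rfl
  e_of_action_lt := ⟨1, one_pos, fun _ _ => rfl⟩

/-- The stage obtained by moving the frequency curve in and around the zone `j`. -/
def perturb (S : Stage q ω₀) (j : ℤ) (c : (Fin d → ℝ) × (Fin d → ℝ)) : Stage q ω₀ where
  w := S.w + zonePath j c
  e := S.e
  isFreqCurve := S.isFreqCurve.add_zonePath j c
  isSymplecto := S.isSymplecto
  action_e := S.action_e
  e_of_action_eq_zero := S.e_of_action_eq_zero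
  e_of_action_lt := S.e_of_action_lt

/-- `Close n T η S S'`: the Hamiltonians of `S` and `S'` are `η`-close in `C^n` on the ball of
radius `n`, and their flows are `η`-close there up to time `T`. -/
structure Close (n : ℕ) (T η : ℝ) (S S' : Stage q ω₀) : Prop where
  smallOn : SmallOn n η (S'.ham - S.ham)
  norm_flow_sub_le : ∀ t z, |t| ≤ T → ‖z‖ ≤ n → ‖S'.flow t z - S.flow t z‖ ≤ η

theorem Close.trans {n : ℕ} {T η η' : ℝ} {S S' S'' : Stage q ω₀} (h : Close n T η S S')
    (h' : Close n T η' S' S'') : Close n T (η + η') S S'' where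
  smallOn := by simpa [add_comm] using h.smallOn.add h'.smallOn
  norm_flow_sub_le t z ht hz := by
    rw [← sub_add_sub_cancel (S''.flow t z) (S'.flow t z), add_comm η]
    exact norm_add_le_of_le (h'.norm_flow_sub_le t z ht hz) (h.norm_flow_sub_le t z ht hz)

section Perturb

variable (S : Stage q ω₀) (j : ℤ) (n : ℕ) {η : ℝ}

/-- The derivative of the Hamiltonian of a stage in the direction of the `i`-th frequency on the
zone `j`. -/
def zoneHam (i : Fin d) (z : Phase d) : ℝ := zoneFun j (action q z) * action i (S.e.symm z)

theorem contDiff_zoneHam (i : Fin d) : ContDiff ℝ ∞ (S.zoneHam j i) :=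
  ((contDiff_zoneFun j).comp (contDiff_action q)).mul
    ((contDiff_action i).comp S.isSymplecto.contDiff_symm)

theorem zoneHam_eventuallyEq_zero (i : Fin d) : S.zoneHam j i =ᶠ[𝓝 0] 0 := by
  have h0 : action q (0 : Phase d) < 1 / 4 ^ j := by
    rw [show action q (0 : Phase d) = 0 by simp [action]]
    positivity
  filter_upwards [(continuous_action q).continuousAt.eventually_lt_const h0] with z hz
  rw [zoneHam, zoneFun_of_lt hz, zero_mul, Pi.zero_apply]

theorem ham_perturb_sub (c : (Fin d → ℝ) × (Fin d → ℝ)) :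
    (S.perturb j c).ham - S.ham =
      ∑ i, c.1 i • S.zoneHam j i + ∑ i, c.2 i • S.zoneHam (j + 1) i := by
  funext z
  simp only [ham, perturb, freqHam, zonePath, zoneHam, Pi.add_apply, Pi.sub_apply, Pi.smul_apply,
    Finset.sum_apply, smul_eq_mul, Function.comp_apply, S.action_symm, ← Finset.sum_sub_distrib,
    ← Finset.sum_add_distrib]
  exact Finset.sum_congr rfl fun i _ => by ring

theorem exists_smallOn_ham_perturb_sub (hη : 0 < η) :
    ∃ δ > 0, ∀ c, ‖c‖ ≤ δ → SmallOn n η ((S.perturb j c).ham - S.ham) := by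
  obtain ⟨δ, hδ, h⟩ := exists_smallOn_sum_smul Finset.univ n (S.contDiff_zoneHam j)
    (S.zoneHam_eventuallyEq_zero j) (half_pos hη)
  obtain ⟨δ', hδ', h'⟩ := exists_smallOn_sum_smul Finset.univ n (S.contDiff_zoneHam (j + 1))
    (S.zoneHam_eventuallyEq_zero (j + 1)) (half_pos hη)
  refine ⟨min δ δ', by positivity, fun c hc => ?_⟩
  rw [ham_perturb_sub, ← add_halves η]
  refine (h c.1 fun i => ?_).add (h' c.2 fun i => ?_)
  · exact ((norm_le_pi_norm c.1 i).trans (norm_fst_le c)).trans (hc.trans (min_le_left _ _))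
  · exact ((norm_le_pi_norm c.2 i).trans (norm_snd_le c)).trans (hc.trans (min_le_right _ _))

theorem continuous_flow_perturb :
    Continuous fun p : ((Fin d → ℝ) × (Fin d → ℝ)) × (ℝ × Phase d) =>
      (S.perturb j p.1).flow p.2.1 p.2.2 := by
  have hzone i : Continuous (zoneFun i) := (contDiff_zoneFun i).continuous
  have hzone' i : Continuous (deriv (zoneFun i)) := (contDiff_zoneFun i).continuous_deriv (by simp)
  have hw := S.isFreqCurve.contDiff.continuous
  have hw' := S.isFreqCurve.contDiff.continuous_deriv (by simp)
  have hderiv (c : (Fin d → ℝ) × (Fin d → ℝ)) (s : ℝ) : deriv (S.w + zonePath j c) s =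
      deriv S.w s + (deriv (zoneFun j) s • c.1 + deriv (zoneFun (j + 1)) s • c.2) := by
    rw [deriv_add (S.isFreqCurve.contDiff.differentiable (by simp) s)
      ((contDiff_zonePath j c).differentiable (by simp) s), deriv_zonePath]
  have hfreq := continuous_freq q
    (w := fun c : (Fin d → ℝ) × (Fin d → ℝ) => S.w + zonePath j c)
    (by simp only [Pi.add_apply, zonePath]; fun_prop) (by simp only [hderiv]; fun_prop)
  have hsymm : Continuous fun p : ((Fin d → ℝ) × (Fin d → ℝ)) × (ℝ × Phase d) => S.e.symm p.2.2 :=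
    S.isSymplecto.contDiff_symm.continuous.comp (by fun_prop)
  exact S.isSymplecto.contDiff.continuous.comp (continuous_rotate
    (continuous_snd.fst.smul (hfreq.comp (continuous_fst.prodMk hsymm))) hsymm)

theorem perturb_zero : S.perturb j 0 = S := by
  simp [perturb, show zonePath j (0 : (Fin d → ℝ) × (Fin d → ℝ)) = 0 from
    funext fun s => by simp [zonePath]]

theorem exists_close_perturb (T : ℝ) (hη : 0 < η) :
    ∃ δ > 0, ∀ c, ‖c‖ ≤ δ → Close n T η S (S.perturb j c) := by
  obtain ⟨δ, hδ, hham⟩ := S.exists_smallOn_ham_perturb_sub j n hη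
  obtain ⟨δ', hδ', hflow⟩ := exists_norm_sub_apply_zero_le
    (F := fun c (p : ℝ × Phase d) => (S.perturb j c).flow p.1 p.2) (S.continuous_flow_perturb j)
    ((isCompact_Icc (a := -T) (b := T)).prod (isCompact_closedBall (0 : Phase d) n)) hη
  refine ⟨min δ δ', by positivity, fun c hc =>
    ⟨hham c (hc.trans (min_le_left _ _)), fun t z ht hz => ?_⟩⟩
  simpa only [perturb_zero] using hflow c (hc.trans (min_le_right _ _)) (t, z)
    ⟨abs_le.1 ht, mem_closedBall_zero_iff.2 hz⟩

end Perturb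

section Precomp

variable {j : ℤ} {k : Fin d → ℤ} {ε M : ℝ} {f : Phase d ≃ Phase d}

/-- The stage obtained by precomposing the conjugation of `S` with a push in the zone `j`. -/
def precomp (S : Stage q ω₀) (hkq : k q = 0) (hf : IsPush q k (zoneCore j) (zone j) ε M f) :
    Stage q ω₀ where
  w := S.w
  e := f.trans S.e
  isFreqCurve := S.isFreqCurve
  isSymplecto := hf.isSymplecto.trans S.isSymplecto
  action_e z := by rw [Equiv.trans_apply, S.action_e, hf.action_apply_of_eq_zero hkq]
  e_of_action_eq_zero z i hz := by
    rw [Equiv.trans_apply, hf.apply_of_action_eq_zero z i hz, S.e_of_action_eq_zero z i hz]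
  e_of_action_lt := by
    obtain ⟨s₀, hs₀, h⟩ := S.e_of_action_lt
    refine ⟨min s₀ (1 / 2 / 4 ^ j), by positivity, fun z hz => ?_⟩
    rw [lt_min_iff] at hz
    rw [Equiv.trans_apply, hf.apply_of_notMem z fun hmem => hz.2.not_ge hmem.1, h z hz.1]

theorem ham_precomp (S : Stage q ω₀) (hkq : k q = 0)
    (hf : IsPush q k (zoneCore j) (zone j) ε M f)
    (hres : ∀ s ∈ zone j, ∑ i, (k i : ℝ) * S.w s i = 0) : (S.precomp hkq hf).ham = S.ham := by
  have hfreq : ∀ z, freqHam q S.w (f z) = freqHam q S.w z := fun z => by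
    by_cases hz : action q z ∈ zone j
    · obtain ⟨u, hu⟩ := hf.exists_action_apply z
      calc freqHam q S.w (f z) = freqHam q S.w z + u * ∑ i, (k i : ℝ) * S.w (action q z) i := by
            simp only [freqHam, hf.action_apply_of_eq_zero hkq, hu, mul_add,
              Finset.sum_add_distrib, Finset.mul_sum]
            exact congrArg _ (Finset.sum_congr rfl fun i _ => by ring)
        _ = freqHam q S.w z := by rw [hres _ hz, mul_zero, add_zero]
    · rw [hf.apply_of_notMem z hz]
  funext z
  rw [ham, ham, Function.comp_apply, Function.comp_apply, ← f.apply_symm_apply (S.e.symm z), hfreq]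
  rfl

end Precomp

end Stage

end Stages

section Steps

open Set Filter

variable {d : ℕ} {q : Fin d} {k : Fin d → ℤ} {w : ℝ → Fin d → ℝ}

theorem sum_mul_freq (hkq : k q = 0) (w : ℝ → Fin d → ℝ) (z : Phase d) :
    ∑ i, (k i : ℝ) * freq q w z i = ∑ i, (k i : ℝ) * w (action q z) i := by
  refine Finset.sum_congr rfl fun i _ => ?_
  rcases eq_or_ne i q with rfl | hi
  · rw [hkq, Int.cast_zero, zero_mul, zero_mul]
  · simp [freq, hi]

theorem resMonomial_freqFlow (hkq : k q = 0) {z : Phase d} {l : ℝ}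
    (hl : ∑ i, (k i : ℝ) * w (action q z) i = l) (t : ℝ) :
    resMonomial k (freqFlow q w t z) =
      Complex.exp (-((t * l : ℝ) : ℂ) * Complex.I) * resMonomial k z := by
  have hsum : ∑ i, (k i : ℝ) * (t • freq q w z) i = t * l := by
    rw [← hl, ← sum_mul_freq hkq, Finset.mul_sum]
    exact Finset.sum_congr rfl fun i _ => mul_left_comm _ _ _
  rw [freqFlow, resMonomial_rotate, hsum]

theorem exists_exp_mul_eq_norm_mul_I (Z : ℂ) {l : ℝ} (hl : l ≠ 0) (a : ℝ) :
    ∃ t ∈ Icc a (a + 2 * Real.pi / |l|),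
      Complex.exp (-((t * l : ℝ) : ℂ) * Complex.I) * Z = ‖Z‖ * Complex.I := by
  have hper : Function.Periodic (fun t : ℝ => Complex.exp (-((t * l : ℝ) : ℂ) * Complex.I))
      (2 * Real.pi / |l|) := fun t => by
    have hlC : (l : ℂ) ≠ 0 := Complex.ofReal_ne_zero.2 hl
    rw [Complex.exp_eq_exp_iff_exists_int]
    rcases abs_choice l with h | h <;> rw [h]
    · exact ⟨-1, by push_cast; field_simp; ring⟩
    · exact ⟨1, by push_cast; field_simp; ring⟩
  obtain ⟨t, ht, hexp⟩ := hper.exists_mem_Ico (by positivity) ((Z.arg - Real.pi / 2) / l) a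
  refine ⟨t, Ico_subset_Icc_self ht, ?_⟩
  calc Complex.exp (-((t * l : ℝ) : ℂ) * Complex.I) * Z
      = Complex.exp (-((Z.arg - Real.pi / 2 : ℝ) : ℂ) * Complex.I) *
          (‖Z‖ * Complex.exp (Z.arg * Complex.I)) := by
        rw [← hexp, div_mul_cancel₀ _ hl, Complex.norm_mul_exp_arg_mul_I]
    _ = ‖Z‖ * Complex.exp (Real.pi / 2 * Complex.I) := by
        rw [mul_left_comm, ← Complex.exp_add]
        push_cast
        ring_nf
    _ = ‖Z‖ * Complex.I := by rw [Complex.exp_pi_div_two_mul_I]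

theorem exists_freqFlow_mem_pushDomain (hkq : k q = 0) {y : Phase d} {l : ℝ} (hl : l ≠ 0)
    (hsum : ∑ i, (k i : ℝ) * w (action q y) i = l) {I : Set ℝ} (hI : action q y ∈ I)
    (hy : ∀ i, action i y ≠ 0) (a : ℝ) :
    ∃ t ∈ Icc a (a + 2 * Real.pi / |l|), freqFlow q w t y ∈ pushDomain q k I := by
  obtain ⟨t, ht, hexp⟩ := exists_exp_mul_eq_norm_mul_I (resMonomial k y) hl a
  rw [← resMonomial_freqFlow hkq hsum] at hexp
  refine ⟨t, ht, ?_, ?_, ?_, fun i => ?_⟩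
  · simp [hexp]
  · simpa [hexp] using resMonomial_ne_zero hy
  · rwa [action_freqFlow]
  · rw [action_freqFlow]
    exact hy i

theorem exists_subset_actionBox {K : Set (Phase d)} (hK : IsCompact K)
    (hpos : ∀ z ∈ K, ∀ i, 0 < action i z) : ∃ ε M : ℝ, 0 < ε ∧ K ⊆ actionBox d ε M := by
  choose m hm hmK using fun i => hK.exists_forall_le' (continuous_action i).continuousOn
    fun z hz => hpos z hz i
  obtain ⟨ε, hε, hεm⟩ : ∃ ε : ℝ, 0 < ε ∧ ∀ i, ε < m i :=
    (eventually_mem_nhdsWithin.and (eventually_all.2 fun i =>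
      (eventually_lt_nhds (hm i)).filter_mono nhdsWithin_le_nhds)).exists (f := 𝓝[>] (0 : ℝ))
  obtain ⟨R, hR⟩ := hK.isBounded.exists_norm_le
  refine ⟨ε, R ^ 2, hε, fun z hz i => ⟨(hεm i).le.trans (hmK i z hz), ?_⟩⟩
  exact (action_le_norm_sq i z).trans (pow_le_pow_left₀ (norm_nonneg z) (hR z hz) 2)

/-- A compact exhaustion of the set where no action vanishes. -/
def compactCore (d n : ℕ) : Set (Phase d) :=
  {z | ‖z‖ ≤ n ∧ ∀ i, 1 / ((n : ℝ) + 1) ≤ action i z}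

theorem isCompact_compactCore (d n : ℕ) : IsCompact (compactCore d n) := by
  have hclosed : IsClosed {z : Phase d | ∀ i, 1 / ((n : ℝ) + 1) ≤ action i z} := by
    simp only [ofPred_forall]
    exact isClosed_iInter fun i => isClosed_le continuous_const (continuous_action i)
  exact (isCompact_closedBall (0 : Phase d) n).of_isClosed_subset
    ((isClosed_le continuous_norm continuous_const).inter hclosed) fun z hz =>
      mem_closedBall_zero_iff.2 hz.1

theorem action_pos_of_mem_compactCore {n : ℕ} {z : Phase d} (hz : z ∈ compactCore d n)
    (i : Fin d) : 0 < action i z :=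
  Nat.one_div_pos_of_nat.trans_le (hz.2 i)

namespace Stage

variable {ω₀ : Fin d → ℝ} {S S' : Stage q ω₀} {j : ℤ} {n : ℕ} {T : ℝ}

theorem symm_pos (S : Stage q ω₀) {z : Phase d} (hz : ∀ i, 0 < action i z) (i : Fin d) :
    0 < action i (S.e.symm z) := by
  refine (action_nonneg i _).lt_of_ne' fun h => (hz i).ne' ?_
  rwa [← S.e_of_action_eq_zero _ i h, S.e.apply_symm_apply] at h

/-- `IsResonantStep S S' j n T ε M k l f`: the stage `S'` is close to `S`, its conjugation is that
of `S` preceded by a push `f` in the zone `j`, and there the monomial `Z^k` rotates with the nonzero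
speed `l` under the flow of the integrable Hamiltonian of `S'`. -/
structure IsResonantStep (S S' : Stage q ω₀) (j : ℤ) (n : ℕ) (T ε M : ℝ) (k : Fin d → ℤ) (l : ℝ)
    (f : Phase d ≃ Phase d) : Prop where
  close : Close n T ((1 / 2) ^ n) S S'
  e_eq : S'.e = f.trans S.e
  apply_eq_zero : k q = 0
  pos : 0 < l
  sum_eq : ∀ s ∈ zone j, ∑ i, (k i : ℝ) * S'.w s i = l
  isPush : IsPush q k (zoneCore j) (zone j) ε M f

theorem exists_close_sum_eq_pos (S : Stage q ω₀) (n : ℕ) (T : ℝ) {η : ℝ} (hη : 0 < η) (hk : k ≠ 0)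
    (hres : ∀ s ∈ zone j, ∑ i, (k i : ℝ) * S.w s i = 0) :
    ∃ (S' : Stage q ω₀) (l : ℝ), Close n T η S S' ∧ S'.e = S.e ∧ 0 < l ∧
      ∀ s ∈ zone j, ∑ i, (k i : ℝ) * S'.w s i = l := by
  obtain ⟨δ, hδ, hclose⟩ := S.exists_close_perturb j n T hη
  let v : Fin d → ℝ := fun i => k i
  have hv : v ≠ 0 := fun h => hk (funext fun i => by simpa [v] using congrFun h i)
  let ρ : ℝ := δ / ‖v‖
  have hρ : 0 < ρ := div_pos hδ (norm_pos_iff.2 hv)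
  have hnorm : ‖(ρ • v, ρ • v)‖ ≤ δ := by
    rw [Prod.norm_mk, max_self, norm_smul, Real.norm_of_nonneg hρ.le,
      div_mul_cancel₀ _ (norm_ne_zero_iff.2 hv)]
  refine ⟨S.perturb j (ρ • v, ρ • v), ρ * (v ⬝ᵥ v), hclose _ hnorm, rfl,
    mul_pos hρ ?_, fun s hs => ?_⟩
  · exact (Finset.sum_nonneg fun i _ => mul_self_nonneg (v i)).lt_of_ne'
      (dotProduct_self_eq_zero.not.2 hv)
  · simp only [perturb, Pi.add_apply, zonePath_self _ hs, mul_add, Finset.sum_add_distrib,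
      hres s hs, zero_add]
    simp only [Pi.smul_apply, smul_eq_mul, v, dotProduct, Finset.mul_sum, mul_left_comm]

theorem exists_isResonantStep (S : Stage q ω₀) (j : ℤ) (n : ℕ) (T : ℝ) {P : (Fin d → ℤ) → Prop}
    (hres : ∀ δ > 0, ∃ c k, ‖c‖ ≤ δ ∧ k ≠ 0 ∧ k q = 0 ∧ P k ∧
      ∀ s ∈ zone j, ∑ i, (k i : ℝ) * (S.w s + zonePath j c s) i = 0)
    {ε : ℝ} (hε : 0 < ε) (M : ℝ) :
    ∃ S' k l f, P k ∧ IsResonantStep S S' j n T ε M k l f := by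
  have hη : (0 : ℝ) < (1 / 2) ^ n / 2 := by positivity
  obtain ⟨δ, hδ, hclose⟩ := S.exists_close_perturb j n T hη
  obtain ⟨c, k, hc, hk, hkq, hP, hzone⟩ := hres δ hδ
  have hp : (0 : ℝ) < 4 ^ j := by positivity
  obtain ⟨f, hf⟩ := exists_isPush q hk hkq hε M (a₁ := 1 / 2 / 4 ^ j) (a₂ := 4 / 4 ^ j)
    (b₁ := 3 / 4 / 4 ^ j) (b₂ := 7 / 2 / 4 ^ j) (by positivity)
    (div_lt_div_of_pos_right (by norm_num) hp) (div_lt_div_of_pos_right (by norm_num) hp)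
  let S₁ := (S.perturb j c).precomp hkq hf
  have hham : S₁.ham = (S.perturb j c).ham := (S.perturb j c).ham_precomp hkq hf hzone
  have hclose₁ : Close n T ((1 / 2) ^ n / 2) S S₁ :=
    ⟨hham ▸ (hclose c hc).smallOn, flow_eq_of_ham_eq hham ▸ (hclose c hc).norm_flow_sub_le⟩
  obtain ⟨S', l, hclose', he, hl, hsum⟩ := S₁.exists_close_sum_eq_pos n T hη hk hzone
  exact ⟨S', k, l, f, hP, add_halves ((1 / 2 : ℝ) ^ n) ▸ hclose₁.trans hclose', he, hkq, hl, hsum,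
    hf⟩

namespace IsResonantStep

variable {ε M l : ℝ} {f : Phase d ≃ Phase d}

theorem flow_eq (h : IsResonantStep S S' j n T ε M k l f) (t : ℝ) (z : Phase d) :
    S'.flow t z = S.e (f (freqFlow q S'.w t (f.symm (S.e.symm z)))) := by
  rw [flow, h.e_eq, Equiv.trans_apply, Equiv.symm_trans_apply]

theorem exists_freqFlow_mem (h : IsResonantStep S S' j n T ε M k l f) {κ : Fin d → ℤ}
    (hκ : κ = k ∨ κ = -k) {y : Phase d} (hyq : action q y ∈ zoneCore j) (hy : ∀ i, action i y ≠ 0)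
    (a : ℝ) :
    ∃ t ∈ Icc a (a + 2 * Real.pi / l), freqFlow q S'.w t y ∈ pushDomain q κ (zoneCore j) := by
  have hsum := h.sum_eq _ (zoneCore_subset_zone j hyq)
  rcases hκ with rfl | rfl
  · simpa only [abs_of_pos h.pos] using
      exists_freqFlow_mem_pushDomain h.apply_eq_zero h.pos.ne' hsum hyq hy a
  · simpa only [abs_neg, abs_of_pos h.pos] using
      exists_freqFlow_mem_pushDomain (k := -k) (l := -l) (by simp [h.apply_eq_zero])
        (neg_ne_zero.2 h.pos.ne') (by simp [Finset.sum_neg_distrib, hsum]) hyq hy a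

theorem exists_symm_flow_notMem_actionBox (h : IsResonantStep S S' j n T ε M k l f) (hε : 0 < ε)
    {z : Phase d} (hz : S.e.symm z ∈ actionBox d ε M) (hzq : action q z ∈ zoneCore j) (a : ℝ) :
    ∃ t ∈ Icc a (a + 2 * Real.pi / l), S.e.symm (S'.flow t z) ∉ actionBox d ε M := by
  obtain ⟨y, hy⟩ := f.surjective (S.e.symm z)
  have hyz : f.symm (S.e.symm z) = y := by rw [← hy, f.symm_apply_apply]
  have hyq : action q y = action q z := by
    rw [← h.isPush.action_apply_of_eq_zero h.apply_eq_zero, hy, S.action_symm]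
  rw [← hy] at hz
  have hy0 : ∀ i, action i y ≠ 0 := fun i hi => by
    have := (hz i).1
    rw [h.isPush.apply_of_action_eq_zero y i hi, hi] at this
    exact hε.not_ge this
  -- The sign of `κ` is chosen so that `y` lies beyond `f y` in the direction of the next push.
  obtain ⟨κ, u, hκ, hu, hact⟩ : ∃ (κ : Fin d → ℤ) (u : ℝ), (κ = k ∨ κ = -k) ∧ 0 ≤ u ∧
      ∀ i, action i (f y) = action i y - κ i * u := by
    obtain ⟨u, hu⟩ := h.isPush.exists_action_apply y
    rcases le_total u 0 with hu0 | hu0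
    · exact ⟨k, -u, .inl rfl, neg_nonneg.2 hu0, fun i => by rw [hu]; ring⟩
    · exact ⟨-k, u, .inr rfl, hu0, fun i => by rw [hu, Pi.neg_apply]; push_cast; ring⟩
  obtain ⟨t, ht, hmem⟩ := h.exists_freqFlow_mem hκ (by rwa [hyq]) hy0 a
  refine ⟨t, ht, ?_⟩
  rw [h.flow_eq, hyz, S.e.symm_apply_apply]
  refine h.isPush.apply_notMem_actionBox κ hκ _ hmem u hu fun i => ?_
  rw [action_freqFlow, ← hact]
  exact hz i

theorem exists_action_le_and_lt (h : IsResonantStep S S' j n T ε M k l f) (hε : ε ∈ zoneCore j)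
    (hε0 : 0 < ε) (hεM : ε ≤ M) (hk : 0 ≤ k) (hSe : ∀ z, action q z = ε → S.e z = z) :
    ∃ p, (∀ i, action i p ≤ ε) ∧
      ∃ t ∈ Icc 0 (2 * Real.pi / l), ∃ i, M < action i (S'.flow t p) := by
  have hkR : ∀ i, (0 : ℝ) ≤ k i := fun i => Int.cast_nonneg (hk i)
  have hSf : ∀ y, action q y = ε → S.e (f y) = f y := fun y hy =>
    hSe _ (by rw [h.isPush.action_apply_of_eq_zero h.apply_eq_zero, hy])
  let y₀ : Phase d := (fun _ => Real.sqrt (2 * ε), 0)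
  have hy₀ : ∀ i, action i y₀ = ε := fun i => by
    simp only [action, y₀, Pi.zero_apply]
    rw [Real.sq_sqrt (by positivity)]
    ring
  obtain ⟨t₁, -, hmem₁⟩ := h.exists_freqFlow_mem (.inr rfl) (y := y₀) (by rwa [hy₀])
    (fun i => by rw [hy₀]; exact hε0.ne') 0
  set y₁ := freqFlow q S'.w t₁ y₀ with hy₁_def
  have hy₁ : ∀ i, action i y₁ = ε := fun i => by rw [hy₁_def, action_freqFlow, hy₀]
  obtain ⟨t, ht, hmem₂⟩ := h.exists_freqFlow_mem (.inl rfl) (y := y₁) (by rwa [hy₁])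
    (fun i => by rw [hy₁]; exact hε0.ne') 0
  set y₂ := freqFlow q S'.w t y₁ with hy₂_def
  have hy₂ : ∀ i, action i y₂ = ε := fun i => by rw [hy₂_def, action_freqFlow, hy₁]
  obtain ⟨u, hu, hactu⟩ := h.isPush.exists_action_apply_of_mem (-k) (.inr rfl) y₁ hmem₁
  obtain ⟨v, hv, hactv⟩ := h.isPush.exists_action_apply_of_mem k (.inl rfl) y₂ hmem₂
  obtain ⟨i, hi⟩ := not_forall.1 (h.isPush.apply_notMem_actionBox k (.inl rfl) y₂ hmem₂ 0 le_rfl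
    fun i => by rw [mul_zero, sub_zero, hy₂]; exact ⟨le_rfl, hεM⟩)
  refine ⟨f y₁, fun i => ?_, t, by simpa using ht, i, ?_⟩
  · rw [hactu, hy₁, Pi.neg_apply, Int.cast_neg]
    linarith [mul_nonneg (hkR i) hu]
  · have hflow : S'.flow t (f y₁) = f y₂ := by
      rw [h.flow_eq, S.e.symm_apply_eq.2 (hSf y₁ (hy₁ q)).symm, f.symm_apply_apply, hSf y₂ (hy₂ q)]
    rw [hflow]
    refine not_le.1 fun hle => hi ⟨?_, hle⟩
    rw [hactv, hy₂]
    linarith [mul_nonneg (hkR i) hv]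

end IsResonantStep

/-- Every orbit that starts in the `n`-th compact core with `r_q` in the core of the zone `j` leaves
the compact core at some time in `[n, T]`. -/
def EscapesCore (q : Fin d) (j : ℤ) (n : ℕ) (T : ℝ) (Φ : ℝ → Phase d → Phase d) : Prop :=
  ∀ z ∈ compactCore d n, action q z ∈ zoneCore j → ∃ t ∈ Icc (n : ℝ) T, Φ t z ∉ compactCore d n

/-- Some orbit that starts `1 / (n + 1)`-close to the origin leaves the ball of radius `n` up to
time `T`. -/
def DiffusesAtScale (n : ℕ) (T : ℝ) (Φ : ℝ → Phase d → Phase d) : Prop :=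
  ∃ p t, ‖p‖ ≤ 1 / ((n : ℝ) + 1) ∧ |t| ≤ T ∧ n ≤ ‖Φ t p‖

theorem exists_resonance_on_zone (hd : 4 ≤ d) (S : Stage q ω₀) (j : ℤ) {δ : ℝ} (hδ : 0 < δ) :
    ∃ (c : (Fin d → ℝ) × (Fin d → ℝ)) (k : Fin d → ℤ), ‖c‖ ≤ δ ∧ k ≠ 0 ∧ k q = 0 ∧
      ∀ s ∈ zone j, ∑ i, (k i : ℝ) * (S.w s + zonePath j c s) i = 0 := by
  obtain ⟨c₀, hc₀⟩ := S.isFreqCurve.eqOn_zone j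
  obtain ⟨c, k, hc, hk, hkq, hres₁, hres₂⟩ := exists_resonance hd q c₀.1 c₀.2 hδ
  refine ⟨c, k, hc, hk, hkq, fun s hs => ?_⟩
  calc ∑ i, (k i : ℝ) * (S.w s + zonePath j c s) i
      = zoneFun j s * ∑ i, (k i : ℝ) * (c₀.1 i + c.1 i) +
          zoneFun (j + 1) s * ∑ i, (k i : ℝ) * (c₀.2 i + c.2 i) := by
        rw [hc₀ hs, Finset.mul_sum, Finset.mul_sum, ← Finset.sum_add_distrib]
        refine Finset.sum_congr rfl fun i _ => ?_
        simp only [zonePath, Pi.add_apply, Pi.smul_apply, smul_eq_mul]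
        ring
    _ = 0 := by rw [hres₁, hres₂, mul_zero, mul_zero, add_zero]

theorem exists_escape_step (hd : 4 ≤ d) (S : Stage q ω₀) (j : ℤ) (n : ℕ) (T : ℝ) :
    ∃ (S' : Stage q ω₀) (T' : ℝ), Close n T ((1 / 2) ^ n) S S' ∧ EscapesCore q j n T' S'.flow := by
  obtain ⟨ε, M, hε, hbox⟩ := exists_subset_actionBox
    ((isCompact_compactCore d n).image S.isSymplecto.contDiff_symm.continuous) <| by
      rintro - ⟨z, hz, rfl⟩
      exact S.symm_pos (action_pos_of_mem_compactCore hz)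
  obtain ⟨S', k, l, f, -, h⟩ := S.exists_isResonantStep (P := fun _ => True) j n T
    (fun δ hδ => by simpa using S.exists_resonance_on_zone hd j hδ) hε M
  refine ⟨S', n + 2 * Real.pi / l, h.close, fun z hz hzq => ?_⟩
  obtain ⟨t, ht, hnot⟩ :=
    h.exists_symm_flow_notMem_actionBox hε (hbox (mem_image_of_mem _ hz)) hzq n
  exact ⟨t, ht, fun hmem => hnot (hbox (mem_image_of_mem _ hmem))⟩

theorem exists_diffusion_step {i₀ j₀ : Fin d} (hi : i₀ ≠ q) (hj : j₀ ≠ q) (hωi : ω₀ i₀ < 0)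
    (hωj : 0 < ω₀ j₀) (S : Stage q ω₀) (n : ℕ) (T : ℝ) :
    ∃ (S' : Stage q ω₀) (T' : ℝ), Close n T ((1 / 2) ^ n) S S' ∧ DiffusesAtScale n T' S'.flow := by
  obtain ⟨s₁, hs₁, hw⟩ := S.isFreqCurve.eq_of_lt
  obtain ⟨s₂, hs₂, he⟩ := S.e_of_action_lt
  obtain ⟨m, hm⟩ := exists_pow_lt_of_lt_one
    (show 0 < min (min s₁ s₂) ((1 / ((n : ℝ) + 1)) ^ 2) / 4 by positivity)
    (show (1 / 4 : ℝ) < 1 by norm_num)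
  set ρ : ℝ := (1 / 4) ^ m with hρ_def
  have hρ : 0 < ρ := by positivity
  rw [lt_div_iff₀ four_pos, lt_min_iff, lt_min_iff] at hm
  have hzone : ∀ s ∈ zone m, s < s₁ := fun s hs => by
    have : s ≤ 4 * ρ := by simpa [hρ_def, div_eq_mul_inv] using hs.2
    linarith
  have hcore : ρ ∈ zoneCore m := mem_Icc_div_zpow.2 <| by
    rw [hρ_def, zpow_natCast, ← mul_pow]
    norm_num
  obtain ⟨S', k, l, f, hk, h⟩ := S.exists_isResonantStep (P := fun k => 0 ≤ k) m n T
    (fun δ hδ => by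
      obtain ⟨c, k, hc, hk, hkq, hk0, hres⟩ := exists_nonneg_resonance hi hj ω₀ hωi hωj hδ
      refine ⟨(c, c), k, by rwa [Prod.norm_mk, max_self], hk, hkq, hk0, fun s hs => ?_⟩
      rw [hw s (hzone s hs), zonePath_self c hs]
      exact hres) hρ (ρ + (n : ℝ) ^ 2)
  obtain ⟨p, hp, t, ht, i, hti⟩ := h.exists_action_le_and_lt hcore hρ
    (by linarith [sq_nonneg (n : ℝ)]) hk fun z hz => he z (by linarith)
  refine ⟨S', 2 * Real.pi / l, h.close, p, t, ?_, (abs_of_nonneg ht.1).trans_le ht.2, ?_⟩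
  · exact norm_le_of_action_le (by positivity) fun i => (hp i).trans (by linarith)
  · exact le_of_sq_le_sq (by linarith [action_le_norm_sq i (S'.flow t p)]) (norm_nonneg _)

theorem Close.refl (S : Stage q ω₀) (n : ℕ) (T : ℝ) {η : ℝ} (hη : 0 ≤ η) : Close n T η S S where
  smallOn := by simpa using (SmallOn.zero (E := Phase d) n).mono hη
  norm_flow_sub_le t z _ _ := by simpa using hη

/-- An enumeration of the zones in which each zone occurs infinitely often. -/
def zoneIndex (n : ℕ) : ℤ := Denumerable.ofNat ℤ (Nat.unpair n).1

theorem exists_zoneIndex_eq (j : ℤ) (N : ℕ) : ∃ n ≥ N, zoneIndex n = j :=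
  ⟨Nat.pair (Encodable.encode j) N, Nat.right_le_pair _ _, by
    rw [zoneIndex, Nat.unpair_pair, Denumerable.ofNat_encode]⟩

theorem exists_step (hd : 4 ≤ d) (hq : (∃ i j, ω₀ i < 0 ∧ 0 < ω₀ j) →
      ∃ i j, i ≠ q ∧ j ≠ q ∧ ω₀ i < 0 ∧ 0 < ω₀ j)
    (S : Stage q ω₀) (n : ℕ) (T : ℝ) :
    ∃ (S' : Stage q ω₀) (T' : ℝ), Close n T ((1 / 2) ^ n) S S' ∧
      (Odd n → EscapesCore q (zoneIndex (n / 2)) n T' S'.flow) ∧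
      (Even n → (∃ i j, ω₀ i < 0 ∧ 0 < ω₀ j) → DiffusesAtScale n T' S'.flow) := by
  rcases Nat.even_or_odd n with hn | hn
  · by_cases hmix : ∃ i j, ω₀ i < 0 ∧ 0 < ω₀ j
    · obtain ⟨i, j, hi, hj, hωi, hωj⟩ := hq hmix
      obtain ⟨S', T', hclose, hdiff⟩ := S.exists_diffusion_step hi hj hωi hωj n T
      exact ⟨S', T', hclose, fun hodd => absurd hn (Nat.not_even_iff_odd.2 hodd), fun _ _ => hdiff⟩
    · exact ⟨S, T, .refl S n T (by positivity),
        fun hodd => absurd hn (Nat.not_even_iff_odd.2 hodd), fun _ h => absurd h hmix⟩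
  · obtain ⟨S', T', hclose, hesc⟩ := S.exists_escape_step hd (zoneIndex (n / 2)) n T
    exact ⟨S', T', hclose, fun _ => hesc, fun heven => absurd heven (Nat.not_even_iff_odd.2 hn)⟩

theorem exists_stages (hd : 4 ≤ d) (hq : (∃ i j, ω₀ i < 0 ∧ 0 < ω₀ j) →
      ∃ i j, i ≠ q ∧ j ≠ q ∧ ω₀ i < 0 ∧ 0 < ω₀ j) :
    ∃ (S : ℕ → Stage q ω₀) (T : ℕ → ℝ), S 0 = init q ω₀ ∧ Monotone T ∧ Tendsto T atTop atTop ∧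
      (∀ n, Close n (T n) ((1 / 2) ^ n) (S n) (S (n + 1))) ∧
      (∀ n, Odd n → EscapesCore q (zoneIndex (n / 2)) n (T (n + 1)) (S (n + 1)).flow) ∧
      ((∃ i j, ω₀ i < 0 ∧ 0 < ω₀ j) →
        ∀ n, Even n → DiffusesAtScale n (T (n + 1)) (S (n + 1)).flow) := by
  choose nextS nextT hclose hesc hdiff using fun (S : Stage q ω₀) (n : ℕ) (T : ℝ) =>
    exists_step hd hq S n T
  let seq : ℕ → Stage q ω₀ × ℝ := fun n => Nat.rec (init q ω₀, 0)
    (fun n p => (nextS p.1 n p.2, max (nextT p.1 n p.2) (max p.2 n))) n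
  have hnext (n : ℕ) : nextT (seq n).1 n (seq n).2 ≤ (seq (n + 1)).2 := le_max_left _ _
  have hle (n : ℕ) : max (seq n).2 n ≤ (seq (n + 1)).2 := le_max_right _ _
  refine ⟨fun n => (seq n).1, fun n => (seq n).2, rfl,
    monotone_nat_of_le_succ fun n => (le_max_left _ _).trans (hle n), ?_,
    fun n => hclose _ _ _, fun n hn z hz hzq => ?_, fun hmix n hn => ?_⟩
  · rw [← tendsto_add_atTop_iff_nat 1]
    exact tendsto_atTop_mono (fun n => (le_max_right _ _).trans (hle n)) tendsto_natCast_atTop_atTop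
  · obtain ⟨t, ht, hnot⟩ := hesc (seq n).1 n (seq n).2 hn z hz hzq
    exact ⟨t, Icc_subset_Icc_right (hnext n) ht, hnot⟩
  · obtain ⟨p, t, hp, ht, hn⟩ := hdiff (seq n).1 n (seq n).2 hn hmix
    exact ⟨p, t, hp, ht.trans (hnext n), hn⟩

end Stage

end Steps

section ActionTori

open Set

variable {d : ℕ}

theorem rotate_rotate (a b : Fin d → ℝ) (z : Phase d) :
    rotate a (rotate b z) = rotate (a + b) z := by
  ext j <;> simp only [rotate, Pi.add_apply, Real.cos_add, Real.sin_add] <;> ring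

theorem rotate_congr {a b : Fin d → ℝ} {z : Phase d} (h : ∀ j, action j z ≠ 0 → a j = b j) :
    rotate a z = rotate b z := by
  have hcoord : ∀ j, (z.1 j = 0 ∧ z.2 j = 0) ∨ a j = b j := fun j =>
    (em (action j z = 0)).imp action_eq_zero.1 (h j)
  ext j <;> rcases hcoord j with ⟨hx, hy⟩ | hab <;> simp [rotate, *]

theorem eq_zero_of_rotGen_eq_zero {Ω : Fin d → ℝ} {z : Phase d} {j : Fin d}
    (h : rotGen Ω z = 0) (hj : action j z ≠ 0) : Ω j = 0 := by
  by_contra hΩ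
  have hy : Ω j * z.2 j = 0 := congrFun (congrArg Prod.fst h) j
  have hx : -(Ω j * z.1 j) = 0 := congrFun (congrArg Prod.snd h) j
  exact hj (action_eq_zero.2 ⟨(mul_eq_zero.1 (neg_eq_zero.1 hx)).resolve_left hΩ,
    (mul_eq_zero.1 hy).resolve_left hΩ⟩)

variable {k : ℕ} {c : Fin d → ℝ} {σ : Fin k → Fin d}

/-- The rotation angles of the torus parameter `θ ∈ ℝ^k / ℤ^k`, which acts on the planes indexed
by `σ`. The sign makes the parametrization of `actionTorus` counterclockwise. -/
def torusAngle (σ : Fin k → Fin d) : (Fin k → ℝ) →L[ℝ] (Fin d → ℝ) :=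
  (-(2 * Real.pi)) • (Function.ExtendByZero.linearMap ℝ σ).toContinuousLinearMap

theorem torusAngle_apply (hσ : Function.Injective σ) (θ : Fin k → ℝ) (l : Fin k) :
    torusAngle σ θ (σ l) = -(2 * Real.pi * θ l) := by
  simp only [torusAngle, smul_apply, LinearMap.coe_toContinuousLinearMap', Pi.smul_apply,
    smul_eq_mul, neg_mul]
  exact congrArg (fun x => -(2 * Real.pi * x)) (hσ.extend_apply θ 0 l)

/-- The parametrization of the torus `{r = c}`, where `σ` enumerates the nonzero actions. -/
def actionTorus (c : Fin d → ℝ) (σ : Fin k → Fin d) (θ : Fin k → ℝ) : Phase d :=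
  rotate (torusAngle σ θ) (fun j => √(2 * c j), 0)

theorem action_actionTorus (hc : 0 ≤ c) (θ : Fin k → ℝ) (j : Fin d) :
    action j (actionTorus c σ θ) = c j := by
  rw [actionTorus, action_rotate, action, Real.sq_sqrt (mul_nonneg zero_le_two (hc j))]
  simp

theorem actionTorus_add (θ v : Fin k → ℝ) :
    actionTorus c σ (θ + v) = rotate (torusAngle σ v) (actionTorus c σ θ) := by
  rw [actionTorus, actionTorus, rotate_rotate, map_add, add_comm]

theorem contDiff_actionTorus : ContDiff ℝ ∞ (actionTorus c σ) := by
  have hangle : ∀ j, ContDiff ℝ ∞ fun θ => torusAngle σ θ j :=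
    contDiff_pi.1 (torusAngle σ).contDiff
  exact (contDiff_pi.2 fun j =>
      (contDiff_const.mul (hangle j).cos).add (contDiff_const.mul (hangle j).sin)).prodMk
    (contDiff_pi.2 fun j =>
      (contDiff_const.mul (hangle j).cos).sub (contDiff_const.mul (hangle j).sin))

theorem actionTorus_fst (hσ : Function.Injective σ) (θ : Fin k → ℝ) (l : Fin k) :
    (actionTorus c σ θ).1 (σ l) = √(2 * c (σ l)) * Real.cos (2 * Real.pi * θ l) := by
  simp [actionTorus, rotate, torusAngle_apply hσ]

theorem actionTorus_snd (hσ : Function.Injective σ) (θ : Fin k → ℝ) (l : Fin k) :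
    (actionTorus c σ θ).2 (σ l) = √(2 * c (σ l)) * Real.sin (2 * Real.pi * θ l) := by
  simp [actionTorus, rotate, torusAngle_apply hσ]

theorem eq_actionTorus_iff (hc : 0 ≤ c) (hσ : Function.Injective σ)
    (hσc : ∀ j, c j ≠ 0 → j ∈ range σ) {z : Phase d} (hz : ∀ j, action j z = c j)
    (θ : Fin k → ℝ) :
    z = actionTorus c σ θ ↔ ∀ l, z.1 (σ l) = √(2 * c (σ l)) * Real.cos (2 * Real.pi * θ l) ∧
      z.2 (σ l) = √(2 * c (σ l)) * Real.sin (2 * Real.pi * θ l) := by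
  refine ⟨?_, fun h => ?_⟩
  · rintro rfl l
    exact ⟨actionTorus_fst hσ θ l, actionTorus_snd hσ θ l⟩
  · have hcoord : ∀ j, z.1 j = (actionTorus c σ θ).1 j ∧ z.2 j = (actionTorus c σ θ).2 j := by
      intro j
      by_cases hj : c j = 0
      · have hz0 := action_eq_zero.1 ((hz j).trans hj)
        have hθ0 := action_eq_zero.1 ((action_actionTorus (σ := σ) hc θ j).trans hj)
        exact ⟨hz0.1.trans hθ0.1.symm, hz0.2.trans hθ0.2.symm⟩
      · obtain ⟨l, rfl⟩ := hσc j hj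
        rw [actionTorus_fst hσ, actionTorus_snd hσ]
        exact h l
    ext j
    exacts [(hcoord j).1, (hcoord j).2]

theorem cos_sin_two_pi_mul_eq_iff {a b : ℝ} :
    (Real.cos (2 * Real.pi * a) = Real.cos (2 * Real.pi * b) ∧
      Real.sin (2 * Real.pi * a) = Real.sin (2 * Real.pi * b)) ↔ ∃ m : ℤ, b = a + m := by
  refine ⟨fun ⟨hcos, hsin⟩ => ?_, ?_⟩
  · obtain ⟨m, hm⟩ := Real.Angle.angle_eq_iff_two_pi_dvd_sub.1
      (Real.Angle.cos_sin_inj hcos hsin).symm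
    exact ⟨m, mul_left_cancel₀ Real.two_pi_pos.ne' (by linarith)⟩
  · rintro ⟨m, rfl⟩
    rw [mul_add, mul_comm _ (m : ℝ), Real.cos_add_int_mul_two_pi, Real.sin_add_int_mul_two_pi]
    exact ⟨rfl, rfl⟩

theorem actionTorus_eq_iff (hc : 0 ≤ c) (hσ : Function.Injective σ)
    (hσc : ∀ j, c j ≠ 0 ↔ j ∈ range σ) (θ θ' : Fin k → ℝ) :
    actionTorus c σ θ = actionTorus c σ θ' ↔ ∃ m : Fin k → ℤ, θ' = θ + fun j => (m j : ℝ) := by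
  have hne : ∀ l, √(2 * c (σ l)) ≠ 0 := fun l => by
    have hpos : 0 < c (σ l) := (hc _).lt_of_ne' ((hσc _).2 ⟨l, rfl⟩)
    positivity
  rw [eq_actionTorus_iff hc hσ (fun j => (hσc j).1) (action_actionTorus hc θ)]
  simp only [actionTorus_fst hσ, actionTorus_snd hσ, mul_right_inj' (hne _),
    cos_sin_two_pi_mul_eq_iff, Classical.skolem, funext_iff, Pi.add_apply]

theorem fderiv_actionTorus_apply (θ v : Fin k → ℝ) :
    fderiv ℝ (actionTorus c σ) θ v = rotGen (torusAngle σ v) (actionTorus c σ θ) := by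
  have hderiv : HasDerivAt (fun s : ℝ => actionTorus c σ (θ + s • v))
      (fderiv ℝ (actionTorus c σ) θ v) 0 :=
    (contDiff_actionTorus.differentiable (by simp) θ).hasFDerivAt.comp_hasDerivAt_of_eq 0
      (by simpa using ((hasDerivAt_id (0 : ℝ)).smul_const v).const_add θ) (by simp)
  simp only [actionTorus_add, map_smul] at hderiv
  simpa [rotate_zero] using hderiv.unique (hasDerivAt_rotate (torusAngle σ v) _ 0)

theorem isTorusEmbedding_actionTorus (hc : 0 ≤ c) (hσ : Function.Injective σ)
    (hσc : ∀ j, c j ≠ 0 ↔ j ∈ range σ) : IsTorusEmbedding ⊤ (actionTorus c σ) := by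
  refine ⟨contDiff_actionTorus, actionTorus_eq_iff hc hσ hσc, fun θ => ?_⟩
  refine (injective_iff_map_eq_zero _).2 fun v hv => funext fun l => ?_
  rw [fderiv_actionTorus_apply] at hv
  have hangle := eq_zero_of_rotGen_eq_zero hv (j := σ l)
    (by rw [action_actionTorus hc]; exact (hσc _).2 ⟨l, rfl⟩)
  simpa [torusAngle_apply hσ, Real.pi_ne_zero] using hangle

theorem range_actionTorus (hc : 0 ≤ c) (hσ : Function.Injective σ)
    (hσc : ∀ j, c j ≠ 0 → j ∈ range σ) : range (actionTorus c σ) = {z | ∀ j, action j z = c j} := by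
  refine Subset.antisymm (range_subset_iff.2 fun θ j => action_actionTorus hc θ j) fun z hz => ?_
  let ζ : Fin k → ℂ := fun l => ⟨z.1 (σ l), z.2 (σ l)⟩
  have hradius : ∀ l, √(2 * c (σ l)) = ‖ζ l‖ := fun l => by
    rw [← hz (σ l), Complex.norm_def, Complex.normSq_apply, action]
    congr 1
    simp only [ζ]
    ring
  refine ⟨fun l => (ζ l).arg / (2 * Real.pi),
    ((eq_actionTorus_iff hc hσ hσc hz _).2 fun l => ?_).symm⟩
  rw [hradius, mul_div_cancel₀ _ Real.two_pi_pos.ne', Complex.norm_mul_cos_arg,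
    Complex.norm_mul_sin_arg]
  exact ⟨rfl, rfl⟩

theorem isLinearFlowOn_actionTorus (hc : 0 ≤ c) (hσ : Function.Injective σ)
    (hσc : ∀ j, c j ≠ 0 → j ∈ range σ) {Φ : ℝ → Phase d → Phase d} {Ω : Fin d → ℝ}
    (hΩ : ∀ t z, (∀ j, action j z = c j) → Φ t z = rotate (t • Ω) z) :
    IsLinearFlowOn Φ (actionTorus c σ) fun l => -(Ω (σ l) / (2 * Real.pi)) := by
  intro t θ
  rw [hΩ t _ (action_actionTorus hc θ), actionTorus_add]
  refine rotate_congr fun j hj => ?_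
  rw [action_actionTorus hc] at hj
  obtain ⟨l, rfl⟩ := hσc j hj
  rw [torusAngle_apply hσ]
  simp only [Pi.smul_apply, smul_eq_mul]
  field_simp

theorem exists_linear_actionTorus {Φ : ℝ → Phase d → Phase d} {i : Fin d} {p : Phase d}
    (hp : action i p = 0) {Ω : Fin d → ℝ}
    (hΩ : ∀ t z, (∀ j, action j z = action j p) → Φ t z = rotate (t • Ω) z) :
    ∃ k ≤ d - 1, ∃ (ι : (Fin k → ℝ) → Phase d) (α : Fin k → ℝ),
      IsTorusEmbedding ⊤ ι ∧ IsLinearFlowOn Φ ι α ∧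
      range ι = {z | ∀ j, action j z = action j p} := by
  classical
  let s : Finset (Fin d) := {j | action j p ≠ 0}
  have hrange : ∀ j, action j p ≠ 0 ↔ j ∈ range (s.orderEmbOfFin rfl) := fun j => by
    simp [s, Finset.range_orderEmbOfFin]
  have hcard : s.card ≤ d - 1 := by
    have hi : s ⊆ Finset.univ.erase i := fun j hj =>
      Finset.mem_erase.2 ⟨by rintro rfl; simp [s, hp] at hj, Finset.mem_univ _⟩
    simpa using Finset.card_le_card hi
  have hσ : Function.Injective (s.orderEmbOfFin rfl) := (s.orderEmbOfFin rfl).injective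
  have hc : 0 ≤ fun j => action j p := fun j => action_nonneg j p
  exact ⟨s.card, hcard, actionTorus _ (s.orderEmbOfFin rfl), _,
    isTorusEmbedding_actionTorus hc hσ hrange,
    isLinearFlowOn_actionTorus hc hσ (fun j => (hrange j).1) hΩ,
    range_actionTorus hc hσ fun j => (hrange j).1⟩

end ActionTori

section InvariantFunctions

open UnitAddTorus MeasureTheory

variable {k : ℕ}

theorem mFourier_add_apply (m : Fin k → ℤ) (x y : UnitAddTorus (Fin k)) :
    mFourier m (x + y) = mFourier m x * mFourier m y := by
  simp only [mFourier, ContinuousMap.coe_mk, Pi.add_apply, fourier_apply, smul_add,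
    AddCircle.toCircle_add, Circle.coe_mul, Finset.prod_mul_distrib]

theorem mFourier_mul_mFourier_neg (m : Fin k → ℤ) (x : UnitAddTorus (Fin k)) :
    mFourier m x * mFourier (-m) x = 1 := by
  rw [← mFourier_add, add_neg_cancel, mFourier_zero, ContinuousMap.one_apply]

theorem mFourierCoeff_comp_add_right (f : UnitAddTorus (Fin k) → ℂ) (a : UnitAddTorus (Fin k))
    (m : Fin k → ℤ) :
    mFourierCoeff (fun x => f (x + a)) m = mFourier m a * mFourierCoeff f m := by
  rw [mFourierCoeff, mFourierCoeff]
  let _ : MeasureSpace UnitAddCircle := ⟨AddCircle.haarAddCircle⟩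
  have _ : Measure.IsAddHaarMeasure (volume : Measure UnitAddCircle) :=
    inferInstanceAs (Measure.IsAddHaarMeasure AddCircle.haarAddCircle)
  rw [← integral_const_mul]
  refine Eq.trans ?_ (integral_add_right_eq_self (μ := (volume : Measure (UnitAddTorus (Fin k))))
    (fun x => mFourier m a * (mFourier (-m) x • f x)) a)
  congr 1
  funext x
  rw [mFourier_add_apply, smul_eq_mul, smul_eq_mul]
  linear_combination (-(mFourier (-m) x * f (x + a))) * mFourier_mul_mFourier_neg m a

theorem mFourier_coe (m : Fin k → ℤ) (θ : Fin k → ℝ) :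
    mFourier m (fun j => (θ j : UnitAddCircle)) =
      Complex.exp (((2 * Real.pi * ∑ j, (m j : ℝ) * θ j : ℝ) : ℂ) * Complex.I) := by
  simp only [mFourier, ContinuousMap.coe_mk, fourier_coe_apply]
  rw [← Complex.exp_sum]
  congr 1
  push_cast
  rw [Finset.mul_sum, Finset.sum_mul]
  exact Finset.sum_congr rfl fun j _ => by simp; ring

/- Translating along the flow for half a period of the character `m` multiplies the coefficient by
`-1`. -/
theorem mFourierCoeff_eq_zero_of_invariant {α : Fin k → ℝ} {f : UnitAddTorus (Fin k) → ℂ}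
    (hf : ∀ (t : ℝ) x, f (x + fun j => ((t * α j : ℝ) : UnitAddCircle)) = f x) {m : Fin k → ℤ}
    (hm : ∑ j, (m j : ℝ) * α j ≠ 0) : mFourierCoeff f m = 0 := by
  set l := ∑ j, (m j : ℝ) * α j
  have hhalf : 2 * Real.pi * ∑ j, (m j : ℝ) * (1 / (2 * l) * α j) = Real.pi := by
    simp only [mul_left_comm _ (1 / (2 * l)), ← Finset.mul_sum]
    change 1 / (2 * l) * (2 * Real.pi * l) = Real.pi
    field_simp
  have hshift := mFourierCoeff_comp_add_right f
    (fun j => ((1 / (2 * l) * α j : ℝ) : UnitAddCircle)) m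
  rw [funext (hf (1 / (2 * l))), mFourier_coe, hhalf, Complex.exp_pi_mul_I] at hshift
  linear_combination (1 / 2) * hshift

theorem eq_mFourierCoeff_zero {F : C(UnitAddTorus (Fin k), ℂ)}
    (hF : ∀ m ≠ 0, mFourierCoeff F m = 0) (x : UnitAddTorus (Fin k)) :
    F x = mFourierCoeff F 0 := by
  have hsummable : Summable (mFourierCoeff F) := summable_of_ne_finset_zero (s := {0}) fun m hm =>
    hF m (by simpa using hm)
  have hsingle := hasSum_single (f := fun m => mFourierCoeff F m • mFourier m x) 0
    fun m hm => by simp [hF m hm]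
  rw [(hasSum_mFourier_series_apply_of_summable hsummable x).unique hsingle, mFourier_zero,
    ContinuousMap.one_apply, smul_eq_mul, mul_one]

theorem exists_continuousMap_torus {E : Type*} [TopologicalSpace E] {f : (Fin k → ℝ) → E}
    (hf : Continuous f) (hper : ∀ θ (m : Fin k → ℤ), f (θ + fun j => (m j : ℝ)) = f θ) :
    ∃ F : C(UnitAddTorus (Fin k), E), ∀ θ, F (fun j => (θ j : UnitAddCircle)) = f θ := by
  let π : C(Fin k → ℝ, UnitAddTorus (Fin k)) :=
    ⟨fun θ j => (θ j : UnitAddCircle), by fun_prop⟩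
  have hπ : Topology.IsQuotientMap π := (IsOpenQuotientMap.piMap fun _ =>
    QuotientAddGroup.isOpenQuotientMap_mk).isQuotientMap
  have hfiber : Function.FactorsThrough f π := fun θ θ' h => by
    have hinteger : ∀ j, ∃ m : ℤ, θ j = θ' j + m := fun j => by
      obtain ⟨m, hm⟩ := AddCircle.coe_eq_zero_iff (1 : ℝ) (x := θ j - θ' j) |>.1
        (by rw [AddCircle.coe_sub, sub_eq_zero]; exact congrFun h j)
      exact ⟨m, by rw [zsmul_one] at hm; linarith⟩
    choose m hm using hinteger
    rw [show θ = θ' + fun j => (m j : ℝ) from funext hm, hper]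
  exact ⟨hπ.lift ⟨f, hf⟩ hfiber, fun θ => congrArg (· θ) (hπ.lift_comp ⟨f, hf⟩ hfiber)⟩

theorem eq_of_nonresonant_periodic {α : Fin k → ℝ} (hα : IsNonresonant α) {f : (Fin k → ℝ) → ℝ}
    (hf : Continuous f) (hper : ∀ θ (m : Fin k → ℤ), f (θ + fun j => (m j : ℝ)) = f θ)
    (hinv : ∀ (t : ℝ) θ, f (θ + t • α) = f θ) (θ θ' : Fin k → ℝ) : f θ = f θ' := by
  obtain ⟨F, hF⟩ := exists_continuousMap_torus (f := fun θ => (f θ : ℂ))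
    (Complex.continuous_ofReal.comp hf) fun θ m => by rw [hper]
  have hFinv : ∀ (t : ℝ) x, F (x + fun j => ((t * α j : ℝ) : UnitAddCircle)) = F x := by
    intro t x
    choose θ hθ using fun j => QuotientAddGroup.mk_surjective (x j)
    obtain rfl : (fun j => (θ j : UnitAddCircle)) = x := funext hθ
    rw [hF, ← hinv t θ, ← hF]
    rfl
  have hconst := eq_mFourierCoeff_zero fun m hm =>
    mFourierCoeff_eq_zero_of_invariant hFinv (hα m hm)
  exact Complex.ofReal_injective (by rw [← hF, ← hF, hconst, hconst])

end InvariantFunctions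

section Obstructions

open Set Filter

variable {d k : ℕ}

/-- The linear map `(u, v) ↦ D u + J (D v)`, where `J = rotGen 1` is the standard complex
structure up to sign. It is bijective when `D` parametrizes a Lagrangian subspace. -/
def complexify (D : (Fin k → ℝ) →L[ℝ] Phase d) :
    (Fin k → ℝ) × (Fin k → ℝ) →ₗ[ℝ] Phase d where
  toFun p := D p.1 + rotGen 1 (D p.2)
  map_add' p p' := by ext j <;> simp [rotGen] <;> ring
  map_smul' a p := by ext j <;> simp [rotGen]

theorem eq_zero_of_sympForm_rotGen_self_eq_zero {z : Phase d}
    (h : sympForm (rotGen 1 z) z = 0) : z = 0 := by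
  have hsq : ∑ j, (z.1 j * z.1 j + z.2 j * z.2 j) = 0 := by
    simpa [sympForm_rotGen, actionDeriv] using h
  have hcoord : ∀ j, z.1 j = 0 ∧ z.2 j = 0 := fun j => mul_self_add_mul_self_eq_zero.1
    ((Finset.sum_eq_zero_iff_of_nonneg fun j _ =>
      add_nonneg (mul_self_nonneg _) (mul_self_nonneg _)).1 hsq j (Finset.mem_univ j))
  ext j
  exacts [(hcoord j).1, (hcoord j).2]

theorem injective_complexify {D : (Fin k → ℝ) →L[ℝ] Phase d} (hD : Function.Injective D)
    (hiso : ∀ u v, sympForm (D u) (D v) = 0) : Function.Injective (complexify D) := by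
  refine (injective_iff_map_eq_zero _).2 fun ⟨u, v⟩ huv => ?_
  have hDu : D u = -rotGen 1 (D v) := eq_neg_of_add_eq_zero_left huv
  have hDv : D v = 0 := eq_zero_of_sympForm_rotGen_self_eq_zero (by
    have huv0 := hiso u v
    rwa [hDu, ← sympCLM_apply, map_neg, neg_apply, neg_eq_zero, sympCLM_apply] at huv0)
  have hrot : rotGen 1 (0 : Phase d) = 0 := by ext j <;> simp [rotGen]
  rw [hDv, hrot, neg_zero] at hDu
  exact Prod.ext ((map_eq_zero_iff D hD).1 hDu) ((map_eq_zero_iff D hD).1 hDv)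

theorem exists_apply_ne_zero_of_isotropic {D : (Fin d → ℝ) →L[ℝ] Phase d}
    (hD : Function.Injective D) (hiso : ∀ u v, sympForm (D u) (D v) = 0) (i : Fin d) :
    ∃ u, action i (D u) ≠ 0 := by
  by_contra! hzero
  obtain ⟨⟨u, v⟩, huv⟩ :=
    LinearMap.injective_iff_surjective.1 (injective_complexify hD hiso) (Pi.single i 1, 0)
  have hone : (D u).1 i + 1 * (D v).2 i = 1 :=
    (congrFun (congrArg Prod.fst huv) i).trans (Pi.single_eq_same i 1)
  rw [(action_eq_zero.1 (hzero u)).1, (action_eq_zero.1 (hzero v)).2] at hone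
  norm_num at hone

section Derivatives

variable {ι : (Fin k → ℝ) → Phase d} {D : (Fin k → ℝ) →L[ℝ] Phase d} {θ : Fin k → ℝ} {j : Fin d}

theorem action_apply_eq_zero_of_hasFDerivAt (hD : HasFDerivAt ι D θ)
    (h : ∀ᶠ x in 𝓝 θ, action j (ι x) = 0) (u : Fin k → ℝ) : action j (D u) = 0 := by
  have hx : HasFDerivAt (fun x => (ι x).1 j) ((coordX j).comp D) θ :=
    (coordX j).hasFDerivAt.comp θ hD
  have hy : HasFDerivAt (fun x => (ι x).2 j) ((coordY j).comp D) θ :=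
    (coordY j).hasFDerivAt.comp θ hD
  have hx0 : HasFDerivAt (fun x => (ι x).1 j) (0 : (Fin k → ℝ) →L[ℝ] ℝ) θ :=
    (hasFDerivAt_const 0 θ).congr_of_eventuallyEq (h.mono fun x hx => (action_eq_zero.1 hx).1)
  have hy0 : HasFDerivAt (fun x => (ι x).2 j) (0 : (Fin k → ℝ) →L[ℝ] ℝ) θ :=
    (hasFDerivAt_const 0 θ).congr_of_eventuallyEq (h.mono fun x hx => (action_eq_zero.1 hx).2)
  exact action_eq_zero.2
    ⟨DFunLike.congr_fun (hx.unique hx0) u, DFunLike.congr_fun (hy.unique hy0) u⟩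

theorem actionDeriv_apply_eq_zero_of_hasFDerivAt (hD : HasFDerivAt ι D θ)
    (h : ∀ᶠ x in 𝓝 θ, action j (ι x) = action j (ι θ)) (u : Fin k → ℝ) :
    actionDeriv j (ι θ) (D u) = 0 :=
  DFunLike.congr_fun (((hasFDerivAt_action j (ι θ)).comp θ hD).unique
    ((hasFDerivAt_const (action j (ι θ)) θ).congr_of_eventuallyEq h)) u

end Derivatives

/- In the plane `(x_j, y_j)` both tangent vectors are orthogonal to the position vector, or all
three vanish. -/
theorem isIsotropic_of_action_const {ι : (Fin k → ℝ) → Phase d} (hι : Differentiable ℝ ι)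
    (hconst : ∀ j θ θ', action j (ι θ) = action j (ι θ')) : IsIsotropic ι := by
  refine fun θ u v => Finset.sum_eq_zero fun j _ => ?_
  have hD := (hι θ).hasFDerivAt
  by_cases hj : action j (ι θ) = 0
  · have hu := action_eq_zero.1 (action_apply_eq_zero_of_hasFDerivAt hD
      (Eventually.of_forall fun x => (hconst j x θ).trans hj) u)
    rw [hu.1, hu.2, zero_mul, zero_mul, sub_zero]
  · have horth := actionDeriv_apply_eq_zero_of_hasFDerivAt hD
      (Eventually.of_forall fun x => hconst j x θ)
    simp only [actionDeriv, add_apply, smul_apply, coordX_apply, coordY_apply,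
      smul_eq_mul] at horth
    set a := fderiv ℝ ι θ u
    set b := fderiv ℝ ι θ v
    refine (mul_eq_zero.1 ?_).resolve_left hj
    rw [action]
    linear_combination
      (((ι θ).1 j * b.2 j - (ι θ).2 j * b.1 j) / 2) * horth u +
        (((ι θ).2 j * a.1 j - (ι θ).1 j * a.2 j) / 2) * horth v

theorem not_isIsotropic_of_action_eq_zero {ι : (Fin d → ℝ) → Phase d} (hι : IsTorusEmbedding 1 ι)
    (hzero : ∀ θ, ∃ i, action i (ι θ) = 0) : ¬ IsIsotropic ι := by
  intro hiso
  have hdiff : Differentiable ℝ ι := hι.1.differentiable (by simp)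
  obtain ⟨i, θ, hθ⟩ := nonempty_interior_of_iUnion_of_closed
    (f := fun i => {θ | action i (ι θ) = 0})
    (fun i => isClosed_eq ((continuous_action i).comp hdiff.continuous) continuous_const)
    (iUnion_eq_univ_iff.2 hzero)
  obtain ⟨u, hu⟩ := exists_apply_ne_zero_of_isotropic (hι.2.2 θ) (hiso θ) i
  exact hu (action_apply_eq_zero_of_hasFDerivAt (hdiff θ).hasFDerivAt
    (mem_interior_iff_mem_nhds.1 hθ) u)

theorem exists_add_int_mem_Icc (θ : Fin k → ℝ) :
    ∃ m : Fin k → ℤ, (θ + fun j => (m j : ℝ)) ∈ Icc (0 : Fin k → ℝ) 1 := by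
  have hfract : (θ + fun j => ((-⌊θ j⌋ : ℤ) : ℝ)) = fun j => Int.fract (θ j) :=
    funext fun j => by
      rw [Pi.add_apply, Int.cast_neg, ← sub_eq_add_neg, Int.self_sub_floor]
  refine ⟨fun j => -⌊θ j⌋, ?_⟩
  rw [hfract]
  exact ⟨fun j => Int.fract_nonneg _, fun j => (Int.fract_lt_one _).le⟩

theorem isCompact_range_of_periodic {X : Type*} [TopologicalSpace X] {ι : (Fin k → ℝ) → X}
    (hι : Continuous ι) (hper : ∀ θ (m : Fin k → ℤ), ι (θ + fun j => (m j : ℝ)) = ι θ) :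
    IsCompact (range ι) := by
  suffices range ι = ι '' Icc 0 1 from this ▸ isCompact_Icc.image hι
  refine Subset.antisymm (range_subset_iff.2 fun θ => ?_) (image_subset_range _ _)
  obtain ⟨m, hm⟩ := exists_add_int_mem_Icc θ
  exact ⟨_, hm, hper θ m⟩

/-- The alternative satisfied by the orbits off the sets `{r_i = 0}`: along times tending to
infinity, the curve has a limit point in one of these sets or a subsequence that diverges. -/
def AccumulatesOnAxesOrAtInfinity (γ : ℝ → Phase d) : Prop :=
  (∃ i, AccumulatesOn γ {z | action i z = 0}) ∨ AccumulatesAtInfinity γ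

theorem AccumulatesOnAxesOrAtInfinity.exists_accumulatesOn {γ : ℝ → Phase d}
    (h : AccumulatesOnAxesOrAtInfinity γ) {K : Set (Phase d)} (hK : IsCompact K)
    (hγ : ∀ t, γ t ∈ K) : ∃ i, AccumulatesOn γ {z | action i z = 0} := by
  refine h.resolve_right ?_
  rintro ⟨t, -, ht⟩
  obtain ⟨R, hR⟩ := hK.isBounded.exists_norm_le
  obtain ⟨n, hn⟩ := (ht.eventually_gt_atTop R).exists
  exact (hR _ (hγ (t n))).not_gt hn

/- Translations of a torus are isometries, so the linear flow run backwards undoes the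
convergence. -/
theorem IsLinearFlowOn.exists_tendsto_neg {Φ : ℝ → Phase d → Phase d} {ι : (Fin k → ℝ) → Phase d}
    {α : Fin k → ℝ} (hlin : IsLinearFlowOn Φ ι α) (hι : Continuous ι)
    (hper : ∀ θ (m : Fin k → ℤ), ι (θ + fun j => (m j : ℝ)) = ι θ) {θ : Fin k → ℝ} {p : Phase d}
    {t : ℕ → ℝ} (ht : Tendsto (fun n => Φ (t n) (ι θ)) atTop (𝓝 p)) :
    ∃ s : ℕ → ℝ, Tendsto (fun n => Φ (s n) p) atTop (𝓝 (ι θ)) := by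
  choose m hm using fun n => exists_add_int_mem_Icc (θ + t n • α)
  obtain ⟨θ', -, φ, hφ, hlim⟩ := isCompact_Icc.tendsto_subseq hm
  obtain rfl : ι θ' = p := by
    refine tendsto_nhds_unique ((hι.tendsto θ').comp hlim)
      ((ht.comp hφ.tendsto_atTop).congr fun n => ?_)
    simp only [Function.comp_apply, hper]
    exact hlin _ _
  refine ⟨fun n => -t (φ n), ?_⟩
  have hback : Tendsto (fun n => θ' + (θ - (θ + t (φ n) • α + fun j => (m (φ n) j : ℝ)))) atTop
      (𝓝 θ) := by
    simpa using (tendsto_const_nhds (x := θ')).add ((tendsto_const_nhds (x := θ)).sub hlim)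
  refine ((hι.tendsto θ).comp hback).congr fun n => ?_
  rw [hlin, ← hper _ (fun j => -m (φ n) j), Function.comp_apply]
  congr 1
  funext j
  simp
  ring

section Flow

variable {Φ : ℝ → Phase d → Phase d}

theorem exists_action_eq_zero_of_isLinearFlowOn
    (hinv : ∀ i p, action i p = 0 → ∀ t j, action j (Φ t p) = action j p)
    (hacc : ∀ p, (∀ i, action i p ≠ 0) → AccumulatesOnAxesOrAtInfinity fun t => Φ t p)
    {ι : (Fin k → ℝ) → Phase d} {α : Fin k → ℝ} (hι : Continuous ι)
    (hper : ∀ θ (m : Fin k → ℤ), ι (θ + fun j => (m j : ℝ)) = ι θ) (hlin : IsLinearFlowOn Φ ι α)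
    (θ : Fin k → ℝ) : ∃ i, action i (ι θ) = 0 := by
  by_contra! hne
  obtain ⟨i, p, hp, t, -, ht⟩ := (hacc _ hne).exists_accumulatesOn
    (isCompact_range_of_periodic hι hper) fun t => ⟨θ + t • α, (hlin t θ).symm⟩
  obtain ⟨s, hs⟩ := hlin.exists_tendsto_neg hι hper ht
  refine hne i (tendsto_nhds_unique (((continuous_action i).tendsto _).comp hs)
    (tendsto_const_nhds.congr fun n => ?_))
  exact ((hinv i p hp (s n) i).trans hp).symm

theorem not_isIsotropic_and_not_isNonresonant
    (hinv : ∀ i p, action i p = 0 → ∀ t j, action j (Φ t p) = action j p)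
    (hacc : ∀ p, (∀ i, action i p ≠ 0) → AccumulatesOnAxesOrAtInfinity fun t => Φ t p)
    {ι : (Fin d → ℝ) → Phase d} {α : Fin d → ℝ} (hι : IsTorusEmbedding 1 ι)
    (hlin : IsLinearFlowOn Φ ι α) : ¬ IsIsotropic ι ∧ ¬ IsNonresonant α := by
  have hcont : Continuous ι := hι.1.continuous
  have hper : ∀ θ (m : Fin d → ℤ), ι (θ + fun j => (m j : ℝ)) = ι θ := fun θ m =>
    ((hι.2.1 θ _).2 ⟨m, rfl⟩).symm
  have hzero := exists_action_eq_zero_of_isLinearFlowOn hinv hacc hcont hper hlin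
  have hiso : ¬ IsIsotropic ι := not_isIsotropic_of_action_eq_zero hι hzero
  refine ⟨hiso, fun hα => hiso ?_⟩
  have hactinv : ∀ j (t : ℝ) θ, action j (ι (θ + t • α)) = action j (ι θ) := fun j t θ => by
    obtain ⟨l, hl⟩ := hzero θ
    rw [← hlin, hinv l _ hl]
  exact isIsotropic_of_action_const (hι.1.differentiable (by simp)) fun j =>
    eq_of_nonresonant_periodic hα ((continuous_action j).comp hcont)
      (fun θ m => congrArg (action j) (hper θ m)) (hactinv j)

theorem exists_action_eq_zero_of_isCompact
    (hacc : ∀ p, (∀ i, action i p ≠ 0) → AccumulatesOnAxesOrAtInfinity fun t => Φ t p)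
    {K : Set (Phase d)} (hK : IsCompact K) (hne : K.Nonempty) (hinv : ∀ t, MapsTo (Φ t) K K) :
    ∃ p ∈ K, ∃ i, action i p = 0 := by
  obtain ⟨p, hp⟩ := hne
  by_contra! h
  have hmem : ∀ t, Φ t p ∈ K := fun t => hinv t hp
  obtain ⟨i, z, hz, t, -, ht⟩ := (hacc p (h p hp)).exists_accumulatesOn hK hmem
  exact h z (hK.isClosed.mem_of_tendsto ht (Eventually.of_forall fun n => hmem _)) i hz

end Flow

end Obstructions

section Conclusion

open Set Filter

variable {d : ℕ}

theorem tendsto_hamVectorField {H : ℕ → Phase d → ℝ} {K : Phase d → ℝ}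
    (hHK : ∀ (N : ℕ) (z : Phase d), 1 ≤ N → ‖z‖ ≤ N →
      ‖fderiv ℝ (H N) z - fderiv ℝ K z‖ ≤ 2 * (1 / 2) ^ N) (p : Phase d) :
    Tendsto (fun n => hamVectorField (H n) p) atTop (𝓝 (hamVectorField K p)) := by
  refine tendsto_iff_norm_sub_tendsto_zero.2 (squeeze_zero'
    (Eventually.of_forall fun _ => norm_nonneg _) ?_ tendsto_two_mul_half_pow)
  filter_upwards [eventually_ge_atTop 1,
    tendsto_natCast_atTop_atTop.eventually_ge_atTop ‖p‖] with n hn hp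
  exact (norm_hamVectorField_sub_le _ _ _).trans (hHK n p hn hp)

theorem exists_tendsto_of_tendsto_rotGen {Ω : ℕ → Fin d → ℝ} {p X : Phase d}
    (h : Tendsto (fun n => rotGen (Ω n) p) atTop (𝓝 X)) :
    ∃ Ω' : Fin d → ℝ, ∀ j, action j p ≠ 0 → Tendsto (fun n => Ω n j) atTop (𝓝 (Ω' j)) := by
  refine ⟨fun j => (p.2 j * X.1 j - p.1 j * X.2 j) / (2 * action j p), fun j hj => ?_⟩
  have hx := ((coordX j).continuous.tendsto X).comp h
  have hy := ((coordY j).continuous.tendsto X).comp h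
  refine (((hx.const_mul (p.2 j)).sub (hy.const_mul (p.1 j))).div_const _).congr fun n => ?_
  rw [div_eq_iff (mul_ne_zero two_ne_zero hj)]
  simp only [Function.comp_apply, coordX_apply, coordY_apply, rotGen, action]
  ring

theorem tendsto_rotate {Ω : ℕ → Fin d → ℝ} {Ω' : Fin d → ℝ} {z : Phase d}
    (h : ∀ j, action j z ≠ 0 → Tendsto (fun n => Ω n j) atTop (𝓝 (Ω' j))) :
    Tendsto (fun n => rotate (Ω n) z) atTop (𝓝 (rotate Ω' z)) := by
  let Ω₁ : ℕ → Fin d → ℝ := fun n j => if action j z = 0 then Ω' j else Ω n j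
  have hΩ₁ : Tendsto Ω₁ atTop (𝓝 Ω') := by
    refine tendsto_pi_nhds.2 fun j => ?_
    by_cases hj : action j z = 0
    · simp only [Ω₁, if_pos hj, tendsto_const_nhds]
    · simpa only [Ω₁, if_neg hj] using h j hj
  refine (((continuous_rotate continuous_id continuous_const).tendsto Ω').comp hΩ₁).congr fun n =>
    rotate_congr fun j hj => ?_
  simp only [id_eq, Ω₁, if_neg hj]

theorem eventually_mem_compactCore {α : Type*} {l : Filter α} {n : α → ℕ} {y : α → Phase d}
    {a : Phase d} (ha : ∀ i, action i a ≠ 0) (hn : Tendsto n l atTop) (hy : Tendsto y l (𝓝 a)) :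
    ∀ᶠ x in l, y x ∈ compactCore d (n x) := by
  have hnorm : ∀ᶠ x in l, ‖y x‖ < ‖a‖ + 1 := hy.norm.eventually_lt_const (lt_add_one _)
  have hlarge : ∀ᶠ x in l, ‖a‖ + 1 ≤ n x :=
    (tendsto_natCast_atTop_atTop.comp hn).eventually_ge_atTop _
  have haction : ∀ᶠ x in l, ∀ i, 1 / ((n x : ℝ) + 1) < action i (y x) :=
    eventually_all.2 fun i => (tendsto_one_div_add_atTop_nhds_zero_nat.comp hn).eventually_lt
      (((continuous_action i).tendsto a).comp hy) ((action_nonneg i a).lt_of_ne' (ha i))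
  filter_upwards [hnorm, hlarge, haction] with x hx hnx hax
  exact ⟨hx.le.trans hnx, fun i => (hax i).le⟩

theorem accumulatesOnAxesOrAtInfinity_of_escape {γ : ℝ → Phase d}
    (h : ∀ N : ℕ, ∃ n ≥ N, ∃ (t : ℝ) (y : Phase d), n ≤ t ∧ y ∉ compactCore d n ∧
      ‖y - γ t‖ ≤ (1 / 2) ^ n) :
    AccumulatesOnAxesOrAtInfinity γ := by
  choose n hn t y ht hy hyt using h
  have hnlim : Tendsto n atTop atTop := tendsto_atTop_mono hn tendsto_id
  have htlim : Tendsto (fun N => |t N|) atTop atTop :=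
    tendsto_atTop_mono (fun N => (ht N).trans (le_abs_self _))
      (tendsto_natCast_atTop_atTop.comp hnlim)
  have hsub : Tendsto (fun N => y N - γ (t N)) atTop (𝓝 0) :=
    squeeze_zero_norm hyt
      ((tendsto_pow_atTop_nhds_zero_of_lt_one (by norm_num) (by norm_num)).comp hnlim)
  by_cases hinf : Tendsto (fun N => ‖γ (t N)‖) atTop atTop
  · exact Or.inr ⟨t, htlim, hinf⟩
  obtain ⟨R, hR⟩ : ∃ R, ∃ᶠ N in atTop, ‖γ (t N)‖ < R := by
    simpa only [tendsto_atTop, not_forall, not_eventually, not_le] using hinf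
  obtain ⟨a, -, φ, hφ, hlim⟩ := (isCompact_closedBall (0 : Phase d) R).tendsto_subseq'
    (x := fun N => γ (t N)) (hR.mono fun N hN => by simpa using hN.le)
  have hylim : Tendsto (y ∘ φ) atTop (𝓝 a) := by
    simpa [Function.comp_def] using (hsub.comp hφ.tendsto_atTop).add hlim
  obtain ⟨i, hi⟩ : ∃ i, action i a = 0 := by
    by_contra! hne
    obtain ⟨N, hN⟩ :=
      (eventually_mem_compactCore hne (hnlim.comp hφ.tendsto_atTop) hylim).exists
    exact hy (φ N) hN
  exact Or.inl ⟨i, a, hi, t ∘ φ, htlim.comp hφ.tendsto_atTop, hlim⟩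

theorem exists_ne_of_opposite_signs (hd : 3 ≤ d) (ω₀ : Fin d → ℝ) :
    ∃ q : Fin d, (∃ i j, ω₀ i < 0 ∧ 0 < ω₀ j) →
      ∃ i j, i ≠ q ∧ j ≠ q ∧ ω₀ i < 0 ∧ 0 < ω₀ j := by
  by_cases h : ∃ i j, ω₀ i < 0 ∧ 0 < ω₀ j
  · obtain ⟨i, j, hi, hj⟩ := h
    obtain ⟨q, hq⟩ : ∃ q, q ∉ ({i, j} : Finset (Fin d)) := by
      by_contra! hall
      have hcard := (Finset.card_le_card fun q _ => hall q : Finset.univ.card ≤ _).trans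
        Finset.card_le_two
      rw [Finset.card_fin] at hcard
      omega
    rw [Finset.mem_insert, Finset.mem_singleton, not_or] at hq
    exact ⟨q, fun _ => ⟨i, j, Ne.symm hq.1, Ne.symm hq.2, hi, hj⟩⟩
  · exact ⟨⟨0, by omega⟩, fun h' => absurd h' h⟩

namespace Stage

variable {q : Fin d} {ω₀ : Fin d → ℝ} {S : ℕ → Stage q ω₀} {Φ : ℝ → Phase d → Phase d} {T : ℕ → ℝ}

theorem flow_of_action_eq_zero (S : Stage q ω₀) {z : Phase d} {i : Fin d} (h : action i z = 0)
    (t : ℝ) : S.flow t z = rotate (t • freq q S.w z) z := by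
  rw [flow, S.symm_of_action_eq_zero h, S.e_of_action_eq_zero _ i (by rw [action_freqFlow, h]),
    freqFlow]

theorem hamVectorField_of_action_eq_zero (S : Stage q ω₀) {z : Phase d} {i : Fin d}
    (h : action i z = 0) : hamVectorField S.ham z = rotGen (freq q S.w z) z := by
  have hderiv := (S.isHamFlow z).2 0
  simp only [S.flow_of_action_eq_zero h] at hderiv
  simpa only [zero_smul, rotate_zero] using hderiv.unique (hasDerivAt_rotate _ z 0)

theorem exists_limit_rotation {K : Phase d → ℝ} {i : Fin d} {p : Phase d}
    (hK : Tendsto (fun n => hamVectorField (S n).ham p) atTop (𝓝 (hamVectorField K p)))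
    (hΦ : ∀ t z, Tendsto (fun n => (S n).flow t z) atTop (𝓝 (Φ t z))) (hp : action i p = 0) :
    ∃ Ω : Fin d → ℝ, ∀ t z, (∀ j, action j z = action j p) → Φ t z = rotate (t • Ω) z := by
  simp only [(S _).hamVectorField_of_action_eq_zero hp] at hK
  obtain ⟨Ω, hΩ⟩ := exists_tendsto_of_tendsto_rotGen hK
  refine ⟨Ω, fun t z hz => tendsto_nhds_unique (hΦ t z) ?_⟩
  have hfreq (n : ℕ) : freq q (S n).w z = freq q (S n).w p := by
    funext l
    simp only [freq, hz]
  simp only [(S _).flow_of_action_eq_zero ((hz i).trans hp), hfreq]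
  exact tendsto_rotate fun j hj => (hΩ j (hz j ▸ hj)).const_mul t

theorem accumulatesOnAxesOrAtInfinity
    (hesc : ∀ n, Odd n → EscapesCore q (zoneIndex (n / 2)) n (T (n + 1)) (S (n + 1)).flow)
    (hnear : ∀ n t z, |t| ≤ T n → ‖z‖ ≤ n → ‖(S n).flow t z - Φ t z‖ ≤ 2 * (1 / 2) ^ n)
    {p : Phase d} (hp : ∀ i, action i p ≠ 0) : AccumulatesOnAxesOrAtInfinity fun t => Φ t p := by
  refine accumulatesOnAxesOrAtInfinity_of_escape fun N => ?_
  obtain ⟨j, hj⟩ := exists_mem_zoneCore ((action_nonneg q p).lt_of_ne' (hp q))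
  obtain ⟨N', hN'⟩ :=
    eventually_atTop.1 (eventually_mem_compactCore hp tendsto_id tendsto_const_nhds)
  obtain ⟨m, hm, rfl⟩ := exists_zoneIndex_eq j (max N N')
  rw [ge_iff_le, max_le_iff] at hm
  have hcore : p ∈ compactCore d (2 * m + 1) := hN' _ (by omega)
  obtain ⟨t, ⟨hnt, htT⟩, hnot⟩ := hesc (2 * m + 1) ⟨m, rfl⟩ p hcore
    (by rwa [show (2 * m + 1) / 2 = m by omega])
  refine ⟨2 * m + 1, by omega, t, _, hnt, hnot, (hnear _ t p ?_ ?_).trans_eq ?_⟩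
  · rwa [abs_of_nonneg ((Nat.cast_nonneg _).trans hnt)]
  · exact hcore.1.trans (by exact_mod_cast Nat.le_succ _)
  · ring

theorem isDiffusive
    (hdiff : ∀ n, Even n → DiffusesAtScale n (T (n + 1)) (S (n + 1)).flow)
    (hnear : ∀ n t z, |t| ≤ T n → ‖z‖ ≤ n → ‖(S n).flow t z - Φ t z‖ ≤ 2 * (1 / 2) ^ n)
    (hΦ : ∀ z, Φ 0 z = z) : IsDiffusive Φ := by
  intro A hA
  obtain ⟨m, hm⟩ := exists_nat_ge (A + 1)
  obtain ⟨p, t, hp, ht, hpt⟩ := hdiff (m + m) ⟨m, rfl⟩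
  push_cast at hp hpt
  have hsmall : ‖p‖ ≤ A⁻¹ :=
    hp.trans (by rw [← one_div]; exact one_div_le_one_div_of_le hA (by linarith))
  have hball : ‖p‖ ≤ 1 := hp.trans (div_le_one_of_le₀ (by linarith) (by positivity))
  have hclose : ‖(S (m + m + 1)).flow t p - Φ t p‖ ≤ 1 :=
    calc _ ≤ 2 * (1 / 2 : ℝ) ^ (m + m + 1) := hnear _ t p ht (by push_cast; linarith)
      _ = (1 / 2) ^ (m + m) := by ring
      _ ≤ 1 := pow_le_one₀ (by norm_num) (by norm_num)
  refine ⟨p, 0, t, by rwa [hΦ], ?_⟩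
  linarith [norm_sub_norm_le ((S (m + m + 1)).flow t p) (Φ t p)]

end Stage

end Conclusion

end

theorem theoremA (d : ℕ) (hd : 4 ≤ d) (ω₀ : Fin d → ℝ) :
    ∃ (H : Phase d → ℝ) (Φ : ℝ → Phase d → Phase d),
      -- `H` is smooth, of the form `⟨ω₀, r⟩ + O³`, with (complete) Hamiltonian flow `Φ`
      ContDiff ℝ ∞ H ∧
      (fun z => H z - quadPart ω₀ z) =O[𝓝 0] (fun z => ‖z‖ ^ 3) ∧
      IsHamFlow H Φ ∧
      -- no invariant torus of dimension `d`: none with linear flow that is Lagrangian or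
      -- whose frequency vector is nonresonant ...
      (∀ (ι : (Fin d → ℝ) → Phase d) (α : Fin d → ℝ),
        IsTorusEmbedding 1 ι → IsLinearFlowOn Φ ι α → ¬ IsIsotropic ι ∧ ¬ IsNonresonant α) ∧
      -- ... and none at all, whatever the dynamics on it, off the sets `{r_i = 0}`
      (∀ T : Set (Phase d), Nonempty (T ≃ₜ (Fin d → UnitAddCircle)) →
        (∀ t, Φ t '' T = T) → ∃ p ∈ T, ∃ i, action i p = 0) ∧
      -- each set `{r_i = 0}` is foliated by the sets `{r = c}` with `c_i = 0`, which are smooth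
      -- invariant tori of dimension at most `d - 1` with linear flow
      (∀ (i : Fin d) (p : Phase d), action i p = 0 →
        ∃ k ≤ d - 1, ∃ (ι : (Fin k → ℝ) → Phase d) (α : Fin k → ℝ),
          IsTorusEmbedding ⊤ ι ∧ IsLinearFlowOn Φ ι α ∧
          Set.range ι = {q | ∀ j, action j q = action j p}) ∧
      -- all other orbits accumulate on these sets or at infinity
      (∀ p : Phase d, (∀ i, action i p ≠ 0) →
        (∃ i, AccumulatesOn (fun t => Φ t p) {q | action i q = 0}) ∨
        AccumulatesAtInfinity (fun t => Φ t p)) ∧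
      -- diffusion when two coordinates of `ω₀` have opposite signs
      ((∃ i j, ω₀ i < 0 ∧ 0 < ω₀ j) → IsDiffusive Φ) := by
  obtain ⟨q, hq⟩ := exists_ne_of_opposite_signs (by omega : 3 ≤ d) ω₀
  obtain ⟨S, T, hS0, hT, hT', hclose, hesc, hdiff⟩ := Stage.exists_stages hd hq
  obtain ⟨H, hH, hO, hHf⟩ := exists_smooth_limit (H := fun n => (S n).ham) (S 0).contDiff_ham
    fun n => (hclose n).smallOn
  rw [hS0] at hO
  obtain ⟨Φ, hΦ, hlim, hnear⟩ := exists_isHamFlow_limit (hH.of_le (by simp)) hHf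
    (fun n => (S n).isHamFlow) hT hT' fun n => (hclose n).norm_flow_sub_le
  have hrot : ∀ (i : Fin d) (p : Phase d), action i p = 0 → ∃ Ω : Fin d → ℝ, ∀ t z,
      (∀ j, action j z = action j p) → Φ t z = rotate (t • Ω) z := fun i p hp =>
    Stage.exists_limit_rotation (tendsto_hamVectorField hHf p) hlim hp
  have hinv : ∀ i p, action i p = 0 → ∀ t j, action j (Φ t p) = action j p := by
    intro i p hp t j
    obtain ⟨Ω, hΩ⟩ := hrot i p hp
    rw [hΩ t p fun _ => rfl, action_rotate]
  have hacc : ∀ p, (∀ i, action i p ≠ 0) → AccumulatesOnAxesOrAtInfinity fun t => Φ t p :=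
    fun p => Stage.accumulatesOnAxesOrAtInfinity hesc hnear
  refine ⟨H, Φ, hH, hO, hΦ, fun ι α => not_isIsotropic_and_not_isNonresonant hinv hacc, ?_,
    fun i p hp => exists_linear_actionTorus hp (hrot i p hp).choose_spec, hacc,
    fun hmix => Stage.isDiffusive (hdiff hmix) hnear fun z => (hΦ z).1⟩
  rintro K ⟨f⟩ hK
  have : CompactSpace K := f.symm.compactSpace
  exact exists_action_eq_zero_of_isCompact hacc (isCompact_iff_compactSpace.2 this)
    ⟨_, (f.symm 0).2⟩ fun t => Set.mapsTo_iff_image_subset.2 (hK t).subset
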